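/- Let $n\ge 1$, and let $f_0:\mathbb R^n\to[0,\infty)$ be an even function in $L^1(\mathbb R^n)$ that is nonzero, i.e. does not vanish almost everywhere. Let $(f_t)_{t\ge0}$ be the Fokker–Planck heat flow with initial data $f_0$: $f_t=f_0$ at $t=0$, and for $t>0$ $$f_t(x)=P_t^*f_0(x)=\int_{\mathbb R^n} e^{-\frac{|x-e^{-t}y|^2}{2(1-e^{-2t})}}\,\frac{f_0(y)\,dy}{(2\pi(1-e^{-2t}))^{n/2}},\qquad x\in\mathbb R^n .$$ For $f:\mathbb R^n\to[0,\infty)$ define the polar function $f^\circ(x)=\inf_{y\in\mathbb R^n}\frac{e^{-\langle x,y\rangle}}{f(y)}$ (with $\frac{e^{-\langle x,y\rangle}}{0}=+\infty$) and the functional volume product $v(f)=\int_{\mathbb R^n}f\,dx\int_{\mathbb R^n}f^\circ\,dx$. Then: 1. $f_t$ is a classical solution, for $t>0$, of $\partial_tf_t=\Delta f_t+\operatorname{div}(xf_t)$ with initial data $f_0$, attained in the sense that $f_t\to f_0$ in $L^1(\mathbb R^n)$ as $t\downarrow0$. 2. $v(f_{t_1})\le v(f_{t_2})$ for all $0\le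 t_1\le t_2$. 3. (Functional Blaschke–Santaló inequality for even functions.) $v(f_0)\le(2\pi)^n$. -/

import Mathlib

open MeasureTheory Filter
open scoped ENNReal Topology

noncomputable section

/-- Euclidean space `ℝⁿ` with its standard inner product, norm and Lebesgue measure. -/
abbrev Rn (n : ℕ) : Type := EuclideanSpace ℝ (Fin n)

/-- The polar function `f°(x) = inf_y e^{-⟨x, y⟩} / f(y)` of a nonnegative function `f`, with values
in `[0, ∞]`; a point `y` with `f y = 0` contributes the value `∞` to the infimum. -/
def polarFun {n : ℕ} (f : Rn n → ℝ) (x : Rn n) : ℝ≥0∞ :=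
  ⨅ y : Rn n, ENNReal.ofReal (Real.exp (-inner ℝ x y)) / ENNReal.ofReal (f y)

/-- The functional volume product `v(f) = ∫ f dx · ∫ f° dx` of a nonnegative function `f`. -/
def volumeProduct {n : ℕ} (f : Rn n → ℝ) : ℝ≥0∞ :=
  (∫⁻ x, ENNReal.ofReal (f x)) * ∫⁻ x, polarFun f x

/-- The Fokker-Planck heat flow `P_t^* f`, for `t ≥ 0`. It is `f` at `t = 0`, and for `t > 0`
`P_t^* f (x) = ∫ e^{-|x - e^{-t} y|² / (2 (1 - e^{-2t}))} f(y) dy / (2π (1 - e^{-2t}))^{n/2}`. -/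
def fokkerPlanckFlow {n : ℕ} (t : ℝ) (f : Rn n → ℝ) (x : Rn n) : ℝ :=
  if t = 0 then f x
  else ∫ y : Rn n, Real.exp (-‖x - Real.exp (-t) • y‖ ^ 2 / (2 * (1 - Real.exp (-2 * t)))) *
    (f y / (2 * Real.pi * (1 - Real.exp (-2 * t))) ^ ((n : ℝ) / 2))

/-- The divergence `∑ᵢ ∂ᵢ Fᵢ (x)` of a vector field `F` on `ℝⁿ`. -/
def divergence {n : ℕ} (F : Rn n → Rn n) (x : Rn n) : ℝ :=
  ∑ i : Fin n, (fderiv ℝ F x (EuclideanSpace.single i 1)) i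

/-- The Fokker-Planck operator `L^* f (x) = Δ f (x) + div (x f) (x)`. -/
def fokkerPlanckOp {n : ℕ} (f : Rn n → ℝ) (x : Rn n) : ℝ :=
  Laplacian.laplacian f x + divergence (fun y => f y • y) x

/-- `u` is a classical solution on `(0, ∞) × ℝⁿ` of the Fokker-Planck equation `∂ₜ u = L^* u`,
with initial data `f₀`, attained in the sense of `L¹(dx)`. -/
structure IsFokkerPlanckSolution {n : ℕ} (f₀ : Rn n → ℝ) (u : ℝ → Rn n → ℝ) : Prop where
  initial : u 0 = f₀
  contDiff : ∀ t : ℝ, 0 < t → ContDiff ℝ 2 (u t)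
  equation : ∀ t : ℝ, 0 < t → ∀ x : Rn n,
    HasDerivAt (fun s : ℝ => u s x) (fokkerPlanckOp (u t) x) t
  tendsto_initial : Tendsto (fun t : ℝ => ∫⁻ x, ‖u t x - f₀ x‖ₑ) (𝓝[>] 0) (𝓝 0)

end

/-! Mass is conserved, so the volume product grows as soon as `∫ f°` does. Up to a mass-preserving
dilation, which leaves `∫ f°` unchanged, the flow at time `t` is convolution with a Gaussian of
variance `e^{2t} - 1` (`fokkerPlanckFlow_eq_avg`, `lintegral_polarFun_fokkerPlanckFlow`). It
therefore has to be shown that `∫ f°` does not decrease when an even `f` is averaged against a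
Gaussian. A Gaussian on `ℝⁿ` is a convolution of Gaussians carried by the coordinate axes, so
averaging along a single line `ℝ a` suffices.

On a line the engine is Prékopa–Leindler. Put `G = √(f(· + a) f(· - a))`. Testing polars at `x ± a`
gives `f°(u) e^{⟨a,u⟩} · f°(v) e^{-⟨a,v⟩} ≤ G°((u + v)/2)²`. After division by the log-convex
function `cosh ⟨a, ·⟩`, evenness makes both factors on the left integrate to `∫ f°`, whence `∫ f° ≤
∫ G° / cosh ⟨a, ·⟩` (`lintegral_polarFun_le_geomShift`).

Now replace `a` by `r a` with `r → 0`. To second order the Gaussian average `H` exceeds `G` by the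
factor `exp (r² (∂ₐ log f)² / 2)`. For the polar at `z` only points near the maximisers of
`e^{⟨z,x⟩} f(x)` matter, and there `∂ₐ log f = -⟨a, z⟩`. So `H°(z)` is at least `G°(z) e^{-r² ⟨a,z⟩²
/ 2}` up to `o(r²)` (`eventually_polarFun_geomShift_le`), and this loss is exactly what `1 / cosh (r
⟨a, z⟩)` provides. Hence `∫ f° ≤ ∫ H° + o(r²)`; as `r²` is the variance, upper semicontinuity and
continuous induction give monotonicity (`NiceFun.lintegral_polarFun_le_avg_lineGauss`).

The expansion needs regularity, collected in `NiceFun`: it holds for Gaussian averages of functions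
of bounded support and persists under line averaging. General `f` is reached by letting the
preliminary averaging time tend to `0` and then removing a truncation.

For the Blaschke–Santaló bound, let `t → ∞`: the flow converges pointwise to the mass of `f₀` times
the standard Gaussian, whose polar is explicitly bounded, and upper semicontinuity of `∫ f°` closes
the argument. The equation itself comes from differentiating the kernel under the integral, and the
initial condition from a Scheffé argument for continuous data plus density and `L¹` contraction. -/

/-! ### The Prékopa-Leindler inequality at the midpoint -/

section PrekopaLeindler

/-- The midpoint Prékopa-Leindler inequality holds on the measured vector space `E`. -/
def HasMidpointPrekopaLeindler (E : Type*) [AddCommGroup E] [Module ℝ E] [MeasureSpace E] : Prop :=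
  ∀ f g h : E → ℝ≥0∞, Measurable f → Measurable g → Measurable h →
    (∀ x y, f x * g y ≤ h ((1 / 2 : ℝ) • (x + y)) ^ 2) →
    (∫⁻ x, f x) * (∫⁻ x, g x) ≤ (∫⁻ x, h x) ^ 2

open scoped Pointwise in
-- With `k = max K` and `l = min L`, the sets `(K + l)/2` and `(k + L)/2` both lie in `C` and can
-- meet only at `(k + l)/2`.
theorem volume_add_volume_le_of_isCompact {K L C : Set ℝ} (hK : IsCompact K) (hL : IsCompact L)
    (hK0 : K.Nonempty) (hL0 : L.Nonempty)
    (h : ∀ x ∈ K, ∀ y ∈ L, (1 / 2 : ℝ) * (x + y) ∈ C) :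
    volume K + volume L ≤ 2 * volume C := by
  obtain ⟨k, hk, hkmax⟩ := hK.exists_isGreatest hK0
  obtain ⟨l, hl, hlmin⟩ := hL.exists_isLeast hL0
  set K' : Set ℝ := (fun x => (1 / 2 : ℝ) * (x + l)) '' K
  set L' : Set ℝ := (fun y => (1 / 2 : ℝ) * (k + y)) '' L
  have hvol : ∀ (S : Set ℝ) (c : ℝ), volume ((fun x => (1 / 2 : ℝ) * (x + c)) '' S)
      = ENNReal.ofReal (1 / 2) * volume S := by
    intro S c
    have : (fun x => (1 / 2 : ℝ) * (x + c)) '' S = (1 / 2 : ℝ) • ((fun x => x + c) '' S) := by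
      rw [← Set.image_smul, Set.image_image]; rfl
    rw [this, Measure.addHaar_smul]
    simp
  have hK' : volume K' = ENNReal.ofReal (1 / 2) * volume K := hvol K l
  have hL' : volume L' = ENNReal.ofReal (1 / 2) * volume L := by
    rw [← hvol L k]; simp only [L', add_comm k]
  have hL'c : IsCompact L' := hL.image (by fun_prop)
  have hdisj : AEDisjoint volume K' L' := by
    refine measure_mono_null (t := {(1 / 2 : ℝ) * (k + l)}) ?_ (by simp)
    rintro z ⟨⟨x, hx, rfl⟩, ⟨y, hy, hxy⟩⟩
    have h1 : x ≤ k := hkmax hx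
    have h2 : l ≤ y := hlmin hy
    simp only at hxy
    simp only [Set.mem_singleton_iff]
    linarith
  have hsub : K' ∪ L' ⊆ C := by
    rintro z (⟨x, hx, rfl⟩ | ⟨y, hy, rfl⟩)
    · exact h x hx l hl
    · exact h k hk y hy
  have h3 := measure_mono (μ := volume) hsub
  rw [measure_union₀ hL'c.measurableSet.nullMeasurableSet hdisj, hK', hL', ← mul_add] at h3
  calc volume K + volume L = 2 * (ENNReal.ofReal (1 / 2) * (volume K + volume L)) := by
        rw [← mul_assoc]
        rw [show (2 : ℝ≥0∞) = ENNReal.ofReal 2 by simp, ← ENNReal.ofReal_mul (by norm_num)]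
        norm_num
    _ ≤ _ := by gcongr

/-- The one-dimensional Brunn-Minkowski inequality at the midpoint. -/
theorem volume_add_volume_le_of_midpoint_mem {S T C : Set ℝ} (hS : MeasurableSet S)
    (hT : MeasurableSet T) (hS0 : S.Nonempty) (hT0 : T.Nonempty)
    (h : ∀ x ∈ S, ∀ y ∈ T, (1 / 2 : ℝ) * (x + y) ∈ C) :
    volume S + volume T ≤ 2 * volume C := by
  have hsup : ∀ {S : Set ℝ}, MeasurableSet S → S.Nonempty →
      ∀ b : ℝ≥0∞, (∀ K ⊆ S, IsCompact K → K.Nonempty → volume K ≤ b) → volume S ≤ b := by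
    intro S hS hS0 b hb
    refine le_of_forall_lt fun q hq => ?_
    obtain ⟨K, hKS, hK, hqK⟩ := hS.exists_lt_isCompact hq
    have hne : K.Nonempty := by
      rw [Set.nonempty_iff_ne_empty]
      rintro rfl
      simp at hqK
    exact hqK.trans_le (hb K hKS hK hne)
  rcases eq_or_ne (volume C) ∞ with hC | hC
  · simp [hC]
  have hC2 : 2 * volume C ≠ ∞ := ENNReal.mul_ne_top (by simp) hC
  have hbase : ∀ K ⊆ S, IsCompact K → K.Nonempty → ∀ L ⊆ T, IsCompact L → L.Nonempty →
      volume K + volume L ≤ 2 * volume C := fun K hKS hK hK0 L hLT hL hL0 =>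
    volume_add_volume_le_of_isCompact hK hL hK0 hL0 fun x hx y hy => h x (hKS hx) y (hLT hy)
  -- Inner regularity is applied to one set at a time, first to `T` with `K` fixed, then to `S`.
  -- Each subtraction needs a finite volume, which is why `volume C = ∞` was split off.
  have h1 : ∀ K ⊆ S, IsCompact K → K.Nonempty → volume K + volume T ≤ 2 * volume C := by
    intro K hKS hK hK0
    have : volume T ≤ 2 * volume C - volume K := hsup hT hT0 _ fun L hLT hL hL0 =>
      ENNReal.le_sub_of_add_le_left hK.measure_lt_top.ne (hbase K hKS hK hK0 L hLT hL hL0)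
    obtain ⟨y, hy⟩ := hT0
    have hKC : volume K ≤ 2 * volume C :=
      le_self_add.trans (hbase K hKS hK hK0 {y} (by simpa) isCompact_singleton (by simp))
    calc volume K + volume T ≤ volume K + (2 * volume C - volume K) := by gcongr
      _ = 2 * volume C := add_tsub_cancel_of_le hKC
  obtain ⟨x, hx⟩ := hS0
  have hTC : volume T ≤ 2 * volume C :=
    le_add_self.trans (h1 {x} (by simpa) isCompact_singleton (by simp))
  have hTt : volume T ≠ ∞ := ne_top_of_le_ne_top hC2 hTC
  have : volume S ≤ 2 * volume C - volume T := hsup hS ⟨x, hx⟩ _ fun K hKS hK hK0 =>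
    ENNReal.le_sub_of_add_le_right hTt (h1 K hKS hK hK0)
  calc volume S + volume T ≤ (2 * volume C - volume T) + volume T := by gcongr
    _ = 2 * volume C := tsub_add_cancel_of_le hTC

/-- Layer cake plus Brunn–Minkowski on superlevel sets. Because `f` and `g` both have supremum `1`,
their level sets are nonempty for the same heights `t < 1` and both empty for `t ≥ 1`. -/
theorem lintegral_add_lintegral_le_of_midpoint {f g h : ℝ → ℝ} (hf : Measurable f)
    (hg : Measurable g) (hh : Measurable h) (hf0 : ∀ x, 0 ≤ f x) (hg0 : ∀ x, 0 ≤ g x)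
    (hh0 : ∀ x, 0 ≤ h x) (hf1 : ∀ x, f x ≤ 1) (hg1 : ∀ x, g x ≤ 1)
    (hfs : ∀ t < 1, ∃ x, t < f x) (hgs : ∀ t < 1, ∃ x, t < g x)
    (hfg : ∀ x y, f x * g y ≤ h ((1 / 2 : ℝ) * (x + y)) ^ 2) :
    (∫⁻ x, ENNReal.ofReal (f x)) + ∫⁻ x, ENNReal.ofReal (g x)
      ≤ 2 * ∫⁻ x, ENNReal.ofReal (h x) := by
  have hlayer : ∀ {k : ℝ → ℝ}, Measurable k → (∀ x, 0 ≤ k x) →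
      ∫⁻ x, ENNReal.ofReal (k x) = ∫⁻ t in Set.Ioi (0 : ℝ), volume {x | t < k x} :=
    fun hk hk0 => lintegral_eq_lintegral_meas_lt volume (Eventually.of_forall hk0) hk.aemeasurable
  have hmeas : ∀ {k : ℝ → ℝ}, Measurable k → Measurable fun t : ℝ => volume {x | t < k x} := by
    intro k _
    refine Antitone.measurable fun s t hst => measure_mono fun x (hx : t < k x) => ?_
    exact lt_of_le_of_lt hst hx
  rw [hlayer hf hf0, hlayer hg hg0, hlayer hh hh0, ← lintegral_add_left (hmeas hf),
    ← lintegral_const_mul _ (hmeas hh)]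
  refine setLIntegral_mono ((hmeas hh).const_mul _) fun t (ht : 0 < t) => ?_
  rcases lt_or_ge t 1 with h1 | h1
  · refine volume_add_volume_le_of_midpoint_mem (measurableSet_lt measurable_const hf)
      (measurableSet_lt measurable_const hg) (hfs t h1) (hgs t h1) fun x hx y hy => ?_
    have hx' : t < f x := hx
    have hy' : t < g y := hy
    have : t ^ 2 < h ((1 / 2 : ℝ) * (x + y)) ^ 2 := by
      have := hfg x y
      nlinarith
    exact lt_of_pow_lt_pow_left₀ 2 (hh0 _) this
  · have e1 : {x | t < f x} = ∅ := by
      ext x; simpa using (hf1 x).trans h1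
    have e2 : {x | t < g x} = ∅ := by
      ext x; simpa using (hg1 x).trans h1
    simp [e1, e2]

theorem ENNReal.four_mul_le_add_sq (x y : ℝ≥0∞) : 4 * (x * y) ≤ (x + y) ^ 2 := by
  rcases eq_or_ne x ∞ with rfl | hx
  · simp
  rcases eq_or_ne y ∞ with rfl | hy
  · simp
  lift x to NNReal using hx
  lift y to NNReal using hy
  norm_cast
  rw [← NNReal.coe_le_coe]
  push_cast
  nlinarith [sq_nonneg ((x : ℝ) - y)]

/-- Dividing `f`, `g` by their suprema `A`, `B` and `h` by `√(AB)` reduces to the additive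
inequality for functions of supremum `1`; the arithmetic-geometric mean inequality makes it
multiplicative. Unbounded `f`, `g` are truncated at integers. -/
theorem hasMidpointPrekopaLeindler_real : HasMidpointPrekopaLeindler ℝ := by
  have bdd : ∀ f g h : ℝ → ℝ≥0∞, Measurable f → Measurable g → Measurable h →
      (∃ N : ℕ, ∀ x, f x ≤ N) → (∃ N : ℕ, ∀ x, g x ≤ N) →
      (∀ x y, f x * g y ≤ h ((1 / 2 : ℝ) • (x + y)) ^ 2) →
      (∫⁻ x, f x) * (∫⁻ x, g x) ≤ (∫⁻ x, h x) ^ 2 := by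
    rintro f g h hf hg hh ⟨N, hN⟩ ⟨N', hN'⟩ hfg
    set A := ⨆ x, f x
    set B := ⨆ x, g x
    have hfA : ∀ x, f x ≤ A := fun x => le_iSup f x
    have hgB : ∀ x, g x ≤ B := fun x => le_iSup g x
    rcases eq_or_ne A 0 with hA | hA
    · have : ∀ x, f x = 0 := fun x => le_antisymm ((hfA x).trans hA.le) bot_le
      simp [this]
    rcases eq_or_ne B 0 with hB | hB
    · have : ∀ x, g x = 0 := fun x => le_antisymm ((hgB x).trans hB.le) bot_le
      simp [this]
    have hAt : A ≠ ∞ := ne_top_of_le_ne_top (ENNReal.natCast_ne_top N) (iSup_le hN)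
    have hBt : B ≠ ∞ := ne_top_of_le_ne_top (ENNReal.natCast_ne_top N') (iSup_le hN')
    set c := (A * B) ^ (1 / 2 : ℝ)
    have hcc : c ^ 2 = A * B := by
      rw [← ENNReal.rpow_natCast, ← ENNReal.rpow_mul]; norm_num
    have hABt : A * B ≠ ∞ := ENNReal.mul_ne_top hAt hBt
    have hc0 : c ≠ 0 := by
      intro h0; rw [h0] at hcc; simp at hcc; tauto
    have hct : c ≠ ∞ := by
      intro h0; rw [h0] at hcc; simp at hcc; exact hABt hcc.symm
    have norm_le : ∀ {k : ℝ → ℝ≥0∞} {D : ℝ≥0∞}, D ≠ 0 → D ≠ ∞ → (∀ x, k x ≤ D) → ∀ x, k x / D ≤ 1 :=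
      fun h0 ht hk x => ENNReal.div_le_of_le_mul (by simpa using hk x)
    have norm_sup : ∀ {k : ℝ → ℝ≥0∞}, (⨆ x, k x) ≠ 0 → (⨆ x, k x) ≠ ∞ → ∀ t < (1 : ℝ),
        ∃ x, t < (k x / ⨆ x, k x).toReal := by
      intro k h0 ht t ht1
      set D := ⨆ x, k x with hD
      have : ENNReal.ofReal t * D < D := by
        have := ENNReal.mul_lt_mul_left h0 ht (ENNReal.ofReal_lt_one.2 ht1)
        simpa using this
      obtain ⟨x, hx⟩ := lt_iSup_iff.1 this
      refine ⟨x, ?_⟩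
      have hfin : k x / D ≠ ∞ :=
        ne_top_of_le_ne_top ENNReal.one_ne_top (norm_le h0 ht (fun x => le_iSup k x) x)
      rcases lt_or_ge t 0 with h0' | h0'
      · exact h0'.trans_le ENNReal.toReal_nonneg
      rw [← ENNReal.ofReal_lt_iff_lt_toReal h0' hfin]
      exact (ENNReal.lt_div_iff_mul_lt (Or.inl h0) (Or.inl ht)).2 hx
    -- Capping `h / c` at `1` keeps it finite under `toReal` and costs nothing, since the normalised
    -- product on the left is at most `1`.
    have key := lintegral_add_lintegral_le_of_midpoint (f := fun x => (f x / A).toReal)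
      (g := fun x => (g x / B).toReal) (h := fun x => (min (h x / c) 1).toReal)
      (by fun_prop) (by fun_prop) (by fun_prop) (fun _ => ENNReal.toReal_nonneg)
      (fun _ => ENNReal.toReal_nonneg) (fun _ => ENNReal.toReal_nonneg)
      (fun x => ENNReal.toReal_le_of_le_ofReal zero_le_one (by simpa using norm_le hA hAt hfA x))
      (fun x => ENNReal.toReal_le_of_le_ofReal zero_le_one (by simpa using norm_le hB hBt hgB x))
      (norm_sup hA hAt) (norm_sup hB hBt) ?_
    · have efin : ∀ {k : ℝ → ℝ≥0∞}, (∀ x, k x ≤ 1) →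
          ∫⁻ x, ENNReal.ofReal (k x).toReal = ∫⁻ x, k x := fun hk =>
        lintegral_congr fun x => ENNReal.ofReal_toReal
          (ne_top_of_le_ne_top ENNReal.one_ne_top (hk x))
      rw [efin (norm_le hA hAt hfA), efin (norm_le hB hBt hgB), efin (fun x => min_le_right _ _)] at key
      have h1 : ∫⁻ x, min (h x / c) 1 ≤ (∫⁻ x, h x) / c := by
        rw [div_eq_mul_inv, ← lintegral_mul_const _ hh]
        exact lintegral_mono fun x => (min_le_left _ _)
      simp only [div_eq_mul_inv] at key h1
      rw [lintegral_mul_const _ hf, lintegral_mul_const _ hg] at key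
      set I := ∫⁻ x, f x
      set J := ∫⁻ x, g x
      set H := ∫⁻ x, h x
      have h2 : 4 * ((I * A⁻¹) * (J * B⁻¹)) ≤ 4 * (H ^ 2 * (c ^ 2)⁻¹) := by
        calc 4 * ((I * A⁻¹) * (J * B⁻¹)) ≤ (I * A⁻¹ + J * B⁻¹) ^ 2 := ENNReal.four_mul_le_add_sq _ _
          _ ≤ (2 * (H * c⁻¹)) ^ 2 := by
            gcongr
            exact key.trans (by gcongr)
          _ = 4 * (H ^ 2 * (c ^ 2)⁻¹) := by
            rw [mul_pow, mul_pow, ENNReal.inv_pow]; norm_num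
      rw [ENNReal.mul_le_mul_iff_right (by norm_num) (by norm_num), hcc,
        ENNReal.mul_inv (Or.inl hA) (Or.inl hAt)] at h2
      calc I * J = (I * A⁻¹) * (J * B⁻¹) * (A * B) := by
            calc I * J = (I * J) * ((A⁻¹ * A) * (B⁻¹ * B)) := by
                  rw [ENNReal.inv_mul_cancel hA hAt, ENNReal.inv_mul_cancel hB hBt]; simp
              _ = _ := by ring
        _ ≤ H ^ 2 * (A⁻¹ * B⁻¹) * (A * B) := by gcongr
        _ = H ^ 2 * ((A⁻¹ * A) * (B⁻¹ * B)) := by ring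
        _ = H ^ 2 := by
            rw [ENNReal.inv_mul_cancel hA hAt, ENNReal.inv_mul_cancel hB hBt]; simp
    · intro x y
      have h1 := hfg x y
      rw [smul_eq_mul] at h1
      rw [← ENNReal.toReal_mul, ← ENNReal.toReal_pow]
      refine ENNReal.toReal_mono (ENNReal.pow_ne_top
        (ne_top_of_le_ne_top ENNReal.one_ne_top (min_le_right _ _))) ?_
      have h3 : f x / A * (g y / B) ≤ 1 := mul_le_one' (norm_le hA hAt hfA x) (norm_le hB hBt hgB y)
      rcases min_choice (h ((1 / 2 : ℝ) * (x + y)) / c) 1 with h2 | h2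
      · rw [h2]
        calc f x / A * (g y / B) = (f x * g y) * (c ^ 2)⁻¹ := by
              rw [hcc, ENNReal.mul_inv (Or.inl hA) (Or.inl hAt), div_eq_mul_inv, div_eq_mul_inv]
              ring
          _ ≤ h ((1 / 2 : ℝ) * (x + y)) ^ 2 * (c ^ 2)⁻¹ := by gcongr
          _ = (h ((1 / 2 : ℝ) * (x + y)) / c) ^ 2 := by
              rw [ENNReal.div_eq_inv_mul (b := c), mul_pow, ENNReal.inv_pow, mul_comm]
      · rw [h2]; simpa using h3
  intro f g h hf hg hh hfg
  have hsup : ∀ {k : ℝ → ℝ≥0∞}, Measurable k →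
      ∫⁻ x, k x = ⨆ N : ℕ, ∫⁻ x, min (k x) N := by
    intro k hk
    rw [← lintegral_iSup (fun N => hk.min measurable_const)
      (fun N N' hN x => min_le_min_left _ (by exact_mod_cast hN))]
    refine lintegral_congr fun x => ?_
    rw [← inf_iSup_eq, ENNReal.iSup_natCast, inf_top_eq]
  rw [hsup hf, hsup hg, ENNReal.iSup_mul]
  refine iSup_le fun N => ?_
  rw [ENNReal.mul_iSup]
  refine iSup_le fun N' => ?_
  exact bdd _ _ h (hf.min measurable_const) (hg.min measurable_const) hh
    ⟨N, fun _ => min_le_right _ _⟩ ⟨N', fun _ => min_le_right _ _⟩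
    fun x y => (mul_le_mul' (min_le_left _ _) (min_le_left _ _)).trans (hfg x y)

/-- The inequality on the fibres `F` is precisely the midpoint hypothesis for the marginals on `E`.
-/
theorem HasMidpointPrekopaLeindler.prod {E F : Type*} [AddCommGroup E] [Module ℝ E]
    [MeasureSpace E] [SFinite (volume : Measure E)] [AddCommGroup F] [Module ℝ F] [MeasureSpace F]
    [SFinite (volume : Measure F)]
    (hE : HasMidpointPrekopaLeindler E) (hF : HasMidpointPrekopaLeindler F) :
    HasMidpointPrekopaLeindler (E × F) := by
  intro f g h hf hg hh hfg
  rw [Measure.volume_eq_prod, lintegral_prod _ hf.aemeasurable, lintegral_prod _ hg.aemeasurable,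
    lintegral_prod _ hh.aemeasurable]
  refine hE _ _ _ hf.lintegral_prod_right' hg.lintegral_prod_right' hh.lintegral_prod_right'
    fun x y => ?_
  exact hF _ _ _ (by fun_prop) (by fun_prop) (by fun_prop) fun u v => hfg (x, u) (y, v)

theorem HasMidpointPrekopaLeindler.of_equiv {E F : Type*} [AddCommGroup E] [Module ℝ E]
    [MeasureSpace E] [AddCommGroup F] [Module ℝ F] [MeasureSpace F] (e : E → F)
    (he : MeasurePreserving e) (hadd : ∀ x y, e (x + y) = e x + e y)
    (hsmul : ∀ (c : ℝ) x, e (c • x) = c • e x)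
    (hE : HasMidpointPrekopaLeindler E) : HasMidpointPrekopaLeindler F := by
  intro f g h hf hg hh hfg
  rw [← he.lintegral_comp hf, ← he.lintegral_comp hg, ← he.lintegral_comp hh]
  refine hE _ _ _ (hf.comp he.measurable) (hg.comp he.measurable) (hh.comp he.measurable)
    fun x y => ?_
  simpa only [hsmul, hadd] using hfg (e x) (e y)

theorem hasMidpointPrekopaLeindler_pi (n : ℕ) : HasMidpointPrekopaLeindler (Fin n → ℝ) := by
  induction n with
  | zero =>
    intro f g h hf hg hh hfg
    have h1 : ∀ k : (Fin 0 → ℝ) → ℝ≥0∞, ∫⁻ x, k x = k 0 := by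
      intro k
      rw [volume_pi, Measure.pi_of_empty _ 0, lintegral_dirac]
    rw [h1, h1, h1]
    exact (hfg 0 0).trans (by simp)
  | succ n ih =>
    refine (hasMidpointPrekopaLeindler_real.prod ih).of_equiv
      (MeasurableEquiv.piFinSuccAbove (fun _ : Fin (n + 1) => ℝ) 0).symm
      (volume_preserving_piFinSuccAbove (fun _ => ℝ) 0).symm ?_ ?_
    · intro x y
      ext i
      refine Fin.cases ?_ (fun j => ?_) i <;> simp [MeasurableEquiv.piFinSuccAbove]
    · intro c x
      ext i
      refine Fin.cases ?_ (fun j => ?_) i <;> simp [MeasurableEquiv.piFinSuccAbove]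

theorem hasMidpointPrekopaLeindler_euclidean (n : ℕ) : HasMidpointPrekopaLeindler (Rn n) :=
  (hasMidpointPrekopaLeindler_pi n).of_equiv _ (PiLp.volume_preserving_toLp (Fin n))
    (fun _ _ => rfl) (fun _ _ => rfl)

end PrekopaLeindler

/-! ### Polar functions -/

section Polar

variable {n : ℕ}

theorem le_polarFun_iff {f : Rn n → ℝ} {z : Rn n} {c : ℝ≥0∞} :
    c ≤ polarFun f z ↔
      ∀ y, c * ENNReal.ofReal (f y) ≤ ENNReal.ofReal (Real.exp (-inner ℝ z y)) := by
  unfold polarFun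
  rw [le_iInf_iff]
  refine forall_congr' fun y => ?_
  refine ENNReal.le_div_iff_mul_le (Or.inr ?_) (Or.inl ENNReal.ofReal_ne_top)
  simpa using Real.exp_pos _

theorem polarFun_mul_le (f : Rn n → ℝ) (z y : Rn n) :
    polarFun f z * ENNReal.ofReal (f y) ≤ ENNReal.ofReal (Real.exp (-inner ℝ z y)) :=
  le_polarFun_iff.1 le_rfl y

theorem polarFun_anti {f g : Rn n → ℝ} (h : ∀ x, f x ≤ g x) (z : Rn n) :
    polarFun g z ≤ polarFun f z :=
  iInf_mono fun y => ENNReal.div_le_div_left (ENNReal.ofReal_le_ofReal (h y)) _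

/-- An infimum of continuous functions is upper semicontinuous, so no regularity of `f` is required;
points where `f` vanishes contribute the constant `∞`. -/
theorem measurable_polarFun (f : Rn n → ℝ) : Measurable (polarFun f) := by
  have : UpperSemicontinuous (polarFun f) := by
    refine upperSemicontinuous_iInf fun y => Continuous.upperSemicontinuous ?_
    by_cases h : ENNReal.ofReal (f y) = 0
    · have : (fun x : Rn n => ENNReal.ofReal (Real.exp (-inner ℝ x y)) / ENNReal.ofReal (f y))
          = fun _ => ∞ := by
        ext x
        rw [h, ENNReal.div_zero]
        simpa using Real.exp_pos _
      rw [this]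
      exact continuous_const
    · refine ENNReal.continuous_div_const _ h |>.comp (ENNReal.continuous_ofReal.comp ?_)
      fun_prop
  exact this.measurable

theorem polarFun_neg {f : Rn n → ℝ} (hf : ∀ x, f (-x) = f x) (z : Rn n) :
    polarFun f (-z) = polarFun f z := by
  unfold polarFun
  refine (Equiv.neg (Rn n)).iInf_congr fun y => ?_
  simp [hf]

/-- Test the infimum at the point of norm `ρ` in the direction of `z`. With `ρ = 1` this is the
integrable majorant behind every limit of polar integrals. -/
theorem polarFun_le_exp_neg_norm {f : Rn n → ℝ} {c ρ : ℝ} (hc : 0 < c) (hρ : 0 ≤ ρ)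
    (hf : ∀ x, ‖x‖ ≤ ρ → c ≤ f x) (z : Rn n) :
    polarFun f z ≤ ENNReal.ofReal (c⁻¹ * Real.exp (-(ρ * ‖z‖))) := by
  have hy : ‖(ρ * ‖z‖⁻¹) • z‖ ≤ ρ := by
    rcases eq_or_ne z 0 with rfl | hz
    · simpa using hρ
    · have : ‖z‖ ≠ 0 := by simpa using hz
      rw [norm_smul, norm_mul, norm_inv, norm_norm, Real.norm_of_nonneg hρ, mul_assoc,
        inv_mul_cancel₀ this, mul_one]
  have hin : inner ℝ z ((ρ * ‖z‖⁻¹) • z) = ρ * ‖z‖ := by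
    rw [inner_smul_right, real_inner_self_eq_norm_sq]
    rcases eq_or_ne z 0 with rfl | hz
    · simp
    · have : ‖z‖ ≠ 0 := by simpa using hz
      field_simp
  refine (iInf_le _ ((ρ * ‖z‖⁻¹) • z)).trans ?_
  rw [hin]
  calc _ ≤ ENNReal.ofReal (Real.exp (-(ρ * ‖z‖))) / ENNReal.ofReal c := by
        gcongr
        exact hf _ hy
    _ = _ := by
        rw [← ENNReal.ofReal_div_of_pos hc, div_eq_inv_mul]

/-- From `(1 + ‖z‖)^m ≤ m! e^{1 + ‖z‖}` with `m = n + k + 1`: the power `k` is absorbed and `(1 +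
‖z‖)^{-(n+1)}` is left, which is integrable. -/
theorem lintegral_exp_neg_norm_mul_lt_top (n k : ℕ) :
    ∫⁻ z : Rn n, ENNReal.ofReal (Real.exp (-‖z‖) * (1 + ‖z‖) ^ k) < ∞ := by
  set m := n + k + 1
  have hint : Integrable (fun z : Rn n => (1 + ‖z‖) ^ (-((n + 1 : ℕ) : ℝ))) volume :=
    integrable_one_add_norm (by simp)
  have hint2 := hint.const_mul (Real.exp 1 * (m.factorial : ℝ))
  refine lt_of_le_of_lt (lintegral_mono fun z => ENNReal.ofReal_le_ofReal ?_)
    hint2.lintegral_lt_top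
  have hz : 0 < 1 + ‖z‖ := by positivity
  have h1 := Real.pow_div_factorial_le_exp (1 + ‖z‖) hz.le m
  rw [Real.rpow_neg hz.le, Real.rpow_natCast, ← div_eq_mul_inv, le_div_iff₀ (by positivity)]
  rw [div_le_iff₀ (by positivity), Real.exp_add] at h1
  calc Real.exp (-‖z‖) * (1 + ‖z‖) ^ k * (1 + ‖z‖) ^ (n + 1)
      = Real.exp (-‖z‖) * (1 + ‖z‖) ^ m := by simp only [m]; ring
    _ ≤ Real.exp (-‖z‖) * (Real.exp 1 * Real.exp ‖z‖ * m.factorial) := by gcongr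
    _ = (Real.exp (-‖z‖) * Real.exp ‖z‖) * (Real.exp 1 * m.factorial) := by ring
    _ = _ := by rw [← Real.exp_add]; simp

theorem lintegral_const_mul_exp_neg_norm_lt_top (n : ℕ) (c : ℝ) :
    ∫⁻ z : Rn n, ENNReal.ofReal (c * Real.exp (-(1 * ‖z‖))) < ∞ := by
  have h := lintegral_exp_neg_norm_mul_lt_top n 0
  simp only [pow_zero, mul_one] at h
  rcases le_total c 0 with hc | hc
  · simp [ENNReal.ofReal_of_nonpos (mul_nonpos_of_nonpos_of_nonneg hc (Real.exp_nonneg _))]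
  simp only [ENNReal.ofReal_mul hc, one_mul]
  rw [lintegral_const_mul _ (by fun_prop)]
  exact ENNReal.mul_lt_top ENNReal.ofReal_lt_top h

/-- One competitor `y` already brings the infimum below `b`, and its value depends continuously on
`f y`. -/
theorem eventually_polarFun_lt {ι : Type*} {l : Filter ι} {F : ι → Rn n → ℝ} {f : Rn n → ℝ}
    (hF : ∀ x, Tendsto (fun k => F k x) l (𝓝 (f x))) {z : Rn n} {b : ℝ≥0∞}
    (hb : polarFun f z < b) : ∀ᶠ k in l, polarFun (F k) z < b := by
  obtain ⟨y, hy⟩ := iInf_lt_iff.1 hb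
  have h1 : Tendsto (fun k => ENNReal.ofReal (Real.exp (-inner ℝ z y)) / ENNReal.ofReal (F k y)) l
      (𝓝 (ENNReal.ofReal (Real.exp (-inner ℝ z y)) / ENNReal.ofReal (f y))) := by
    refine ENNReal.Tendsto.div tendsto_const_nhds (Or.inl ?_)
      (ENNReal.tendsto_ofReal (hF y)) (Or.inl ENNReal.ofReal_ne_top)
    simpa using Real.exp_pos _
  filter_upwards [h1.eventually_lt_const hy] with k hk
  exact (iInf_le _ y).trans_lt hk

/-- Upper semicontinuity of `f ↦ ∫ f°` under pointwise convergence. -/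
theorem eventually_lintegral_polarFun_lt {ι : Type*} {l : Filter ι} [l.IsCountablyGenerated]
    {F : ι → Rn n → ℝ} {f : Rn n → ℝ} (hF : ∀ x, Tendsto (fun k => F k x) l (𝓝 (f x)))
    {c : ℝ} (hc : 0 < c) (hFc : ∀ᶠ k in l, ∀ x, ‖x‖ ≤ 1 → c ≤ F k x) {b : ℝ≥0∞}
    (hb : ∫⁻ z, polarFun f z < b) : ∀ᶠ k in l, ∫⁻ z, polarFun (F k) z < b := by
  rcases l.eq_or_neBot with rfl | hl
  · simp
  have hfc : ∀ x, ‖x‖ ≤ 1 → c ≤ f x := fun x hx =>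
    ge_of_tendsto (hF x) (hFc.mono fun k hk => hk x hx)
  -- Taking the maximum with the limit polar turns upper semicontinuity into pointwise convergence,
  -- so that dominated convergence applies.
  have h1 : Tendsto (fun k => ∫⁻ z, max (polarFun (F k) z) (polarFun f z)) l
      (𝓝 (∫⁻ z, polarFun f z)) := by
    refine tendsto_lintegral_filter_of_dominated_convergence
      (fun z => ENNReal.ofReal (c⁻¹ * Real.exp (-(1 * ‖z‖))))
      (Eventually.of_forall fun k => (measurable_polarFun _).max (measurable_polarFun _)) ?_
      (lintegral_const_mul_exp_neg_norm_lt_top n _).ne ?_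
    · filter_upwards [hFc] with k hk
      exact Eventually.of_forall fun z => max_le
        (polarFun_le_exp_neg_norm hc zero_le_one hk z)
        (polarFun_le_exp_neg_norm hc zero_le_one hfc z)
    · refine Eventually.of_forall fun z => ?_
      refine tendsto_order.2 ⟨fun a ha => Eventually.of_forall fun k => ha.trans_le
        (le_max_right _ _), fun a ha => ?_⟩
      filter_upwards [eventually_polarFun_lt hF ha] with k hk
      exact max_lt hk ha
  filter_upwards [h1.eventually_lt_const hb] with k hk
  exact (lintegral_mono fun z => le_max_left _ _).trans_lt hk

/-! ### Geometric means of translates and Prékopa–Leindler for polars -/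

/-- The geometric mean of the two translates of `f` by `a` and `-a`. -/
noncomputable def geomShift (a : Rn n) (f : Rn n → ℝ) (x : Rn n) : ℝ := √(f (x + a) * f (x - a))

/-- The polar at `u` is tested at `x + a` and the one at `v` at `x - a`; the exponential weights
cancel the shifts and leave `e^{-⟨u + v, x⟩}`, the square of the bound required at the midpoint. -/
theorem polarFun_mul_polarFun_le_geomShift {f : Rn n → ℝ} (hf : ∀ x, 0 ≤ f x) (a u v : Rn n) :
    (polarFun f u * ENNReal.ofReal (Real.exp (inner ℝ a u))) *
      (polarFun f v * ENNReal.ofReal (Real.exp (-inner ℝ a v)))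
      ≤ polarFun (geomShift a f) ((1 / 2 : ℝ) • (u + v)) ^ 2 := by
  set P := (polarFun f u * ENNReal.ofReal (Real.exp (inner ℝ a u))) *
      (polarFun f v * ENNReal.ofReal (Real.exp (-inner ℝ a v)))
  have hP : (P ^ (1 / 2 : ℝ)) ^ 2 = P := by
    rw [← ENNReal.rpow_natCast, ← ENNReal.rpow_mul]; norm_num
  rw [← hP]
  gcongr
  rw [le_polarFun_iff]
  intro x
  refine (ENNReal.pow_le_pow_left_iff two_ne_zero).1 ?_
  rw [mul_pow, hP, geomShift, ← ENNReal.ofReal_pow (Real.sqrt_nonneg _),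
    Real.sq_sqrt (mul_nonneg (hf _) (hf _)), ENNReal.ofReal_mul (hf _)]
  calc P * (ENNReal.ofReal (f (x + a)) * ENNReal.ofReal (f (x - a)))
      = (polarFun f u * ENNReal.ofReal (f (x + a))) * ENNReal.ofReal (Real.exp (inner ℝ a u)) *
        ((polarFun f v * ENNReal.ofReal (f (x - a))) *
          ENNReal.ofReal (Real.exp (-inner ℝ a v))) := by simp only [P]; ring
    _ ≤ ENNReal.ofReal (Real.exp (-inner ℝ u (x + a))) * ENNReal.ofReal (Real.exp (inner ℝ a u)) *
        (ENNReal.ofReal (Real.exp (-inner ℝ v (x - a))) *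
          ENNReal.ofReal (Real.exp (-inner ℝ a v))) := by
        gcongr <;> exact polarFun_mul_le _ _ _
    _ = _ := by
        rw [← ENNReal.ofReal_mul (by positivity), ← ENNReal.ofReal_mul (by positivity),
          ← ENNReal.ofReal_mul (by positivity), ← ENNReal.ofReal_pow (by positivity),
          ← Real.exp_add, ← Real.exp_add, ← Real.exp_add, ← Real.exp_nat_mul]
        congr 2
        simp only [inner_smul_left, inner_add_left, inner_add_right, inner_sub_right,
          real_inner_comm a]
        norm_num
        ring

/-- Log-convexity of `cosh`: `2 cosh p cosh q = cosh (p + q) + cosh (p - q) ≥ cosh (p + q) + 1`. -/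
theorem Real.cosh_midpoint_sq_le (p q : ℝ) :
    Real.cosh ((1 / 2) * (p + q)) ^ 2 ≤ Real.cosh p * Real.cosh q := by
  have h1 := Real.cosh_add p q
  have h2 := Real.cosh_sub p q
  have h3 := Real.one_le_cosh (p - q)
  have h4 := Real.cosh_two_mul ((1 / 2) * (p + q))
  have h5 := Real.cosh_sq ((1 / 2) * (p + q))
  rw [show 2 * ((1 / 2) * (p + q)) = p + q by ring] at h4
  linarith

/-- Apply Prékopa–Leindler to `f°` weighted by `e^{±⟨a,·⟩} / cosh ⟨a,·⟩`. The two weighted functions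
are reflections of each other because `f°` is even, and they sum to `2 f°`, so each has integral `∫
f°`. This is where evenness of `f` enters decisively. -/
theorem lintegral_polarFun_le_geomShift {f : Rn n → ℝ} (hf : ∀ x, 0 ≤ f x)
    (hfe : ∀ x, f (-x) = f x) (a : Rn n) :
    ∫⁻ z, polarFun f z ≤
      ∫⁻ z, polarFun (geomShift a f) z * ENNReal.ofReal (Real.cosh (inner ℝ a z))⁻¹ := by
  set f₁ : Rn n → ℝ≥0∞ := fun u => (polarFun f u * ENNReal.ofReal (Real.exp (inner ℝ a u))) *
    ENNReal.ofReal (Real.cosh (inner ℝ a u))⁻¹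
  set f₂ : Rn n → ℝ≥0∞ := fun u => (polarFun f u * ENNReal.ofReal (Real.exp (-inner ℝ a u))) *
    ENNReal.ofReal (Real.cosh (inner ℝ a u))⁻¹
  have hm : Measurable fun u : Rn n => ENNReal.ofReal (Real.cosh (inner ℝ a u))⁻¹ := by
    have : Measurable Real.cosh := Real.continuous_cosh.measurable
    fun_prop
  have hf₁ : Measurable f₁ := ((measurable_polarFun f).mul (by fun_prop)).mul hm
  have hf₂ : Measurable f₂ := ((measurable_polarFun f).mul (by fun_prop)).mul hm
  have h12 : ∫⁻ u, f₂ u = ∫⁻ u, f₁ u := by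
    rw [← (Measure.measurePreserving_neg (volume : Measure (Rn n))).lintegral_comp hf₁]
    refine lintegral_congr fun u => ?_
    simp [f₁, f₂, polarFun_neg hfe, inner_neg_right]
  have hsum : ∫⁻ u, f₁ u + f₂ u = 2 * ∫⁻ u, polarFun f u := by
    rw [← lintegral_const_mul _ (measurable_polarFun f)]
    refine lintegral_congr fun u => ?_
    simp only [f₁, f₂]
    rw [← add_mul, ← mul_add, mul_assoc, ← ENNReal.ofReal_add (by positivity) (by positivity),
      ← ENNReal.ofReal_mul (by positivity), mul_comm]
    congr 1
    have hexp := Real.cosh_eq (inner ℝ a u)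
    have := (Real.cosh_pos (inner ℝ a u)).ne'
    refine Eq.trans (congrArg ENNReal.ofReal ?_) (ENNReal.ofReal_ofNat 2)
    rw [← div_eq_mul_inv, div_eq_iff this]
    linarith
  rw [lintegral_add_left hf₁, h12, ← two_mul] at hsum
  have heq : ∫⁻ u, f₁ u = ∫⁻ u, polarFun f u :=
    (ENNReal.mul_right_inj two_ne_zero ENNReal.ofNat_ne_top).1 hsum
  have key := hasMidpointPrekopaLeindler_euclidean n f₁ f₂ _ hf₁ hf₂
    ((measurable_polarFun (geomShift a f)).mul hm) fun u v => ?_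
  · rw [h12, heq, ← sq] at key
    exact (ENNReal.pow_le_pow_left_iff two_ne_zero).1 key
  · calc f₁ u * f₂ v = ((polarFun f u * ENNReal.ofReal (Real.exp (inner ℝ a u))) *
          (polarFun f v * ENNReal.ofReal (Real.exp (-inner ℝ a v)))) *
          (ENNReal.ofReal (Real.cosh (inner ℝ a u))⁻¹ *
            ENNReal.ofReal (Real.cosh (inner ℝ a v))⁻¹) := by simp only [f₁, f₂]; ring
      _ ≤ polarFun (geomShift a f) ((1 / 2 : ℝ) • (u + v)) ^ 2 *
          ENNReal.ofReal (Real.cosh (inner ℝ a ((1 / 2 : ℝ) • (u + v))))⁻¹ ^ 2 := by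
        gcongr
        · exact polarFun_mul_polarFun_le_geomShift hf a u v
        · rw [← ENNReal.ofReal_mul (inv_nonneg.2 (Real.cosh_pos _).le),
            ← ENNReal.ofReal_pow (inv_nonneg.2 (Real.cosh_pos _).le)]
          refine ENNReal.ofReal_le_ofReal ?_
          rw [← mul_inv, inv_pow]
          refine inv_anti₀ (pow_pos (Real.cosh_pos _) 2) ?_
          rw [inner_smul_right, inner_add_right]
          exact Real.cosh_midpoint_sq_le _ _
      _ = _ := by rw [Pi.mul_apply, mul_pow]

end Polar

/-! ### Gaussian measures and averages -/

section Gaussian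

variable {n : ℕ}

open ProbabilityTheory

/-- The average of the translates of `f` with respect to `μ`. -/
noncomputable def avg (μ : Measure (Rn n)) (f : Rn n → ℝ) (x : Rn n) : ℝ := ∫ w, f (x + w) ∂μ

/-- The heat kernel, i.e. the density of the centered Gaussian of covariance `s • 1`. -/
noncomputable def gaussKernel (s : ℝ) (x : Rn n) : ℝ :=
  Real.exp (-‖x‖ ^ 2 / (2 * s)) / (2 * Real.pi * s) ^ ((n : ℝ) / 2)

/-- The centered Gaussian measure of covariance `s • 1`, for `s > 0`. -/
noncomputable def gaussVec (n : ℕ) (s : ℝ) : Measure (Rn n) :=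
  volume.withDensity fun x => ENNReal.ofReal (gaussKernel s x)

/-- The law of `Z • b` for a standard Gaussian variable `Z`. -/
noncomputable def lineGauss (b : Rn n) : Measure (Rn n) :=
  (gaussianReal 0 1).map fun τ => τ • b

theorem gaussKernel_pos {s : ℝ} (hs : 0 < s) (x : Rn n) : 0 < gaussKernel s x := by
  unfold gaussKernel; positivity

theorem continuous_gaussKernel (s : ℝ) : Continuous (gaussKernel s : Rn n → ℝ) := by
  unfold gaussKernel
  exact Continuous.div_const (by fun_prop) _

theorem gaussKernel_neg (s : ℝ) (x : Rn n) : gaussKernel s (-x) = gaussKernel s x := by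
  simp [gaussKernel]

theorem gaussKernel_eq (s : ℝ) (x : Rn n) : gaussKernel s x =
    ((2 * Real.pi * s) ^ ((n : ℝ) / 2))⁻¹ * Real.exp (-(1 / (2 * s)) * ‖x‖ ^ 2) := by
  rw [gaussKernel, div_eq_inv_mul]
  congr 2
  ring

theorem integrable_gaussKernel {s : ℝ} (hs : 0 < s) :
    Integrable (gaussKernel s : Rn n → ℝ) volume := by
  refine Integrable.congr (Integrable.const_mul ?_ _)
    (Eventually.of_forall fun x => (gaussKernel_eq s x).symm)
  have := GaussianFourier.integrable_cexp_neg_mul_sq_norm_add (V := Rn n)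
    (b := ((1 / (2 * s) : ℝ) : ℂ)) (by simpa using hs) 0 0
  refine this.norm.congr (Eventually.of_forall fun x => ?_)
  beta_reduce
  rw [Complex.norm_exp, zero_mul, add_zero, ← Complex.ofReal_neg, ← Complex.ofReal_pow,
    ← Complex.ofReal_mul, Complex.ofReal_re]

theorem integral_gaussKernel {s : ℝ} (hs : 0 < s) : ∫ x : Rn n, gaussKernel s x = 1 := by
  simp_rw [gaussKernel_eq]
  rw [integral_const_mul, GaussianFourier.integral_rexp_neg_mul_sq_norm (by positivity)]
  rw [finrank_euclideanSpace_fin, show Real.pi / (1 / (2 * s)) = 2 * Real.pi * s by field_simp]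
  exact inv_mul_cancel₀ (by positivity)

theorem lintegral_gaussKernel {s : ℝ} (hs : 0 < s) :
    ∫⁻ x : Rn n, ENNReal.ofReal (gaussKernel s x) = 1 := by
  rw [← ofReal_integral_eq_lintegral_ofReal (integrable_gaussKernel hs)
    (Eventually.of_forall fun x => (gaussKernel_pos hs x).le), integral_gaussKernel hs]
  simp

theorem isProbabilityMeasure_gaussVec {s : ℝ} (hs : 0 < s) :
    IsProbabilityMeasure (gaussVec n s) :=
  ⟨by rw [gaussVec, withDensity_apply _ MeasurableSet.univ, Measure.restrict_univ,
    lintegral_gaussKernel hs]⟩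

instance isProbabilityMeasure_lineGauss (b : Rn n) : IsProbabilityMeasure (lineGauss b) :=
  Measure.isProbabilityMeasure_map (by fun_prop)

theorem integral_gaussVec {E : Type*} [NormedAddCommGroup E] [NormedSpace ℝ E] {s : ℝ} (hs : 0 < s)
    (f : Rn n → E) : ∫ x, f x ∂(gaussVec n s) = ∫ x, gaussKernel s x • f x := by
  rw [gaussVec, integral_withDensity_eq_integral_toReal_smul
    (by have := (continuous_gaussKernel (n := n) s).measurable; fun_prop) (by simp)]
  simp [ENNReal.toReal_ofReal (gaussKernel_pos hs _).le]

theorem lintegral_gaussVec (s : ℝ) {f : Rn n → ℝ≥0∞} (hf : Measurable f) :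
    ∫⁻ x, f x ∂(gaussVec n s) = ∫⁻ x, ENNReal.ofReal (gaussKernel s x) * f x := by
  have := (continuous_gaussKernel (n := n) s).measurable
  rw [gaussVec, lintegral_withDensity_eq_lintegral_mul _ (by fun_prop) hf]
  rfl

/-- Completing the square: the tilted kernel is a multiple of the kernel translated to the centre
`-s • z`. -/
theorem lintegral_exp_gaussVec {s : ℝ} (hs : 0 < s) (z : Rn n) :
    ∫⁻ w, ENNReal.ofReal (Real.exp (-inner ℝ w z)) ∂(gaussVec n s)
      = ENNReal.ofReal (Real.exp (s * ‖z‖ ^ 2 / 2)) := by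
  rw [lintegral_gaussVec s (by fun_prop)]
  have h : ∀ w : Rn n, ENNReal.ofReal (gaussKernel s w) *
      ENNReal.ofReal (Real.exp (-inner ℝ w z)) =
      ENNReal.ofReal (Real.exp (s * ‖z‖ ^ 2 / 2)) * ENNReal.ofReal (gaussKernel s (w + s • z)) := by
    intro w
    rw [← ENNReal.ofReal_mul (gaussKernel_pos hs w).le, ← ENNReal.ofReal_mul (by positivity)]
    congr 1
    simp only [gaussKernel]
    rw [div_mul_eq_mul_div, ← Real.exp_add, mul_div_assoc', ← Real.exp_add]
    congr 2
    rw [norm_add_sq_real, inner_smul_right, norm_smul, Real.norm_of_nonneg hs.le]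
    field_simp
    ring
  have hm := (continuous_gaussKernel (n := n) s).measurable
  simp_rw [h]
  rw [lintegral_const_mul _ (by fun_prop),
    lintegral_add_right_eq_self (fun w => ENNReal.ofReal (gaussKernel s w)),
    lintegral_gaussKernel hs, mul_one]

theorem lintegral_exp_lineGauss (b z : Rn n) :
    ∫⁻ w, ENNReal.ofReal (Real.exp (-inner ℝ w z)) ∂(lineGauss b)
      = ENNReal.ofReal (Real.exp (inner ℝ b z ^ 2 / 2)) := by
  rw [lineGauss, lintegral_map (by fun_prop) (by fun_prop)]
  have h := congrFun (mgf_fun_id_gaussianReal (μ := 0) (v := 1)) (-inner ℝ b z)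
  simp only [mgf] at h
  have hi := integrable_exp_mul_gaussianReal (μ := 0) (v := 1) (-inner ℝ b z)
  simp only [inner_smul_left]
  rw [show (fun τ : ℝ => ENNReal.ofReal (Real.exp (-((starRingEnd ℝ) τ * inner ℝ b z)))) =
    fun τ => ENNReal.ofReal (Real.exp (-inner ℝ b z * τ)) from
      funext fun τ => by congr 2; simp; ring]
  rw [← ofReal_integral_eq_lintegral_ofReal hi (Eventually.of_forall fun τ => (Real.exp_pos _).le),
    h]
  congr 2
  simp

/-- Characteristic functions serve to identify convolutions, reflections and rescalings of these
measures without computing with densities. -/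
theorem charFun_gaussVec {s : ℝ} (hs : 0 < s) (t : Rn n) :
    charFun (gaussVec n s) t = Complex.exp ((-(s * ‖t‖ ^ 2 / 2) : ℝ)) := by
  have hc : ∀ v : Rn n, gaussKernel s v • Complex.exp (inner ℝ v t * Complex.I) =
      ((((2 * Real.pi * s) ^ ((n : ℝ) / 2))⁻¹ : ℝ) : ℂ) *
      Complex.exp (-((1 / (2 * s) : ℝ) : ℂ) * (‖v‖ : ℂ) ^ 2 + Complex.I * (inner ℝ t v : ℝ)) := by
    intro v
    rw [gaussKernel_eq, Complex.real_smul, Complex.ofReal_mul, Complex.ofReal_exp, mul_assoc,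
      ← Complex.exp_add, real_inner_comm]
    push_cast
    congr 3
    ring
  have h0 : ∀ v : Rn n, ((gaussKernel s v : ℝ) : ℂ) =
      ((((2 * Real.pi * s) ^ ((n : ℝ) / 2))⁻¹ : ℝ) : ℂ) *
      Complex.exp (-((1 / (2 * s) : ℝ) : ℂ) * (‖v‖ : ℂ) ^ 2) := by
    intro v
    rw [gaussKernel_eq, Complex.ofReal_mul, Complex.ofReal_exp]
    push_cast
    rfl
  have h1 : ((((2 * Real.pi * s) ^ ((n : ℝ) / 2))⁻¹ : ℝ) : ℂ) *
      (Real.pi / ((1 / (2 * s) : ℝ) : ℂ)) ^ (Module.finrank ℝ (Rn n) / 2 : ℂ) = 1 := by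
    rw [← GaussianFourier.integral_cexp_neg_mul_sq_norm (by simpa using hs), ← integral_const_mul]
    simp_rw [← h0]
    rw [integral_complex_ofReal, integral_gaussKernel hs, Complex.ofReal_one]
  rw [charFun_apply, integral_gaussVec hs]
  simp_rw [hc]
  rw [integral_const_mul, GaussianFourier.integral_cexp_neg_mul_sq_norm_add (by simpa using hs),
    ← mul_assoc, h1, one_mul]
  congr 1
  push_cast
  rw [Complex.I_sq]
  have : (s : ℂ) ≠ 0 := by exact_mod_cast hs.ne'
  field_simp
  norm_num

theorem charFun_lineGauss (b t : Rn n) :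
    charFun (lineGauss b) t = Complex.exp ((-(inner ℝ b t ^ 2 / 2) : ℝ)) := by
  have h := charFun_gaussianReal (μ := 0) (v := 1) (inner ℝ b t)
  rw [charFun_apply_real] at h
  rw [charFun_apply, lineGauss, integral_map (by fun_prop) (by fun_prop)]
  simp only [inner_smul_left]
  rw [show (fun τ : ℝ => Complex.exp (((starRingEnd ℝ) τ * inner ℝ b t : ℝ) * Complex.I)) =
    fun τ : ℝ => Complex.exp ((inner ℝ b t : ℝ) * τ * Complex.I) from
      funext fun τ => by congr 2; simp; ring, h]
  congr 1
  push_cast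
  ring

theorem gaussVec_conv {s t : ℝ} (hs : 0 < s) (ht : 0 < t) :
    (gaussVec n s).conv (gaussVec n t) = gaussVec n (s + t) := by
  have := isProbabilityMeasure_gaussVec (n := n) hs
  have := isProbabilityMeasure_gaussVec (n := n) ht
  have := isProbabilityMeasure_gaussVec (n := n) (add_pos hs ht)
  refine Measure.ext_of_charFun (funext fun u => ?_)
  rw [charFun_conv, charFun_gaussVec hs, charFun_gaussVec ht, charFun_gaussVec (add_pos hs ht),
    ← Complex.exp_add]
  congr 1
  push_cast
  ring

theorem lineGauss_conv (a : Rn n) {p q r : ℝ} (h : p ^ 2 + q ^ 2 = r ^ 2) :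
    (lineGauss (p • a)).conv (lineGauss (q • a)) = lineGauss (r • a) := by
  refine Measure.ext_of_charFun (funext fun u => ?_)
  rw [charFun_conv, charFun_lineGauss, charFun_lineGauss, charFun_lineGauss, ← Complex.exp_add]
  congr 1
  simp only [inner_smul_left]
  rw [← Complex.ofReal_add]
  congr 1
  simp only [conj_trivial]
  linear_combination (-(inner ℝ a u ^ 2 / 2)) * h

theorem avg_avg {μ ν : Measure (Rn n)} [SFinite μ] [SFinite ν] {f : Rn n → ℝ} {x : Rn n}
    (hf : Integrable (fun w => f (x + w)) (μ.conv ν)) :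
    avg μ (avg ν f) x = avg (μ.conv ν) f x := by
  unfold avg
  rw [integral_conv hf]
  simp only [add_assoc]

theorem avg_even {μ : Measure (Rn n)} (hμ : μ.map (fun w => -w) = μ) {f : Rn n → ℝ}
    (hf : ∀ x, f (-x) = f x) (x : Rn n) : avg μ f (-x) = avg μ f x := by
  unfold avg
  conv_rhs => rw [← hμ]
  rw [show (fun w : Rn n => -w) = Homeomorph.neg (Rn n) from rfl,
    (Homeomorph.neg (Rn n)).measurableEmbedding.integral_map (μ := μ) fun w => f (x + w)]
  refine integral_congr_ae (Eventually.of_forall fun w => ?_)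
  simp only [Homeomorph.coe_neg]
  rw [← hf]
  congr 1
  abel

theorem lineGauss_map_neg (b : Rn n) : (lineGauss b).map (fun w => -w) = lineGauss b := by
  have : (gaussianReal 0 1).map (fun x : ℝ => -x) = gaussianReal 0 1 := by
    simpa using gaussianReal_map_neg (μ := 0) (v := 1)
  unfold lineGauss
  conv_rhs => rw [← this]
  rw [Measure.map_map (by fun_prop) (by fun_prop), Measure.map_map (by fun_prop) (by fun_prop)]
  congr 1
  ext τ : 1
  simp

theorem gaussVec_map_neg {s : ℝ} (hs : 0 < s) :
    (gaussVec n s).map (fun w => -w) = gaussVec n s := by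
  have := isProbabilityMeasure_gaussVec (n := n) hs
  have : IsProbabilityMeasure ((gaussVec n s).map (fun w => -w)) :=
    Measure.isProbabilityMeasure_map (by fun_prop)
  refine Measure.ext_of_charFun (funext fun u => ?_)
  rw [charFun_apply, integral_map (by fun_prop) (by fun_prop)]
  simp only [inner_neg_left]
  simp_rw [← inner_neg_right]
  rw [← charFun_apply, charFun_gaussVec hs, charFun_gaussVec hs, norm_neg]

/-- Integrate `f°(z) f(x + w) ≤ e^{-⟨z,x⟩} e^{-⟨z,w⟩}` in `w`: averaging lowers the polar by at most
the Laplace transform of `μ`. When the translate is not integrable the average is `0` by convention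
and the bound is trivial. -/
theorem polarFun_mul_exp_le_avg {μ : Measure (Rn n)} {f : Rn n → ℝ} (hf : ∀ x, 0 ≤ f x)
    {z : Rn n} {q : ℝ}
    (hq : ∫⁻ w, ENNReal.ofReal (Real.exp (-inner ℝ w z)) ∂μ ≤ ENNReal.ofReal (Real.exp q)) :
    polarFun f z * ENNReal.ofReal (Real.exp (-q)) ≤ polarFun (avg μ f) z := by
  rw [le_polarFun_iff]
  intro x
  by_cases hi : Integrable (fun w => f (x + w)) μ
  · rw [avg, ofReal_integral_eq_lintegral_ofReal hi (Eventually.of_forall fun w => hf _)]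
    have h1 : polarFun f z * ∫⁻ w, ENNReal.ofReal (f (x + w)) ∂μ ≤
        ENNReal.ofReal (Real.exp (-inner ℝ z x)) * ENNReal.ofReal (Real.exp q) := by
      calc polarFun f z * ∫⁻ w, ENNReal.ofReal (f (x + w)) ∂μ
          = ∫⁻ w, polarFun f z * ENNReal.ofReal (f (x + w)) ∂μ := by
            rw [lintegral_const_mul'' _ hi.aemeasurable.ennreal_ofReal]
        _ ≤ ∫⁻ w, ENNReal.ofReal (Real.exp (-inner ℝ z x)) *
              ENNReal.ofReal (Real.exp (-inner ℝ w z)) ∂μ := by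
            refine lintegral_mono fun w => (polarFun_mul_le f z (x + w)).trans_eq ?_
            rw [← ENNReal.ofReal_mul (by positivity), ← Real.exp_add, inner_add_right,
              real_inner_comm z w, neg_add]
        _ = ENNReal.ofReal (Real.exp (-inner ℝ z x)) *
              ∫⁻ w, ENNReal.ofReal (Real.exp (-inner ℝ w z)) ∂μ :=
            lintegral_const_mul _ (by fun_prop)
        _ ≤ _ := by gcongr
    calc polarFun f z * ENNReal.ofReal (Real.exp (-q)) * ∫⁻ w, ENNReal.ofReal (f (x + w)) ∂μ
        = (polarFun f z * ∫⁻ w, ENNReal.ofReal (f (x + w)) ∂μ) * ENNReal.ofReal (Real.exp (-q)) := by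
          ring
      _ ≤ ENNReal.ofReal (Real.exp (-inner ℝ z x)) * ENNReal.ofReal (Real.exp q) *
            ENNReal.ofReal (Real.exp (-q)) := by gcongr
      _ = ENNReal.ofReal (Real.exp (-inner ℝ z x)) := by
          rw [mul_assoc, ← ENNReal.ofReal_mul (by positivity), ← Real.exp_add]; simp
  · rw [avg, integral_undef hi]
    simp

end Gaussian

/-! ### A class of functions that is stable under Gaussian averaging -/

section NiceFunctions

variable {n : ℕ}

open ProbabilityTheory

/-- Positive even functions that decay faster than any exponential, have second order Taylor
expansions with uniform cubic remainder on all lines, and whose logarithm is uniformly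
semiconvex on all lines. -/
structure NiceFun (F : Rn n → ℝ) : Prop where
  cont : Continuous F
  pos : ∀ x, 0 < F x
  even : ∀ x, F (-x) = F x
  decay : ∀ R : ℝ, 0 ≤ R → ∃ C : ℝ, 0 ≤ C ∧ ∀ x, F x ≤ C * Real.exp (-(R * ‖x‖))
  taylor : ∀ a : Rn n, ∃ (D₁ D₂ : Rn n → ℝ) (C : ℝ), Continuous D₁ ∧ Continuous D₂ ∧
    (∀ x, |D₁ x| ≤ C) ∧ (∀ x, |D₂ x| ≤ C) ∧
    ∀ (x : Rn n) (τ : ℝ), |F (x + τ • a) - F x - τ * D₁ x - τ ^ 2 / 2 * D₂ x| ≤ C * |τ| ^ 3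
  semiconvex : ∀ a : Rn n, ∃ β : ℝ, 0 ≤ β ∧ ∀ (x : Rn n) (τ : ℝ),
    F x ^ 2 ≤ Real.exp (β * τ ^ 2) * (F (x + τ • a) * F (x - τ • a))

theorem NiceFun.bounded {F : Rn n → ℝ} (hF : NiceFun F) : ∃ C : ℝ, 0 ≤ C ∧ ∀ x, F x ≤ C := by
  obtain ⟨C, hC, h⟩ := hF.decay 0 le_rfl
  exact ⟨C, hC, fun x => by simpa using h x⟩

theorem integrable_translate_of_bounded {μ : Measure (Rn n)} [IsFiniteMeasure μ] {f : Rn n → ℝ}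
    (hf : Continuous f) {C : ℝ} (hC : ∀ x, |f x| ≤ C) (x : Rn n) :
    Integrable (fun w => f (x + w)) μ :=
  Integrable.of_bound (by fun_prop) C (Eventually.of_forall fun w => hC _)

theorem NiceFun.integrable_translate {F : Rn n → ℝ} (hF : NiceFun F) (μ : Measure (Rn n))
    [IsFiniteMeasure μ] (x : Rn n) : Integrable (fun w => F (x + w)) μ := by
  obtain ⟨C, -, h⟩ := hF.bounded
  exact integrable_translate_of_bounded hF.cont
    (fun x => by rw [abs_of_pos (hF.pos x)]; exact h x) x

theorem continuous_avg {μ : Measure (Rn n)} [IsFiniteMeasure μ] {f : Rn n → ℝ}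
    (hf : Continuous f) {C : ℝ} (hC : ∀ x, |f x| ≤ C) : Continuous (avg μ f) :=
  continuous_of_dominated (bound := fun _ => C) (fun x => by fun_prop)
    (fun x => Eventually.of_forall fun w => hC _) (integrable_const _)
    (Eventually.of_forall fun w => by fun_prop)

theorem abs_avg_le {μ : Measure (Rn n)} [IsProbabilityMeasure μ] {f : Rn n → ℝ} {C : ℝ}
    (hC : ∀ x, |f x| ≤ C) (x : Rn n) : |avg μ f x| ≤ C := by
  have := norm_integral_le_of_norm_le_const (μ := μ) (f := fun w => f (x + w)) (C := C)
    (Eventually.of_forall fun w => hC _)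
  simpa [avg] using this

theorem integral_sub_sub_sub {α : Type*} [MeasurableSpace α] {μ : Measure α} {f g h k : α → ℝ}
    (hf : Integrable f μ) (hg : Integrable g μ) (hh : Integrable h μ) (hk : Integrable k μ) :
    ∫ x, (f x - g x - h x - k x) ∂μ
      = ∫ x, f x ∂μ - ∫ x, g x ∂μ - ∫ x, h x ∂μ - ∫ x, k x ∂μ := by
  rw [← integral_sub hf hg, ← integral_sub (f := fun x => f x - g x) (hf.sub hg) hh,
    ← integral_sub (f := fun x => f x - g x - h x) ((hf.sub hg).sub hh) hk]

/-- A form of the Cauchy-Schwarz inequality. -/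
theorem sq_integral_le_of_sq_le {α : Type*} [MeasurableSpace α] {μ : Measure α} {f g h : α → ℝ}
    {K : ℝ} (hf : Integrable f μ) (hg : Integrable g μ) (hh : Integrable h μ)
    (hf0 : ∀ x, 0 ≤ f x) (hg0 : ∀ x, 0 ≤ g x) (hh0 : ∀ x, 0 ≤ h x) (hK : 0 ≤ K)
    (hfI : 0 < ∫ x, f x ∂μ) (hgI : 0 < ∫ x, g x ∂μ)
    (H : ∀ x, h x ^ 2 ≤ K * (f x * g x)) :
    (∫ x, h x ∂μ) ^ 2 ≤ K * ((∫ x, f x ∂μ) * ∫ x, g x ∂μ) := by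
  set I := ∫ x, f x ∂μ
  set J := ∫ x, g x ∂μ
  -- Weighted arithmetic-geometric mean; the weight `√(J / I)` balances the two integrals and so
  -- loses nothing after integration.
  have key : ∀ x, h x ≤ √K * (√(J / I) * f x + (√(J / I))⁻¹ * g x) / 2 := by
    intro x
    have hl : 0 < √(J / I) := Real.sqrt_pos.2 (div_pos hgI hfI)
    set l := √(J / I)
    refine abs_le_of_sq_le_sq' ?_ (by have := hf0 x; have := hg0 x; positivity) |>.2
    refine (H x).trans ?_
    have h1 : f x * g x = (l * f x) * (l⁻¹ * g x) := by field_simp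
    rw [div_pow, mul_pow, Real.sq_sqrt hK, mul_div_assoc, h1]
    refine mul_le_mul_of_nonneg_left ?_ hK
    nlinarith [sq_nonneg (l * f x - l⁻¹ * g x)]
  have h2 : ∫ x, h x ∂μ ≤ √K * (√(J / I) * I + (√(J / I))⁻¹ * J) / 2 := by
    calc ∫ x, h x ∂μ ≤ ∫ x, √K * (√(J / I) * f x + (√(J / I))⁻¹ * g x) / 2 ∂μ :=
          integral_mono hh ((((hf.const_mul _).add (hg.const_mul _)).const_mul _).div_const _) key
      _ = _ := by
          rw [integral_div, integral_const_mul, integral_add (hf.const_mul _) (hg.const_mul _),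
            integral_const_mul, integral_const_mul]
  have h3 : √K * (√(J / I) * I + (√(J / I))⁻¹ * J) / 2 = √K * √(I * J) := by
    rw [Real.sqrt_div hgI.le, Real.sqrt_mul hfI.le]
    have hi := Real.mul_self_sqrt hfI.le
    have hj := Real.mul_self_sqrt hgI.le
    have hi0 := Real.sqrt_pos.2 hfI
    have hj0 := Real.sqrt_pos.2 hgI
    rw [inv_div]
    have e1 : √J / √I * I = √I * √J := by
      rw [div_mul_eq_mul_div, div_eq_iff hi0.ne']; linear_combination (-√J) * hi
    have e2 : √I / √J * J = √I * √J := by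
      rw [div_mul_eq_mul_div, div_eq_iff hj0.ne']; linear_combination (-√I) * hj
    rw [e1, e2]; ring
  rw [h3] at h2
  calc (∫ x, h x ∂μ) ^ 2 ≤ (√K * √(I * J)) ^ 2 :=
        pow_le_pow_left₀ (integral_nonneg hh0) h2 2
    _ = _ := by rw [mul_pow, Real.sq_sqrt hK, Real.sq_sqrt (by positivity)]

theorem integral_exp_norm_lineGauss_le (b : Rn n) (R : ℝ) :
    Integrable (fun w => Real.exp (R * ‖w‖)) (lineGauss b) ∧
      ∫ w, Real.exp (R * ‖w‖) ∂(lineGauss b) ≤ 2 * Real.exp ((R * ‖b‖) ^ 2 / 2) := by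
  set c := R * ‖b‖
  have hi := integrable_exp_mul_gaussianReal (μ := 0) (v := 1)
  have hle : ∀ τ : ℝ, Real.exp (R * ‖τ • b‖) ≤ Real.exp (c * τ) + Real.exp (-c * τ) := by
    intro τ
    rw [norm_smul, Real.norm_eq_abs, show R * (|τ| * ‖b‖) = c * |τ| by simp only [c]; ring]
    rcases abs_cases τ with ⟨h, -⟩ | ⟨h, -⟩ <;> rw [h]
    · linarith [Real.exp_pos (-c * τ)]
    · rw [mul_neg, neg_mul]; linarith [Real.exp_pos (c * τ)]
  have hint : Integrable (fun τ : ℝ => Real.exp (R * ‖τ • b‖)) (gaussianReal 0 1) := by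
    refine Integrable.mono' ((hi c).add (hi (-c))) (by fun_prop) (Eventually.of_forall fun τ => ?_)
    rw [Real.norm_of_nonneg (Real.exp_pos _).le]
    exact hle τ
  have hmgf := congrFun (mgf_fun_id_gaussianReal (μ := 0) (v := 1))
  simp only [mgf] at hmgf
  constructor
  · rw [lineGauss, integrable_map_measure (by fun_prop) (by fun_prop)]
    exact hint
  · rw [lineGauss, integral_map (by fun_prop) (by fun_prop)]
    calc _ ≤ ∫ τ, (Real.exp (c * τ) + Real.exp (-c * τ)) ∂(gaussianReal 0 1) :=
          integral_mono hint ((hi c).add (hi (-c))) hle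
      _ = _ := by
          rw [integral_add (hi c) (hi (-c)), hmgf, hmgf]
          simp
          ring

/-- The constant depends on `b` only through `‖b‖`, monotonically, so the decay is uniform over `b =
r • a` with `0 < r < 1`. -/
theorem avg_lineGauss_le {F : Rn n → ℝ} (hF : NiceFun F) {R C : ℝ} (hR : 0 ≤ R) (hC : 0 ≤ C)
    (h : ∀ x, F x ≤ C * Real.exp (-(R * ‖x‖))) (b x : Rn n) :
    avg (lineGauss b) F x ≤ C * (2 * Real.exp ((R * ‖b‖) ^ 2 / 2)) * Real.exp (-(R * ‖x‖)) := by
  obtain ⟨hi, hle⟩ := integral_exp_norm_lineGauss_le b R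
  calc avg (lineGauss b) F x ≤ ∫ w, C * Real.exp (-(R * ‖x‖)) * Real.exp (R * ‖w‖) ∂(lineGauss b) := by
        refine integral_mono (hF.integrable_translate _ x) (hi.const_mul _) fun w => ?_
        refine (h (x + w)).trans ?_
        rw [mul_assoc, ← Real.exp_add]
        gcongr
        have : ‖x‖ ≤ ‖x + w‖ + ‖w‖ := by
          simpa using norm_sub_le (x + w) w
        nlinarith
    _ = C * Real.exp (-(R * ‖x‖)) * ∫ w, Real.exp (R * ‖w‖) ∂(lineGauss b) := integral_const_mul _ _
    _ ≤ C * Real.exp (-(R * ‖x‖)) * (2 * Real.exp ((R * ‖b‖) ^ 2 / 2)) := by gcongr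
    _ = _ := by ring

theorem NiceFun.avg_pos {F : Rn n → ℝ} (hF : NiceFun F) (μ : Measure (Rn n))
    [IsProbabilityMeasure μ] (x : Rn n) : 0 < avg μ F x := by
  rw [avg, integral_pos_iff_support_of_nonneg (fun w => (hF.pos _).le)
    (hF.integrable_translate _ x)]
  have : Function.support (fun w => F (x + w)) = Set.univ :=
    Set.eq_univ_of_forall fun w => (hF.pos _).ne'
  rw [this]
  simp

/-- Taylor expansions average linearly with the same constant, and the semiconvexity inequality
integrates, with the same `β`, by Cauchy–Schwarz. -/
theorem NiceFun.avg_lineGauss {F : Rn n → ℝ} (hF : NiceFun F) (b : Rn n) :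
    NiceFun (avg (lineGauss b) F) where
  cont := by
    obtain ⟨C, -, h⟩ := hF.bounded
    exact continuous_avg hF.cont (fun x => by rw [abs_of_pos (hF.pos x)]; exact h x)
  pos := hF.avg_pos _
  even := avg_even (lineGauss_map_neg b) hF.even
  decay R hR := by
    obtain ⟨C, hC, h⟩ := hF.decay R hR
    exact ⟨_, by positivity, avg_lineGauss_le hF hR hC h b⟩
  taylor a := by
    obtain ⟨D₁, D₂, C, h1, h2, h3, h4, h5⟩ := hF.taylor a
    refine ⟨avg (lineGauss b) D₁, avg (lineGauss b) D₂, C, continuous_avg h1 h3,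
      continuous_avg h2 h4, abs_avg_le h3, abs_avg_le h4, fun x τ => ?_⟩
    have i0 := hF.integrable_translate (lineGauss b)
    have i1 := integrable_translate_of_bounded (μ := lineGauss b) h1 h3
    have i2 := integrable_translate_of_bounded (μ := lineGauss b) h2 h4
    have : avg (lineGauss b) F (x + τ • a) - avg (lineGauss b) F x - τ * avg (lineGauss b) D₁ x
        - τ ^ 2 / 2 * avg (lineGauss b) D₂ x
        = ∫ w, (F ((x + w) + τ • a) - F (x + w) - τ * D₁ (x + w) - τ ^ 2 / 2 * D₂ (x + w))
          ∂(lineGauss b) := by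
      have i0' : Integrable (fun w => F ((x + w) + τ • a)) (lineGauss b) := by
        simpa only [add_right_comm] using i0 (x + τ • a)
      rw [integral_sub_sub_sub i0' (i0 x) ((i1 x).const_mul τ) ((i2 x).const_mul _),
        integral_const_mul, integral_const_mul]
      simp only [avg, add_right_comm]
    rw [this]
    have := norm_integral_le_of_norm_le_const (μ := lineGauss b) (C := C * |τ| ^ 3)
      (f := fun w => F ((x + w) + τ • a) - F (x + w) - τ * D₁ (x + w) - τ ^ 2 / 2 * D₂ (x + w))
      (Eventually.of_forall fun w => h5 (x + w) τ)
    simpa using this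
  semiconvex a := by
    obtain ⟨β, hβ, h⟩ := hF.semiconvex a
    refine ⟨β, hβ, fun x τ => ?_⟩
    have i0 := hF.integrable_translate (lineGauss b)
    refine sq_integral_le_of_sq_le (i0 _) (i0 _) (i0 _) (fun w => (hF.pos _).le)
      (fun w => (hF.pos _).le) (fun w => (hF.pos _).le) (Real.exp_pos _).le (hF.avg_pos _ _)
      (hF.avg_pos _ _) fun w => ?_
    have := h (x + w) τ
    rwa [add_right_comm, add_sub_right_comm] at this

/-- The first Gaussian moment kills the `D₁` term, the second moment is `1`, and the third absolute
moment controls the remainder. -/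
theorem NiceFun.avg_expansion {F : Rn n → ℝ} (hF : NiceFun F) {a : Rn n} {D₁ D₂ : Rn n → ℝ}
    {C : ℝ}
    (h : ∀ (x : Rn n) (τ : ℝ), |F (x + τ • a) - F x - τ * D₁ x - τ ^ 2 / 2 * D₂ x| ≤ C * |τ| ^ 3)
    {r : ℝ} (hr : 0 ≤ r) (x : Rn n) :
    |avg (lineGauss (r • a)) F x - F x - r ^ 2 / 2 * D₂ x|
      ≤ C * (∫ τ, |τ| ^ 3 ∂(gaussianReal 0 1)) * r ^ 3 := by
  have m1 : ∫ τ, τ ∂(gaussianReal 0 1) = 0 := integral_id_gaussianReal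
  have l2 : MemLp id 2 (gaussianReal 0 1) := memLp_id_gaussianReal' 2 (by simp)
  have l3 : MemLp id 3 (gaussianReal 0 1) := memLp_id_gaussianReal' 3 (by simp)
  have i1 : Integrable (fun τ : ℝ => τ) (gaussianReal 0 1) := l2.integrable (by norm_num)
  have i2 : Integrable (fun τ : ℝ => τ ^ 2) (gaussianReal 0 1) := l2.integrable_sq
  have i3 : Integrable (fun τ : ℝ => |τ| ^ 3) (gaussianReal 0 1) := by
    simpa using l3.integrable_norm_pow (by norm_num)
  have m2 : ∫ τ, τ ^ 2 ∂(gaussianReal 0 1) = 1 := by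
    have h := variance_fun_id_gaussianReal (μ := 0) (v := 1)
    rw [variance_of_integral_eq_zero (by fun_prop) m1] at h
    simpa using h
  have i0 : Integrable (fun τ : ℝ => F (x + (τ * r) • a)) (gaussianReal 0 1) := by
    have := hF.integrable_translate (lineGauss (r • a)) x
    rw [lineGauss, integrable_map_measure (by have := hF.cont; fun_prop) (by fun_prop)] at this
    refine this.congr (Eventually.of_forall fun τ => ?_)
    simp [smul_smul]
  have e : avg (lineGauss (r • a)) F x - F x - r ^ 2 / 2 * D₂ x =
      ∫ τ, (F (x + (τ * r) • a) - F x - (τ * r) * D₁ x - (τ * r) ^ 2 / 2 * D₂ x)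
        ∂(gaussianReal 0 1) := by
    have e1 : ∀ τ : ℝ, F (x + (τ * r) • a) - F x - (τ * r) * D₁ x - (τ * r) ^ 2 / 2 * D₂ x
        = F (x + (τ * r) • a) - F x - τ * (r * D₁ x) - τ ^ 2 * (r ^ 2 / 2 * D₂ x) := by
      intro τ; ring
    simp_rw [e1]
    rw [integral_sub_sub_sub i0 (integrable_const _) (i1.mul_const _) (i2.mul_const _),
      integral_mul_const, integral_mul_const, m1, m2]
    rw [avg, lineGauss, integral_map (by fun_prop) (by have := hF.cont; fun_prop)]
    simp [smul_smul]
  rw [e]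
  calc _ ≤ ∫ τ, C * r ^ 3 * |τ| ^ 3 ∂(gaussianReal 0 1) := by
        rw [← Real.norm_eq_abs]
        refine norm_integral_le_of_norm_le (i3.const_mul _) (Eventually.of_forall fun τ => ?_)
        refine (h x (τ * r)).trans_eq ?_
        rw [abs_mul, abs_of_nonneg hr]
        ring
    _ = _ := by rw [integral_const_mul]; ring

end NiceFunctions

/-! ### Infinitesimal comparison of the heat flow and geometric means of translates -/

section InfinitesimalComparison

variable {n : ℕ}

open ProbabilityTheory

/-- Scalar core of the comparison; `H` stands for the average and `P`, `M` for the two translates.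
With `A = F + r² D₂ / 2` one has `H² ≤ A² + O(r³)` and `P M ≥ A² - r² D₁² - O(r³)`. The factor `1 +
q r²` restores `q r² A²`, and the gap `ε` between `q F²` and `D₁²` absorbs the cubic errors for
small `r`. -/
theorem sq_le_mul_exp_of_expansion {C c q ε : ℝ} (hC : 1 ≤ C) (hc : 0 < c) (hq : ε ≤ q)
    (hε : 0 < ε) {F D₁ D₂ : ℝ} (hcF : c ≤ F) (hFC : F ≤ C) (hD₁ : |D₁| ≤ C) (hD₂ : |D₂| ≤ C)
    (hDF : D₁ ^ 2 ≤ (q - ε) * F ^ 2) {r : ℝ} (hr : 0 < r) (hr1 : r ≤ 1)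
    (hrε : C ^ 2 * (14 + 9 * q) * r ≤ ε * c ^ 2) {H P M : ℝ} (hH0 : 0 ≤ H)
    (hH : H ≤ F + r ^ 2 / 2 * D₂ + C * r ^ 3)
    (hP : |P - F - r * D₁ - r ^ 2 / 2 * D₂| ≤ C * r ^ 3)
    (hM : |M - F + r * D₁ - r ^ 2 / 2 * D₂| ≤ C * r ^ 3) (hPM : 0 ≤ P * M) :
    H ^ 2 ≤ P * M * Real.exp (q * r ^ 2) := by
  have hC0 : 0 < C := by linarith
  have hq0 : 0 < q := by linarith
  obtain ⟨A, hA⟩ : ∃ A, A = F + r ^ 2 / 2 * D₂ := ⟨_, rfl⟩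
  obtain ⟨e₁, he₁⟩ : ∃ e, e = P - F - r * D₁ - r ^ 2 / 2 * D₂ := ⟨_, rfl⟩
  obtain ⟨e₂, he₂⟩ : ∃ e, e = M - F + r * D₁ - r ^ 2 / 2 * D₂ := ⟨_, rfl⟩
  rw [← he₁] at hP
  rw [← he₂] at hM
  have hr2 : r ^ 2 ≤ 1 := pow_le_one₀ hr.le hr1
  have hr3 : r ^ 3 ≤ 1 := pow_le_one₀ hr.le hr1
  have hr30 : 0 < r ^ 3 := by positivity
  have hF0 : 0 < F := by linarith
  have hA2 : |A| ≤ 2 * C := by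
    rw [hA]
    calc |F + r ^ 2 / 2 * D₂| ≤ |F| + |r ^ 2 / 2 * D₂| := abs_add_le _ _
      _ ≤ C + 1 / 2 * C := by
        rw [abs_of_pos hF0, abs_mul, abs_of_nonneg (by positivity : 0 ≤ r ^ 2 / 2)]
        gcongr
      _ ≤ _ := by linarith
  have hrD : |r * D₁| ≤ C := by
    rw [abs_mul, abs_of_pos hr]
    calc r * |D₁| ≤ 1 * C := by gcongr
      _ = C := one_mul C
  have hPe : P = A + r * D₁ + e₁ := by rw [he₁, hA]; ring
  have hMe : M = A - r * D₁ + e₂ := by rw [he₂, hA]; ring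
  have hAp : |A + r * D₁| ≤ 3 * C := (abs_add_le _ _).trans (by linarith)
  have hAm : |A - r * D₁| ≤ 3 * C := (abs_sub _ _).trans (by linarith)
  have hPM1 : A ^ 2 - r ^ 2 * D₁ ^ 2 - 7 * C ^ 2 * r ^ 3 ≤ P * M := by
    have h1 : |(A + r * D₁) * e₂| ≤ 3 * C * (C * r ^ 3) := by rw [abs_mul]; gcongr
    have h2 : |(A - r * D₁) * e₁| ≤ 3 * C * (C * r ^ 3) := by rw [abs_mul]; gcongr
    have h3 : |e₁ * e₂| ≤ C * 1 * (C * r ^ 3) := by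
      rw [abs_mul]
      have : |e₁| ≤ C * 1 := hP.trans (by gcongr)
      gcongr
    have := (abs_le.1 h1).1
    have := (abs_le.1 h2).1
    have := (abs_le.1 h3).1
    have e : P * M = A ^ 2 - r ^ 2 * D₁ ^ 2 + (A + r * D₁) * e₂ + (A - r * D₁) * e₁ + e₁ * e₂ := by
      rw [hPe, hMe]; ring
    rw [e]
    linarith
  have hH2 : H ^ 2 ≤ A ^ 2 + 5 * C ^ 2 * r ^ 3 := by
    have h1 : H ^ 2 ≤ (A + C * r ^ 3) ^ 2 := by
      refine pow_le_pow_left₀ hH0 ?_ 2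
      rw [hA]; exact hH
    have h2 : A * (C * r ^ 3) ≤ 2 * C * (C * r ^ 3) := by
      have := (abs_le.1 hA2).2
      gcongr
    have h3 : (C * r ^ 3) * (C * r ^ 3) ≤ C * 1 * (C * r ^ 3) := by gcongr
    linarith
  have hA2F : F ^ 2 - C ^ 2 * r ^ 2 ≤ A ^ 2 := by
    have h1 : -(C * C) ≤ F * D₂ := by
      have : |F * D₂| ≤ C * C := by
        rw [abs_mul, abs_of_pos hF0]; gcongr
      exact (abs_le.1 this).1
    have h2 : 0 ≤ r ^ 2 * (F * D₂ + C * C) := mul_nonneg (by positivity) (by linarith)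
    have h3 : A ^ 2 = F ^ 2 + r ^ 2 * (F * D₂) + (r ^ 2 / 2 * D₂) ^ 2 := by rw [hA]; ring
    linarith [sq_nonneg (r ^ 2 / 2 * D₂)]
  have hD12 : D₁ ^ 2 ≤ C ^ 2 := sq_le_sq' (by linarith [(abs_le.1 hD₁).1]) (abs_le.1 hD₁).2
  have hexp : 1 + q * r ^ 2 ≤ Real.exp (q * r ^ 2) := by
    linarith [Real.add_one_le_exp (q * r ^ 2)]
  have hcF2 : c ^ 2 ≤ F ^ 2 := pow_le_pow_left₀ hc.le hcF 2
  have hqr : 0 ≤ q * r ^ 2 := by positivity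
  calc H ^ 2 ≤ A ^ 2 + 5 * C ^ 2 * r ^ 3 := hH2
    _ ≤ (A ^ 2 - r ^ 2 * D₁ ^ 2 - 7 * C ^ 2 * r ^ 3) * (1 + q * r ^ 2) := by
      have h1 : ε * c ^ 2 - q * C ^ 2 * r ^ 2 ≤ q * A ^ 2 - D₁ ^ 2 := by
        have h1a : q * (F ^ 2 - C ^ 2 * r ^ 2) ≤ q * A ^ 2 := by gcongr
        have h1b : ε * c ^ 2 ≤ ε * F ^ 2 := by gcongr
        linarith
      -- Here `12 = 5 + 7` collects the cubic errors of `H²` and `P M`, and `9 q = q + q + 7 q` the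
      -- terms multiplied by `q r²`; the `14` in the hypothesis leaves some slack.
      have h2 : 12 * C ^ 2 * r ^ 3 + q * C ^ 2 * r ^ 4 + r ^ 4 * q * D₁ ^ 2 +
          7 * C ^ 2 * q * r ^ 5 ≤ r ^ 2 * (ε * c ^ 2) := by
        have h4 : r ^ 4 ≤ r ^ 3 := pow_le_pow_of_le_one hr.le hr1 (by norm_num)
        have h5 : r ^ 5 ≤ r ^ 3 := pow_le_pow_of_le_one hr.le hr1 (by norm_num)
        calc _ ≤ 12 * C ^ 2 * r ^ 3 + q * C ^ 2 * r ^ 3 + r ^ 3 * q * C ^ 2 +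
              7 * C ^ 2 * q * r ^ 3 := by gcongr
          _ ≤ r ^ 2 * (C ^ 2 * (14 + 9 * q) * r) := by
            have : 0 ≤ C ^ 2 * r ^ 3 := by positivity
            linarith
          _ ≤ _ := by gcongr
      linarith [mul_le_mul_of_nonneg_left h1 (sq_nonneg r)]
    _ ≤ P * M * (1 + q * r ^ 2) := by gcongr
    _ ≤ _ := by gcongr

/-- The quantities entering the comparison at a fixed dual point `z`. -/
theorem eventually_expansion_on_compact {F : Rn n → ℝ} (hF : NiceFun F) {a : Rn n}
    {D₁ D₂ : Rn n → ℝ} {C : ℝ} (h1 : ∀ x, |D₁ x| ≤ C) (h2 : ∀ x, |D₂ x| ≤ C)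
    (h : ∀ (x : Rn n) (τ : ℝ), |F (x + τ • a) - F x - τ * D₁ x - τ ^ 2 / 2 * D₂ x| ≤ C * |τ| ^ 3)
    {q ε : ℝ} (hε : 0 < ε) (hq : ε ≤ q) (ρ : ℝ) :
    ∀ᶠ r in 𝓝[>] (0 : ℝ), ∀ x, ‖x‖ ≤ ρ → D₁ x ^ 2 ≤ (q - ε) * F x ^ 2 →
      avg (lineGauss (r • a)) F x ≤ geomShift (r • a) F x * Real.exp (q * r ^ 2 / 2) := by
  obtain ⟨B, hB, hFB⟩ := hF.bounded
  set m := ∫ τ, |τ| ^ 3 ∂(gaussianReal 0 1)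
  -- A single constant dominating `1`, `F`, the Taylor constant and the remainder constant of the
  -- averaged expansion.
  set K := 1 + B + |C| + |C * m|
  have hK : 1 ≤ K := by
    have := abs_nonneg C
    have := abs_nonneg (C * m)
    simp only [K]; linarith
  have hCK : C ≤ K := by
    have := le_abs_self C
    have := abs_nonneg (C * m)
    simp only [K]; linarith
  have hCmK : C * m ≤ K := by
    have := abs_nonneg C
    have := le_abs_self (C * m)
    simp only [K]; linarith
  have hBK : B ≤ K := by
    have := abs_nonneg C
    have := abs_nonneg (C * m)
    simp only [K]; linarith
  obtain ⟨c, hc, hcF⟩ : ∃ c : ℝ, 0 < c ∧ ∀ x : Rn n, ‖x‖ ≤ ρ → c ≤ F x := by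
    rcases lt_or_ge ρ 0 with hρ | hρ
    · exact ⟨1, one_pos, fun x hx => absurd (norm_nonneg x) (by linarith)⟩
    · obtain ⟨x₀, -, hx₀⟩ := (isCompact_closedBall (0 : Rn n) ρ).exists_isMinOn
        ⟨0, by simpa using hρ⟩ hF.cont.continuousOn
      exact ⟨F x₀, hF.pos _, fun x hx => hx₀ (by simpa using hx)⟩
  have e1 : ∀ᶠ r in 𝓝[>] (0 : ℝ), K ^ 2 * (14 + 9 * q) * r < ε * c ^ 2 := by
    have : Tendsto (fun r : ℝ => K ^ 2 * (14 + 9 * q) * r) (𝓝[>] 0) (𝓝 0) := by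
      have : Tendsto (fun r : ℝ => K ^ 2 * (14 + 9 * q) * r) (𝓝 0)
        (𝓝 (K ^ 2 * (14 + 9 * q) * 0)) := Continuous.tendsto (by fun_prop) 0
      simpa using this.mono_left nhdsWithin_le_nhds
    exact this.eventually_lt_const (by positivity)
  have e2 : ∀ᶠ r in 𝓝[>] (0 : ℝ), r < 1 :=
    (eventually_lt_nhds one_pos).filter_mono nhdsWithin_le_nhds
  filter_upwards [e1, e2, self_mem_nhdsWithin] with r hr1 hr2 hr x hx hD
  have hr0 : 0 < r := hr
  have hexp := hF.avg_expansion h hr0.le x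
  have hr3 : 0 ≤ r ^ 3 := by positivity
  have hPM : 0 ≤ F (x + r • a) * F (x - r • a) := mul_nonneg (hF.pos _).le (hF.pos _).le
  have key := sq_le_mul_exp_of_expansion hK hc hq hε (hcF x hx) ((hFB x).trans hBK)
    ((h1 x).trans hCK) ((h2 x).trans hCK) hD hr0 hr2.le hr1.le
    (H := avg (lineGauss (r • a)) F x) (P := F (x + r • a)) (M := F (x - r • a))
    (hF.avg_pos _ x).le ?_ ?_ ?_ hPM
  · refine abs_le_of_sq_le_sq' (key.trans_eq ?_) (by unfold geomShift; positivity) |>.2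
    rw [mul_pow, geomShift, Real.sq_sqrt hPM, ← Real.exp_nat_mul]
    congr 2
    push_cast
    ring
  · have := (abs_le.1 hexp).2
    have : C * m * r ^ 3 ≤ K * r ^ 3 := by gcongr
    simp only [m] at *
    linarith
  · have := h x r
    rw [abs_of_pos hr0] at this
    exact this.trans (by gcongr)
  · have := h x (-r)
    rw [abs_neg, abs_of_pos hr0, neg_smul, ← sub_eq_add_neg, neg_sq] at this
    refine le_trans (le_of_eq ?_) (this.trans (by gcongr))
    congr 1
    ring

/-- First-order condition for `e^{⟨z,·⟩} F` along `a`; the Taylor bound at `x₁` makes `D₁ x₁` the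
directional derivative. It links the loss caused by averaging to `⟨a, z⟩²`. -/
theorem NiceFun.deriv_of_isMax {F : Rn n → ℝ} {a z x₁ : Rn n}
    {D₁ D₂ : Rn n → ℝ} {C : ℝ} (h2 : |D₂ x₁| ≤ C)
    (h : ∀ τ : ℝ, |F (x₁ + τ • a) - F x₁ - τ * D₁ x₁ - τ ^ 2 / 2 * D₂ x₁| ≤ C * |τ| ^ 3)
    (hmax : ∀ x, Real.exp (inner ℝ z x) * F x ≤ Real.exp (inner ℝ z x₁) * F x₁) :
    D₁ x₁ = -(inner ℝ a z * F x₁) := by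
  have hC : 0 ≤ C := (abs_nonneg _).trans h2
  have hd : HasDerivAt (fun τ : ℝ => F (x₁ + τ • a)) (D₁ x₁) 0 := by
    rw [hasDerivAt_iff_isLittleO]
    have hb : (fun τ : ℝ => F (x₁ + τ • a) - F (x₁ + (0 : ℝ) • a) - (τ - 0) • D₁ x₁)
        =O[𝓝 0] fun τ : ℝ => τ ^ 2 := by
      refine Asymptotics.IsBigO.of_bound (2 * C) ?_
      have : ∀ᶠ τ : ℝ in 𝓝 0, |τ| < 1 := by
        have : Tendsto (fun τ : ℝ => |τ|) (𝓝 0) (𝓝 |0|) := continuous_abs.tendsto 0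
        rw [abs_zero] at this
        exact this.eventually_lt_const one_pos
      filter_upwards [this] with τ hτ
      have h3 := h τ
      rw [zero_smul, add_zero, sub_zero, smul_eq_mul, norm_pow, Real.norm_eq_abs, Real.norm_eq_abs]
      have e : F (x₁ + τ • a) - F x₁ - τ * D₁ x₁ =
        (F (x₁ + τ • a) - F x₁ - τ * D₁ x₁ - τ ^ 2 / 2 * D₂ x₁) + τ ^ 2 / 2 * D₂ x₁ := by ring
      rw [e]
      calc _ ≤ C * |τ| ^ 3 + |τ ^ 2 / 2 * D₂ x₁| := (abs_add_le _ _).trans (by gcongr)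
        _ ≤ C * (|τ| ^ 2 * 1) + |τ| ^ 2 / 2 * C := by
          rw [abs_mul, abs_of_nonneg (by positivity : 0 ≤ τ ^ 2 / 2), ← sq_abs]
          have : |τ| ^ 3 ≤ |τ| ^ 2 * 1 := by
            rw [pow_succ]; gcongr
          gcongr
        _ ≤ _ := by nlinarith [mul_nonneg hC (sq_nonneg |τ|)]
    refine hb.trans_isLittleO ?_
    simpa using (Asymptotics.isLittleO_pow_id (𝕜 := ℝ) one_lt_two)
  have hd2 : HasDerivAt (fun τ : ℝ => Real.exp (inner ℝ z (x₁ + τ • a)) * F (x₁ + τ • a))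
      (Real.exp (inner ℝ z x₁) * inner ℝ z a * F x₁ + Real.exp (inner ℝ z x₁) * D₁ x₁) 0 := by
    have hl : HasDerivAt (fun τ : ℝ => inner ℝ z (x₁ + τ • a)) (inner ℝ z a) 0 := by
      simp only [inner_add_right, inner_smul_right]
      simpa using ((hasDerivAt_id (0 : ℝ)).mul_const (inner ℝ z a)).const_add (inner ℝ z x₁)
    have := (hl.exp).mul hd
    simp only [zero_smul, add_zero] at this
    exact this
  have hloc : IsLocalMax (fun τ : ℝ => Real.exp (inner ℝ z (x₁ + τ • a)) * F (x₁ + τ • a)) 0 :=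
    Eventually.of_forall fun τ => by simpa using hmax (x₁ + τ • a)
  have h0 := hloc.hasDerivAt_eq_zero hd2
  have hp := Real.exp_pos (inner ℝ z x₁)
  have h1 : Real.exp (inner ℝ z x₁) * (inner ℝ z a * F x₁ + D₁ x₁) = 0 := by linarith
  rcases mul_eq_zero.1 h1 with h4 | h4
  · exact absurd h4 hp.ne'
  · rw [real_inner_comm]; linarith

/-- Inside a large ball and where `(∂ₐ log F)² < ⟨a,z⟩² + ε/2`, the second-order expansion compares
the average with the geometric mean pointwise. Elsewhere `e^{⟨z,x⟩}` times the average stays below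
`(1 - η)` times the maximum of `e^{⟨z,·⟩} F`, and testing the polar of the geometric mean at the
maximiser alone is enough. -/
theorem eventually_polarFun_geomShift_le {F : Rn n → ℝ} (hF : NiceFun F) (a z : Rn n) {ε : ℝ}
    (hε : 0 < ε) :
    ∀ᶠ r in 𝓝[>] (0 : ℝ), polarFun (geomShift (r • a) F) z *
        ENNReal.ofReal (Real.exp (-((inner ℝ a z ^ 2 + ε) * r ^ 2 / 2)))
      ≤ polarFun (avg (lineGauss (r • a)) F) z := by
  obtain ⟨D₁, D₂, C, c1, c2, b1, b2, h⟩ := hF.taylor a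
  obtain ⟨w, hw⟩ : ∃ w, w = inner ℝ a z := ⟨_, rfl⟩
  rw [← hw]
  set Φ : Rn n → ℝ := fun x => Real.exp (inner ℝ z x) * F x
  have hΦc : Continuous Φ := by have := hF.cont; fun_prop
  have hΦ0 : ∀ x, 0 < Φ x := fun x => mul_pos (Real.exp_pos _) (hF.pos x)
  obtain ⟨C₁, hC₁, hdec⟩ := hF.decay (‖z‖ + 1) (by positivity)
  have hexpz : ∀ (y : ℝ) (D : ℝ), 0 ≤ y → ∀ x : Rn n, y ≤ D * Real.exp (-((‖z‖ + 1) * ‖x‖)) →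
      Real.exp (inner ℝ z x) * y ≤ D * Real.exp (-‖x‖) := by
    intro y D hy0 x hy
    calc Real.exp (inner ℝ z x) * y
        ≤ Real.exp (‖z‖ * ‖x‖) * (D * Real.exp (-((‖z‖ + 1) * ‖x‖))) := by
          gcongr
          exact real_inner_le_norm z x
      _ = D * (Real.exp (‖z‖ * ‖x‖) * Real.exp (-((‖z‖ + 1) * ‖x‖))) := by ring
      _ = D * Real.exp (-‖x‖) := by rw [← Real.exp_add]; congr 2; ring
  have hmaxOn : ∀ (S : Set (Rn n)), IsClosed S → S.Nonempty → ∃ x ∈ S, ∀ y ∈ S, Φ y ≤ Φ x := by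
    rintro S hS ⟨x₀, hx₀⟩
    have ht : Tendsto Φ (cocompact (Rn n)) (𝓝 0) := by
      have h1 : Tendsto (fun x : Rn n => C₁ * Real.exp (-‖x‖)) (cocompact (Rn n)) (𝓝 (C₁ * 0)) :=
        (Real.tendsto_exp_atBot.comp (tendsto_neg_atTop_atBot.comp
          (tendsto_norm_cocompact_atTop (E := Rn n)))).const_mul C₁
      rw [mul_zero] at h1
      exact squeeze_zero (fun x => (hΦ0 x).le) (fun x => hexpz _ _ (hF.pos x).le x (hdec x)) h1
    obtain ⟨x, hx, hmax⟩ := hΦc.continuousOn.exists_isMaxOn' hS hx₀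
      ((ht.eventually_le_const (hΦ0 x₀)).filter_mono inf_le_left)
    exact ⟨x, hx, hmax⟩
  obtain ⟨x₀, -, hx₀⟩ := hmaxOn Set.univ isClosed_univ Set.univ_nonempty
  replace hx₀ : ∀ y, Φ y ≤ Φ x₀ := fun y => hx₀ y trivial
  set m := Φ x₀
  have hm : 0 < m := hΦ0 x₀
  -- away from the region where `D₁` is controlled, `Φ` stays below its maximum
  obtain ⟨η, hη0, hη1, hη⟩ : ∃ η : ℝ, 0 < η ∧ η ≤ 1 / 2 ∧
      ∀ x, (w ^ 2 + ε / 2) * F x ^ 2 ≤ D₁ x ^ 2 → Φ x ≤ (1 - 2 * η) * m := by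
    set S : Set (Rn n) := {x | (w ^ 2 + ε / 2) * F x ^ 2 ≤ D₁ x ^ 2}
    have hS : IsClosed S := isClosed_le (by have := hF.cont; fun_prop) (by fun_prop)
    rcases S.eq_empty_or_nonempty with hS0 | hS0
    · refine ⟨1 / 2, by norm_num, le_rfl, fun x hx => ?_⟩
      have : x ∈ S := hx
      simp [hS0] at this
    · obtain ⟨x₁, hx₁, hmax⟩ := hmaxOn S hS hS0
      -- At a global maximiser `D₁² = w² F²`, which is strictly below the threshold defining `S`; so
      -- no maximiser belongs to `S`.
      have hlt : Φ x₁ < m := by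
        refine lt_of_le_of_ne (hx₀ x₁) fun heq => ?_
        have hd := NiceFun.deriv_of_isMax (b2 x₁) (h x₁) (z := z) (fun y => (hx₀ y).trans_eq heq.symm)
        have hx₁' : (w ^ 2 + ε / 2) * F x₁ ^ 2 ≤ D₁ x₁ ^ 2 := hx₁
        rw [hd, ← hw] at hx₁'
        nlinarith [pow_pos (hF.pos x₁) 2]
      refine ⟨(1 - Φ x₁ / m) / 2, ?_, ?_, fun x hx => (hmax x hx).trans_eq ?_⟩
      · have := (div_lt_one hm).2 hlt
        linarith
      · have := div_pos (hΦ0 x₁) hm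
        linarith
      · field_simp
        ring
  -- uniform decay
  obtain ⟨ρ, hρ⟩ : ∃ ρ : ℝ, C₁ * (2 * Real.exp (((‖z‖ + 1) * ‖a‖) ^ 2 / 2)) * Real.exp (-ρ)
      ≤ m / 2 := by
    have h1 : Tendsto (fun ρ : ℝ => C₁ * (2 * Real.exp (((‖z‖ + 1) * ‖a‖) ^ 2 / 2)) * Real.exp (-ρ))
        atTop (𝓝 (C₁ * (2 * Real.exp (((‖z‖ + 1) * ‖a‖) ^ 2 / 2)) * 0)) :=
      (Real.tendsto_exp_atBot.comp tendsto_neg_atTop_atBot).const_mul _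
    rw [mul_zero] at h1
    exact (h1.eventually_le_const (by positivity)).exists
  have e1 := eventually_expansion_on_compact hF b1 b2 h (q := w ^ 2 + ε) (ε := ε / 2)
    (by positivity) (by nlinarith [sq_nonneg w]) ρ
  have e2 : ∀ᶠ r in 𝓝[>] (0 : ℝ), r < 1 :=
    (eventually_lt_nhds one_pos).filter_mono nhdsWithin_le_nhds
  have e3 : ∀ᶠ r in 𝓝[>] (0 : ℝ), (1 - η) * F x₀ < geomShift (r • a) F x₀ := by
    have h1 : Tendsto (fun r : ℝ => geomShift (r • a) F x₀) (𝓝 0)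
        (𝓝 (geomShift ((0 : ℝ) • a) F x₀)) := by
      have : Continuous fun r : ℝ => geomShift (r • a) F x₀ := by
        unfold geomShift; have := hF.cont; fun_prop
      exact this.tendsto 0
    have h2 : geomShift ((0 : ℝ) • a) F x₀ = F x₀ := by
      simp [geomShift, Real.sqrt_mul_self (hF.pos x₀).le]
    rw [h2] at h1
    refine (h1.mono_left nhdsWithin_le_nhds).eventually_const_lt ?_
    nlinarith [hF.pos x₀]
  have e4 : ∀ᶠ r in 𝓝[>] (0 : ℝ),
      Real.exp (‖z‖ * ρ) * (C / 2 * r ^ 2 + C * (∫ τ, |τ| ^ 3 ∂(gaussianReal 0 1)) * r ^ 3)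
        < η * m := by
    have h1 : Tendsto (fun r : ℝ => Real.exp (‖z‖ * ρ) *
        (C / 2 * r ^ 2 + C * (∫ τ, |τ| ^ 3 ∂(gaussianReal 0 1)) * r ^ 3)) (𝓝 0)
        (𝓝 (Real.exp (‖z‖ * ρ) *
        (C / 2 * 0 ^ 2 + C * (∫ τ, |τ| ^ 3 ∂(gaussianReal 0 1)) * 0 ^ 3))) := by
      refine Continuous.tendsto ?_ 0
      fun_prop
    have : Real.exp (‖z‖ * ρ) *
        (C / 2 * 0 ^ 2 + C * (∫ τ, |τ| ^ 3 ∂(gaussianReal 0 1)) * 0 ^ 3) = 0 := by ring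
    rw [this] at h1
    exact (h1.mono_left nhdsWithin_le_nhds).eventually_lt_const (by positivity)
  filter_upwards [e1, e2, e3, e4, self_mem_nhdsWithin] with r hr1 hr2 hr3 hr4 hr
  have hr0 : 0 < r := hr
  rw [le_polarFun_iff]
  intro x
  set H := avg (lineGauss (r • a)) F x
  have hH0 : 0 < H := hF.avg_pos _ x
  set S := polarFun (geomShift (r • a) F) z
  set E := Real.exp (-((w ^ 2 + ε) * r ^ 2 / 2))
  have hE1 : E ≤ 1 := Real.exp_le_one_iff.2 (by nlinarith [mul_nonneg (add_pos_of_nonneg_of_pos (sq_nonneg w) hε).le (sq_nonneg r)])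
  have case1 : H ≤ geomShift (r • a) F x * Real.exp ((w ^ 2 + ε) * r ^ 2 / 2) →
      S * ENNReal.ofReal E * ENNReal.ofReal H ≤ ENNReal.ofReal (Real.exp (-inner ℝ z x)) := by
    intro hle
    calc S * ENNReal.ofReal E * ENNReal.ofReal H = S * ENNReal.ofReal (E * H) := by
          rw [mul_assoc, ← ENNReal.ofReal_mul (Real.exp_pos _).le]
      _ ≤ S * ENNReal.ofReal (geomShift (r • a) F x) := by
          gcongr
          calc E * H ≤ E * (geomShift (r • a) F x * Real.exp ((w ^ 2 + ε) * r ^ 2 / 2)) := by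
                gcongr
            _ = geomShift (r • a) F x * (E * Real.exp ((w ^ 2 + ε) * r ^ 2 / 2)) := by ring
            _ = _ := by simp only [E]; rw [← Real.exp_add]; simp
      _ ≤ _ := polarFun_mul_le _ _ _
  have case2 : Real.exp (inner ℝ z x) * H ≤ (1 - η) * m →
      S * ENNReal.ofReal E * ENNReal.ofReal H ≤ ENNReal.ofReal (Real.exp (-inner ℝ z x)) := by
    intro hle
    have hH : H ≤ geomShift (r • a) F x₀ *
        (Real.exp (inner ℝ z x₀) * Real.exp (-inner ℝ z x)) := by
      calc H = Real.exp (-inner ℝ z x) * (Real.exp (inner ℝ z x) * H) := by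
            rw [← mul_assoc, ← Real.exp_add]; simp
        _ ≤ Real.exp (-inner ℝ z x) * ((1 - η) * m) := by gcongr
        _ = (1 - η) * F x₀ * (Real.exp (inner ℝ z x₀) * Real.exp (-inner ℝ z x)) := by
            simp only [m, Φ]; ring
        _ ≤ _ := by gcongr
    calc S * ENNReal.ofReal E * ENNReal.ofReal H ≤ S * 1 * ENNReal.ofReal (geomShift (r • a) F x₀ *
        (Real.exp (inner ℝ z x₀) * Real.exp (-inner ℝ z x))) := by
          gcongr
          simpa using hE1
      _ = S * ENNReal.ofReal (geomShift (r • a) F x₀) *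
            ENNReal.ofReal (Real.exp (inner ℝ z x₀) * Real.exp (-inner ℝ z x)) := by
          rw [ENNReal.ofReal_mul (p := geomShift (r • a) F x₀) (Real.sqrt_nonneg _)]; ring
      _ ≤ ENNReal.ofReal (Real.exp (-inner ℝ z x₀)) *
            ENNReal.ofReal (Real.exp (inner ℝ z x₀) * Real.exp (-inner ℝ z x)) := by
          gcongr
          exact polarFun_mul_le _ _ _
      _ = _ := by
          rw [← ENNReal.ofReal_mul (Real.exp_pos _).le, ← mul_assoc, ← Real.exp_add]; simp
  rcases le_or_gt ‖x‖ ρ with hx | hx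
  · by_cases hD : (w ^ 2 + ε / 2) * F x ^ 2 ≤ D₁ x ^ 2
    · refine case2 ?_
      have h1 := (abs_le.1 (hF.avg_expansion h hr0.le x)).2
      have h2 : H ≤ F x + (C / 2 * r ^ 2 + C * (∫ τ, |τ| ^ 3 ∂(gaussianReal 0 1)) * r ^ 3) := by
        have : r ^ 2 / 2 * D₂ x ≤ r ^ 2 / 2 * C := by
          gcongr
          exact (abs_le.1 (b2 x)).2
        simp only [H]
        linarith
      set Q := C / 2 * r ^ 2 + C * (∫ τ, |τ| ^ 3 ∂(gaussianReal 0 1)) * r ^ 3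
      have hQ0 : 0 ≤ Q := by
        have hC0 : 0 ≤ C := (abs_nonneg _).trans (b1 0)
        have : 0 ≤ ∫ τ, |τ| ^ 3 ∂(gaussianReal 0 1) := integral_nonneg fun τ => by positivity
        simp only [Q]
        positivity
      have h3 : Real.exp (inner ℝ z x) ≤ Real.exp (‖z‖ * ρ) := by
        gcongr
        exact (real_inner_le_norm z x).trans (by gcongr)
      calc Real.exp (inner ℝ z x) * H ≤ Real.exp (inner ℝ z x) * (F x + Q) := by gcongr
        _ = Φ x + Real.exp (inner ℝ z x) * Q := by simp only [Φ]; ring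
        _ ≤ (1 - 2 * η) * m + Real.exp (‖z‖ * ρ) * Q := by
          gcongr
          exact hη x hD
        _ ≤ (1 - 2 * η) * m + η * m := by gcongr
        _ = _ := by ring
    · refine case1 (hr1 x hx ?_)
      have e : w ^ 2 + ε - ε / 2 = w ^ 2 + ε / 2 := by ring
      rw [e]
      exact (not_le.1 hD).le
  · refine case2 ?_
    have h1 := avg_lineGauss_le hF (by positivity) hC₁ hdec (r • a) x
    have h2 : ‖r • a‖ ≤ ‖a‖ := by
      rw [norm_smul, Real.norm_of_nonneg hr0.le]
      nlinarith [norm_nonneg a]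
    have h3 := hexpz H (C₁ * (2 * Real.exp (((‖z‖ + 1) * ‖a‖) ^ 2 / 2))) hH0.le x
      (h1.trans (by gcongr))
    calc Real.exp (inner ℝ z x) * H
        ≤ C₁ * (2 * Real.exp (((‖z‖ + 1) * ‖a‖) ^ 2 / 2)) * Real.exp (-‖x‖) := h3
      _ ≤ C₁ * (2 * Real.exp (((‖z‖ + 1) * ‖a‖) ^ 2 / 2)) * Real.exp (-ρ) := by gcongr
      _ ≤ m / 2 := hρ
      _ ≤ (1 - η) * m := by nlinarith

end InfinitesimalComparison

/-! ### Monotonicity along one-dimensional heat flows -/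

section LineMonotonicity

variable {n : ℕ}

open ProbabilityTheory

theorem Real.one_add_sq_div_two_le_cosh (x : ℝ) : 1 + x ^ 2 / 2 ≤ Real.cosh x := by
  have h1 := Real.cosh_two_mul (x / 2)
  have h2 := Real.cosh_sq (x / 2)
  rw [show 2 * (x / 2) = x by ring] at h1
  have h3 : (x / 2) ^ 2 ≤ Real.sinh (x / 2) ^ 2 := by
    rcases le_total 0 (x / 2) with h | h
    · exact pow_le_pow_left₀ h (Real.self_le_sinh_iff.2 h) 2
    · have := Real.sinh_le_self_iff.2 h
      nlinarith
  linarith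

/-- `cosh (r w)` is at least `1 + r² w² / 2`, and the margin `ε r² / 2` absorbs the quartic error of
the exponential. -/
theorem eventually_exp_le_cosh (w : ℝ) {ε : ℝ} (hε : 0 < ε) :
    ∀ᶠ r in 𝓝[>] (0 : ℝ), Real.exp (r ^ 2 * (w ^ 2 - ε) / 2) ≤ Real.cosh (r * w) := by
  obtain ⟨k, hk⟩ : ∃ k, k = (w ^ 2 - ε) / 2 := ⟨_, rfl⟩
  have h1 : Tendsto (fun r : ℝ => r ^ 2 * k) (𝓝[>] 0) (𝓝 0) := by
    have : Tendsto (fun r : ℝ => r ^ 2 * k) (𝓝 0) (𝓝 (0 ^ 2 * k)) :=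
      Continuous.tendsto (by fun_prop) 0
    simpa using this.mono_left nhdsWithin_le_nhds
  have h2 : Tendsto (fun r : ℝ => r ^ 2 * k ^ 2) (𝓝[>] 0) (𝓝 0) := by
    have : Tendsto (fun r : ℝ => r ^ 2 * k ^ 2) (𝓝 0) (𝓝 (0 ^ 2 * k ^ 2)) :=
      Continuous.tendsto (by fun_prop) 0
    simpa using this.mono_left nhdsWithin_le_nhds
  have h1' : ∀ᶠ r in 𝓝[>] (0 : ℝ), |r ^ 2 * k| < 1 := by
    have := h1.abs
    rw [abs_zero] at this
    exact this.eventually_lt_const one_pos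
  filter_upwards [h1', h2.eventually_lt_const (half_pos hε)] with r hr1 hr2
  have h3 := (abs_le.1 (Real.abs_exp_sub_one_sub_id_le hr1.le)).2
  have h4 := Real.one_add_sq_div_two_le_cosh (r * w)
  rw [show r ^ 2 * (w ^ 2 - ε) / 2 = r ^ 2 * k by rw [hk]; ring]
  have h5 : (r ^ 2 * k) ^ 2 ≤ r ^ 2 * (ε / 2) := by
    have : (r ^ 2 * k) ^ 2 = r ^ 2 * (r ^ 2 * k ^ 2) := by ring
    rw [this]; gcongr
  have h6 : r ^ 2 * k + r ^ 2 * (ε / 2) = (r * w) ^ 2 / 2 := by rw [hk]; ring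
  linarith

/-- Semiconvexity of `log F` bounds the geometric mean below by a multiple of `F`; the resulting
upper bound on its polar differs from `F°` only by `O(r²)`, as domination requires. -/
theorem NiceFun.polarFun_geomShift_le {F : Rn n → ℝ} (hF : NiceFun F) {a : Rn n} {β r : ℝ}
    (h : ∀ x, F x ^ 2 ≤ Real.exp (β * r ^ 2) * (F (x + r • a) * F (x - r • a))) (z : Rn n) :
    polarFun (geomShift (r • a) F) z ≤ polarFun F z * ENNReal.ofReal (Real.exp (β * r ^ 2 / 2)) := by
  set E := Real.exp (β * r ^ 2 / 2)
  have hE : 0 < E := Real.exp_pos _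
  rw [← ENNReal.div_le_iff (by simpa using hE) ENNReal.ofReal_ne_top, le_polarFun_iff]
  intro y
  refine le_trans ?_ (polarFun_mul_le (geomShift (r • a) F) z y)
  rw [ENNReal.div_eq_inv_mul, mul_comm _ (polarFun _ z), mul_assoc, ← ENNReal.ofReal_inv_of_pos hE,
    ← ENNReal.ofReal_mul (by positivity)]
  gcongr
  rw [inv_mul_le_iff₀ hE]
  have hp : 0 ≤ F (y + r • a) * F (y - r • a) := mul_nonneg (hF.pos _).le (hF.pos _).le
  refine abs_le_of_sq_le_sq' ((h y).trans_eq ?_) (by unfold geomShift; positivity) |>.2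
  rw [mul_pow, geomShift, Real.sq_sqrt hp, ← Real.exp_nat_mul]
  congr 2
  push_cast
  ring

theorem NiceFun.exists_le_ball {F : Rn n → ℝ} (hF : NiceFun F) (ρ : ℝ) :
    ∃ c : ℝ, 0 < c ∧ ∀ x, ‖x‖ ≤ ρ → c ≤ F x := by
  rcases lt_or_ge ρ 0 with hρ | hρ
  · exact ⟨1, one_pos, fun x hx => absurd (norm_nonneg x) (by linarith)⟩
  · obtain ⟨x₀, -, hx₀⟩ := (isCompact_closedBall (0 : Rn n) ρ).exists_isMinOn
      ⟨0, by simpa using hρ⟩ hF.cont.continuousOn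
    exact ⟨F x₀, hF.pos _, fun x hx => hx₀ (by simpa using hx)⟩

theorem NiceFun.polarFun_lt_top {F : Rn n → ℝ} (hF : NiceFun F) (z : Rn n) : polarFun F z < ∞ := by
  refine (iInf_le _ 0).trans_lt (ENNReal.div_lt_top ENNReal.ofReal_ne_top ?_)
  simpa using hF.pos 0

theorem NiceFun.lintegral_polarFun_mul_lt_top {F : Rn n → ℝ} (hF : NiceFun F) (a : Rn n)
    {K : ℝ} (hK : 0 ≤ K) :
    ∫⁻ z, polarFun F z * ENNReal.ofReal (K + inner ℝ a z ^ 2 / 2) < ∞ := by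
  obtain ⟨c, hc, hcF⟩ := hF.exists_le_ball 1
  have h := lintegral_exp_neg_norm_mul_lt_top n 2
  have h2 : ∀ z, polarFun F z * ENNReal.ofReal (K + inner ℝ a z ^ 2 / 2) ≤
      ENNReal.ofReal (c⁻¹ * (K + ‖a‖ ^ 2 / 2)) *
        ENNReal.ofReal (Real.exp (-‖z‖) * (1 + ‖z‖) ^ 2) := by
    intro z
    calc _ ≤ ENNReal.ofReal (c⁻¹ * Real.exp (-(1 * ‖z‖))) *
          ENNReal.ofReal ((K + ‖a‖ ^ 2 / 2) * (1 + ‖z‖) ^ 2) := by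
          gcongr
          · exact polarFun_le_exp_neg_norm hc zero_le_one hcF z
          · have h3 : inner ℝ a z ^ 2 ≤ (‖a‖ * ‖z‖) ^ 2 :=
              sq_le_sq' (by linarith [(abs_le.1 (abs_real_inner_le_norm a z)).1])
                (real_inner_le_norm a z)
            have h4 : 1 ≤ (1 + ‖z‖) ^ 2 := one_le_pow₀ (by linarith [norm_nonneg z])
            have h5 : ‖z‖ ^ 2 ≤ (1 + ‖z‖) ^ 2 := by
              gcongr; linarith [norm_nonneg z]
            nlinarith [mul_le_mul_of_nonneg_left h4 hK,
              mul_le_mul_of_nonneg_left h5 (sq_nonneg ‖a‖)]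
      _ = _ := by
          rw [← ENNReal.ofReal_mul (by positivity), ← ENNReal.ofReal_mul (by positivity), one_mul]
          congr 1; ring
  refine (lintegral_mono h2).trans_lt ?_
  rw [lintegral_const_mul _ (by fun_prop)]
  exact ENNReal.mul_lt_top ENNReal.ofReal_lt_top h

theorem polarFun_mul_exp_le_avg_lineGauss {f : Rn n → ℝ} (hf : ∀ x, 0 ≤ f x) (b z : Rn n) :
    polarFun f z * ENNReal.ofReal (Real.exp (-(inner ℝ b z ^ 2 / 2)))
      ≤ polarFun (avg (lineGauss b) f) z :=
  polarFun_mul_exp_le_avg hf (lintegral_exp_lineGauss b z).le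

/-- In the variance variable `r²`, the lower right derivative of `∫ F°` at `0` is nonnegative.
Prékopa–Leindler gives `∫ F° ≤ ∫ q r`, and the positive part of `(q r - p r) / r²` tends to `0`
pointwise and is dominated. -/
theorem NiceFun.eventually_lintegral_polarFun_le {F : Rn n → ℝ} (hF : NiceFun F) (a : Rn n)
    {ε : ℝ} (hε : 0 < ε) :
    ∀ᶠ r in 𝓝[>] (0 : ℝ), ∫⁻ z, polarFun F z ≤
      (∫⁻ z, polarFun (avg (lineGauss (r • a)) F) z) + ENNReal.ofReal (ε * r ^ 2) := by
  obtain ⟨β, hβ, hsc⟩ := hF.semiconvex a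
  set q : ℝ → Rn n → ℝ≥0∞ := fun r z =>
    polarFun (geomShift (r • a) F) z * ENNReal.ofReal (Real.cosh (inner ℝ (r • a) z))⁻¹
  set p : ℝ → Rn n → ℝ≥0∞ := fun r z => polarFun (avg (lineGauss (r • a)) F) z
  -- Subtraction in `ℝ≥0∞` is truncated, so `d` is the positive part of the difference quotient,
  -- which is all that is needed.
  set d : ℝ → Rn n → ℝ≥0∞ := fun r z => (q r z - p r z) / ENNReal.ofReal (r ^ 2)
  have hcosh : Measurable Real.cosh := Real.continuous_cosh.measurable
  have hqm : ∀ r, Measurable (q r) := fun r =>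
    (measurable_polarFun _).mul (by fun_prop)
  have hpm : ∀ r, Measurable (p r) := fun r => measurable_polarFun _
  have hdm : ∀ r, Measurable (d r) := fun r => ((hqm r).sub (hpm r)).div_const _
  have hr1 : ∀ᶠ r in 𝓝[>] (0 : ℝ), r < 1 :=
    (eventually_lt_nhds one_pos).filter_mono nhdsWithin_le_nhds
  have hq : ∀ r z, q r z ≤ polarFun F z * ENNReal.ofReal (Real.exp (β * r ^ 2 / 2)) := by
    intro r z
    calc q r z ≤ polarFun (geomShift (r • a) F) z * 1 := by
          simp only [q]
          gcongr
          simpa using inv_le_one_of_one_le₀ (Real.one_le_cosh _)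
      _ ≤ _ := by
          rw [mul_one]
          exact hF.polarFun_geomShift_le (fun x => hsc x r) z
  have hd_le : ∀ {r : ℝ} {z : Rn n} {b : ℝ≥0∞}, 0 < r →
      q r z ≤ p r z + ENNReal.ofReal (r ^ 2) * b → d r z ≤ b := by
    intro r z b hr h
    have h1 : q r z - p r z ≤ ENNReal.ofReal (r ^ 2) * b := tsub_le_iff_left.2 h
    exact ENNReal.div_le_of_le_mul' h1
  have hlim : Tendsto (fun r => ∫⁻ z, d r z) (𝓝[>] 0) (𝓝 (∫⁻ _ : Rn n, 0)) := by
    refine tendsto_lintegral_filter_of_dominated_convergence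
      (fun z => polarFun F z * ENNReal.ofReal (β / 2 * Real.exp (β / 2) + inner ℝ a z ^ 2 / 2))
      (Eventually.of_forall hdm) ?_ (hF.lintegral_polarFun_mul_lt_top a (by positivity)).ne ?_
    · filter_upwards [hr1, self_mem_nhdsWithin] with r hr hr0
      replace hr0 : 0 < r := hr0
      refine Eventually.of_forall fun z => hd_le hr0 ?_
      have h1 := polarFun_mul_exp_le_avg_lineGauss (fun x => (hF.pos x).le) (r • a) z
      refine (hq r z).trans ?_
      set w := inner ℝ a z
      have hw : inner ℝ (r • a) z = r * w := by simp [inner_smul_left, w]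
      rw [hw] at h1
      -- The bounds `q r ≤ F° e^{β r²/2}` and `p r ≥ F° e^{-(r w)²/2}` differ by `F°` times a
      -- multiple of `r²` that is quadratic in `w`.
      have h2 : Real.exp (β * r ^ 2 / 2) ≤ Real.exp (-((r * w) ^ 2 / 2)) +
          r ^ 2 * (β / 2 * Real.exp (β / 2) + w ^ 2 / 2) := by
        have h3 := Real.add_one_le_exp (-((r * w) ^ 2 / 2))
        have h4 : Real.exp (β * r ^ 2 / 2) ≤ 1 + β * r ^ 2 / 2 * Real.exp (β / 2) := by
          have h5 := Real.add_one_le_exp (-(β * r ^ 2 / 2))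
          have h6 : Real.exp (β * r ^ 2 / 2) * Real.exp (-(β * r ^ 2 / 2)) = 1 := by
            rw [← Real.exp_add]; simp
          have h7 : Real.exp (β * r ^ 2 / 2) ≤ Real.exp (β / 2) := by
            gcongr
            have : r ^ 2 ≤ 1 := pow_le_one₀ hr0.le hr.le
            nlinarith
          have h8 := mul_le_mul_of_nonneg_left h5 (Real.exp_pos (β * r ^ 2 / 2)).le
          have h9 := mul_le_mul_of_nonneg_left h7 (by positivity : 0 ≤ β * r ^ 2 / 2)
          linarith
        linarith
      calc polarFun F z * ENNReal.ofReal (Real.exp (β * r ^ 2 / 2))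
          ≤ polarFun F z * ENNReal.ofReal (Real.exp (-((r * w) ^ 2 / 2)) +
              r ^ 2 * (β / 2 * Real.exp (β / 2) + w ^ 2 / 2)) := by gcongr
        _ = polarFun F z * ENNReal.ofReal (Real.exp (-((r * w) ^ 2 / 2))) +
              ENNReal.ofReal (r ^ 2) * (polarFun F z *
                ENNReal.ofReal (β / 2 * Real.exp (β / 2) + w ^ 2 / 2)) := by
            rw [ENNReal.ofReal_add (by positivity) (by positivity),
              ENNReal.ofReal_mul (p := r ^ 2) (by positivity)]
            ring
        _ ≤ _ := by gcongr
    · refine Eventually.of_forall fun z => ENNReal.tendsto_nhds_zero.2 fun δ hδ => ?_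
      set G := polarFun F z * ENNReal.ofReal (Real.exp (β / 2))
      have hG : G ≠ ∞ := ENNReal.mul_ne_top (hF.polarFun_lt_top z).ne ENNReal.ofReal_ne_top
      obtain ⟨κ, hκ, hκδ⟩ := ENNReal.exists_nnreal_pos_mul_lt hG hδ.ne'
      have hκ0 : 0 < (κ : ℝ) := by exact_mod_cast hκ
      filter_upwards [hr1, self_mem_nhdsWithin, eventually_polarFun_geomShift_le hF a z hκ0,
        eventually_exp_le_cosh (inner ℝ a z) hκ0] with r hr hr0 h1 h2
      replace hr0 : 0 < r := hr0
      refine (hd_le hr0 ?_).trans hκδ.le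
      set w := inner ℝ a z
      have hw : inner ℝ (r • a) z = r * w := by simp [inner_smul_left, w]
      -- The gain `e^{-r² w² / 2}` from `1 / cosh` and the loss `e^{r² w² / 2}` from averaging
      -- cancel; only the two `κ r² / 2` margins remain.
      have h3 : q r z * ENNReal.ofReal (Real.exp (-(κ * r ^ 2))) ≤ p r z := by
        refine le_trans ?_ h1
        simp only [q]
        rw [mul_assoc, ← ENNReal.ofReal_mul (inv_nonneg.2 (Real.cosh_pos _).le), hw]
        gcongr
        rw [inv_mul_le_iff₀ (Real.cosh_pos _)]
        calc Real.exp (-(κ * r ^ 2)) = Real.exp (r ^ 2 * (w ^ 2 - κ) / 2) *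
              Real.exp (-((w ^ 2 + κ) * r ^ 2 / 2)) := by
              rw [← Real.exp_add]; congr 1; ring
          _ ≤ _ := by gcongr
      have h4 : q r z ≤ G := by
        refine (hq r z).trans ?_
        simp only [G]
        gcongr
        have : r ^ 2 ≤ 1 := pow_le_one₀ hr0.le hr.le
        nlinarith
      have h5 : 1 ≤ Real.exp (-(κ * r ^ 2)) + κ * r ^ 2 := by
        linarith [Real.add_one_le_exp (-(κ * r ^ 2))]
      calc q r z = q r z * 1 := (mul_one _).symm
        _ ≤ q r z * ENNReal.ofReal (Real.exp (-(κ * r ^ 2)) + κ * r ^ 2) := by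
            gcongr
            simpa using h5
        _ = q r z * ENNReal.ofReal (Real.exp (-(κ * r ^ 2))) +
              ENNReal.ofReal (r ^ 2) * (κ * q r z) := by
            rw [ENNReal.ofReal_add (by positivity) (by positivity),
              ENNReal.ofReal_mul (by positivity), ENNReal.ofReal_coe_nnreal]
            ring
        _ ≤ _ := by gcongr
  rw [lintegral_zero] at hlim
  filter_upwards [hlim.eventually_le_const (ENNReal.ofReal_pos.2 hε), self_mem_nhdsWithin]
    with r hr hr0
  replace hr0 : 0 < r := hr0
  have hr2 : ENNReal.ofReal (r ^ 2) ≠ 0 := by simpa using hr0.ne'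
  calc ∫⁻ z, polarFun F z ≤ ∫⁻ z, q r z :=
        lintegral_polarFun_le_geomShift (fun x => (hF.pos x).le) hF.even (r • a)
    _ ≤ ∫⁻ z, (p r z + ENNReal.ofReal (r ^ 2) * d r z) := by
        refine lintegral_mono fun z => ?_
        simp only [d]
        rw [ENNReal.mul_div_cancel hr2 ENNReal.ofReal_ne_top]
        exact le_add_tsub
    _ = (∫⁻ z, p r z) + ENNReal.ofReal (r ^ 2) * ∫⁻ z, d r z := by
        rw [lintegral_add_left (hpm r), lintegral_const_mul _ (hdm r)]
    _ ≤ _ := by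
        gcongr
        calc _ ≤ ENNReal.ofReal (r ^ 2) * ENNReal.ofReal ε := by gcongr
          _ = _ := by rw [← ENNReal.ofReal_mul (by positivity), mul_comm]

theorem NiceFun.continuous_avg_lineGauss {F : Rn n → ℝ} (hF : NiceFun F) (b : Rn n) :
    Continuous fun p : ℝ × Rn n => avg (lineGauss (√p.1 • b)) F p.2 := by
  have hc := hF.cont
  obtain ⟨C, -, hC⟩ := hF.bounded
  have : ∀ p : ℝ × Rn n, avg (lineGauss (√p.1 • b)) F p.2 =
      ∫ τ, F (p.2 + τ • √p.1 • b) ∂(gaussianReal 0 1) := by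
    intro p
    rw [avg, lineGauss, integral_map (by fun_prop) (by fun_prop)]
  simp_rw [this]
  refine continuous_of_dominated (bound := fun _ => C) (fun p => by fun_prop)
    (fun p => Eventually.of_forall fun τ => ?_) (integrable_const _)
    (Eventually.of_forall fun τ => by fun_prop)
  rw [Real.norm_of_nonneg (hF.pos _).le]
  exact hC _

/-- Joint continuity gives a positive minimum of the averages over a compact set of times and the
unit ball, the lower bound required by `eventually_lintegral_polarFun_lt`. Negative times are
harmless because `√t = 0` there. -/
theorem NiceFun.upperSemicontinuous_lintegral_polarFun {F : Rn n → ℝ} (hF : NiceFun F)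
    (b : Rn n) :
    UpperSemicontinuous fun t : ℝ => ∫⁻ z, polarFun (avg (lineGauss (√t • b)) F) z := by
  intro t y hy
  have hc := hF.continuous_avg_lineGauss b
  obtain ⟨p₀, -, hp₀⟩ := ((isCompact_closedBall t 1).prod
    (isCompact_closedBall (0 : Rn n) 1)).exists_isMinOn
    ⟨(t, 0), by simp⟩ hc.continuousOn
  refine eventually_lintegral_polarFun_lt (c := avg (lineGauss (√p₀.1 • b)) F p₀.2)
    (fun x => ?_) (hF.avg_pos _ _) ?_ hy
  · exact (hc.comp (Continuous.prodMk_left x)).tendsto t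
  · filter_upwards [Metric.closedBall_mem_nhds t one_pos] with s hs x hx
    exact hp₀ (a := (s, x)) ⟨hs, by simpa using hx⟩

/-- Continuous induction on the variance `t`: the set where `N 0 ≤ N t + ε t` is closed by upper
semicontinuity, and from any of its points in `[0, 1)` the semigroup law allows a further step `r²`,
since the averaged function is again nice. -/
theorem NiceFun.lintegral_polarFun_le_avg_lineGauss {F : Rn n → ℝ} (hF : NiceFun F)
    (b : Rn n) :
    ∫⁻ z, polarFun F z ≤ ∫⁻ z, polarFun (avg (lineGauss b) F) z := by
  set N : ℝ → ℝ≥0∞ := fun t => ∫⁻ z, polarFun (avg (lineGauss (√t • b)) F) z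
  have hN0 : N 0 = ∫⁻ z, polarFun F z := by
    have : avg (lineGauss (√0 • b)) F = F := by
      ext x
      rw [avg, lineGauss, integral_map (by fun_prop) (by have := hF.cont; fun_prop)]
      simp
    simp only [N, this]
  have hN1 : N 1 = ∫⁻ z, polarFun (avg (lineGauss b) F) z := by simp [N]
  rw [← hN0, ← hN1]
  refine ENNReal.le_of_forall_pos_le_add fun ε hε _ => ?_
  have hε' : 0 < (ε : ℝ) := by exact_mod_cast hε
  set S : Set ℝ := {t | N 0 ≤ N t + ENNReal.ofReal (ε * t)}
  have hS : IsClosed S := by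
    have h1 : UpperSemicontinuous fun t : ℝ => N t + ENNReal.ofReal (ε * t) :=
      (hF.upperSemicontinuous_lintegral_polarFun b).add
        (ENNReal.continuous_ofReal.comp (continuous_const_mul _)).upperSemicontinuous
    exact h1.isClosed_preimage (N 0)
  have h1S : (1 : ℝ) ∈ S := by
    refine IsClosed.mem_of_ge_of_forall_exists_gt (a := (0 : ℝ)) (b := 1) (hS.inter isClosed_Icc)
      (by simp [S]) zero_le_one ?_
    rintro t ⟨ht, ht0, ht1⟩
    have hFt := hF.avg_lineGauss (√t • b)
    have hr1 : ∀ᶠ r in 𝓝[>] (0 : ℝ), r ^ 2 < 1 - t := by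
      have : Tendsto (fun r : ℝ => r ^ 2) (𝓝 0) (𝓝 (0 ^ 2)) := Continuous.tendsto (by fun_prop) 0
      rw [zero_pow two_ne_zero] at this
      exact (this.mono_left nhdsWithin_le_nhds).eventually_lt_const (by linarith)
    obtain ⟨r, hr, hr1, hr0⟩ := ((hFt.eventually_lintegral_polarFun_le b hε').and
      (hr1.and self_mem_nhdsWithin)).exists
    replace hr0 : 0 < r := hr0
    refine ⟨t + r ^ 2, ?_, by nlinarith, by linarith⟩
    have e : avg (lineGauss (r • b)) (avg (lineGauss (√t • b)) F)
        = avg (lineGauss (√(t + r ^ 2) • b)) F := by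
      ext x
      have hconv := lineGauss_conv b (p := r) (q := √t) (r := √(t + r ^ 2))
        (by rw [Real.sq_sqrt ht0, Real.sq_sqrt (by positivity)]; ring)
      rw [avg_avg (by rw [hconv]; exact hF.integrable_translate _ x), hconv]
    rw [e] at hr
    have ht' : N 0 ≤ N t + ENNReal.ofReal (ε * t) := ht
    calc N 0 ≤ N t + ENNReal.ofReal (ε * t) := ht'
      _ ≤ N (t + r ^ 2) + ENNReal.ofReal (ε * r ^ 2) + ENNReal.ofReal (ε * t) := by
          gcongr
      _ = N (t + r ^ 2) + ENNReal.ofReal (ε * (t + r ^ 2)) := by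
          rw [add_assoc, ← ENNReal.ofReal_add (by positivity) (by positivity)]
          congr 2
          ring
  have : N 0 ≤ N 1 + ENNReal.ofReal (ε * 1) := h1S
  simpa using this

end LineMonotonicity

/-! ### Monotonicity along the heat flow -/

section HeatMonotonicity

variable {n : ℕ}

open ProbabilityTheory

/-- Average along the coordinate axes one after another; the characteristic function records the
axes already treated and identifies the final measure. -/
theorem NiceFun.lintegral_polarFun_le_avg_gaussVec {F : Rn n → ℝ} (hF : NiceFun F) {s : ℝ}
    (hs : 0 < s) : ∫⁻ z, polarFun F z ≤ ∫⁻ z, polarFun (avg (gaussVec n s) F) z := by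
  have key : ∀ S : Finset (Fin n), ∃ μ : Measure (Rn n), IsProbabilityMeasure μ ∧
      (∀ t : Rn n, charFun μ t = Complex.exp ((-(s * (∑ i ∈ S, t i ^ 2) / 2) : ℝ))) ∧
      NiceFun (avg μ F) ∧ ∫⁻ z, polarFun F z ≤ ∫⁻ z, polarFun (avg μ F) z := by
    intro S
    induction S using Finset.induction_on with
    | empty =>
      have : avg (Measure.dirac 0) F = F := by
        ext x; simp [avg]
      refine ⟨Measure.dirac 0, inferInstance, fun t => by simp, ?_, ?_⟩ <;> rw [this]
      exact hF
    | insert i S hi ih =>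
      obtain ⟨μ, hμ, hchar, hnice, hle⟩ := ih
      set b : Rn n := EuclideanSpace.single i (√s)
      have e : avg ((lineGauss b).conv μ) F = avg (lineGauss b) (avg μ F) := by
        ext x
        rw [avg_avg (hF.integrable_translate _ x)]
      refine ⟨(lineGauss b).conv μ, inferInstance, fun t => ?_, ?_, ?_⟩
      · rw [charFun_conv, charFun_lineGauss, hchar, ← Complex.exp_add, Finset.sum_insert hi]
        congr 1
        rw [← Complex.ofReal_add]
        congr 1
        simp only [b, EuclideanSpace.inner_single_left, conj_trivial]
        rw [mul_pow, Real.sq_sqrt hs.le]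
        ring
      · rw [e]; exact hnice.avg_lineGauss b
      · rw [e]; exact hle.trans (hnice.lintegral_polarFun_le_avg_lineGauss b)
  obtain ⟨μ, hμ, hchar, -, hle⟩ := key Finset.univ
  have := isProbabilityMeasure_gaussVec (n := n) hs
  have hμe : μ = gaussVec n s := by
    refine Measure.ext_of_charFun (funext fun t => ?_)
    rw [hchar, charFun_gaussVec hs, EuclideanSpace.real_norm_sq_eq]
  rwa [hμe] at hle

/-! ### Gaussian averages of integrable functions -/

theorem avg_gaussVec_eq {s : ℝ} (hs : 0 < s) (f : Rn n → ℝ) (x : Rn n) :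
    avg (gaussVec n s) f x = ∫ y, gaussKernel s (x - y) * f y := by
  rw [avg, integral_gaussVec hs,
    ← integral_add_left_eq_self (fun y => gaussKernel s (x - y) * f y) x]
  refine integral_congr_ae (Eventually.of_forall fun w => ?_)
  simp only [smul_eq_mul]
  rw [show x - (x + w) = -w by abel, gaussKernel_neg]

theorem gaussKernel_le {s : ℝ} (hs : 0 < s) (x : Rn n) :
    gaussKernel s x ≤ ((2 * Real.pi * s) ^ ((n : ℝ) / 2))⁻¹ := by
  rw [gaussKernel_eq]
  refine mul_le_of_le_one_right (by positivity) (Real.exp_le_one_iff.2 ?_)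
  have : 0 ≤ 1 / (2 * s) * ‖x‖ ^ 2 := by positivity
  linarith

theorem integrable_kernel_mul {k f : Rn n → ℝ} (hf : Integrable f volume) (hk : Continuous k)
    {C : ℝ} (hC : ∀ x, |k x| ≤ C) (x : Rn n) : Integrable (fun y => k (x - y) * f y) volume :=
  hf.bdd_mul (by fun_prop) (Eventually.of_forall fun y => hC _)

theorem continuous_integral_kernel_mul {k f : Rn n → ℝ} (hf : Integrable f volume)
    (hk : Continuous k) {C : ℝ} (hC : ∀ x, |k x| ≤ C) :
    Continuous fun x => ∫ y, k (x - y) * f y := by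
  refine continuous_of_dominated (bound := fun y => C * |f y|)
    (fun x => (integrable_kernel_mul hf hk hC x).aestronglyMeasurable)
    (fun x => Eventually.of_forall fun y => ?_) (hf.abs.const_mul C)
    (Eventually.of_forall fun y => by fun_prop)
  rw [Real.norm_eq_abs, abs_mul]
  gcongr
  exact hC _

theorem abs_integral_kernel_mul_le {k f : Rn n → ℝ} (hf : Integrable f volume)
    {C : ℝ} (hC : ∀ x, |k x| ≤ C) (x : Rn n) :
    |∫ y, k (x - y) * f y| ≤ C * ∫ y, |f y| := by
  rw [← integral_const_mul, ← Real.norm_eq_abs]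
  refine norm_integral_le_of_norm_le (hf.abs.const_mul C) (Eventually.of_forall fun y => ?_)
  rw [Real.norm_eq_abs, abs_mul]
  gcongr
  exact hC _

theorem abs_gaussKernel_le {s : ℝ} (hs : 0 < s) (x : Rn n) :
    |gaussKernel s x| ≤ ((2 * Real.pi * s) ^ ((n : ℝ) / 2))⁻¹ := by
  rw [abs_of_pos (gaussKernel_pos hs x)]
  exact gaussKernel_le hs x

theorem integrable_translate_gaussVec {s : ℝ} (hs : 0 < s) {f : Rn n → ℝ}
    (hf : Integrable f volume) (x : Rn n) : Integrable (fun w => f (x + w)) (gaussVec n s) := by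
  have hm := (continuous_gaussKernel (n := n) s).measurable
  rw [gaussVec, integrable_withDensity_iff_integrable_smul' (by fun_prop) (by simp)]
  have := ((integrable_kernel_mul hf (continuous_gaussKernel s) (abs_gaussKernel_le hs) x).comp_add_left x)
  refine this.congr (Eventually.of_forall fun w => ?_)
  simp only [smul_eq_mul, ENNReal.toReal_ofReal (gaussKernel_pos hs _).le]
  rw [show x - (x + w) = -w by abel, gaussKernel_neg]

theorem avg_gaussVec_avg {s t : ℝ} (hs : 0 < s) (ht : 0 < t) {f : Rn n → ℝ}
    (hf : Integrable f volume) :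
    avg (gaussVec n s) (avg (gaussVec n t) f) = avg (gaussVec n (s + t)) f := by
  have := isProbabilityMeasure_gaussVec (n := n) hs
  have := isProbabilityMeasure_gaussVec (n := n) ht
  ext x
  rw [avg_avg, gaussVec_conv hs ht]
  rw [gaussVec_conv hs ht]
  exact integrable_translate_gaussVec (add_pos hs ht) hf x

/-- Three uses of the mean value inequality; the sharp factor `1/6` is given up. -/
theorem abs_taylor_two_le {g g₁ g₂ g₃ : ℝ → ℝ} (h0 : ∀ τ, HasDerivAt g (g₁ τ) τ)
    (h1 : ∀ τ, HasDerivAt g₁ (g₂ τ) τ) (h2 : ∀ τ, HasDerivAt g₂ (g₃ τ) τ) {C : ℝ}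
    (hC : ∀ τ, |g₃ τ| ≤ C) (τ : ℝ) :
    |g τ - g 0 - τ * g₁ 0 - τ ^ 2 / 2 * g₂ 0| ≤ C * |τ| ^ 3 := by
  have mv : ∀ (k k' : ℝ → ℝ), (∀ σ, HasDerivAt k (k' σ) σ) → ∀ (T B : ℝ),
      (∀ σ, |σ| ≤ |T| → |k' σ| ≤ B) → |k T - k 0| ≤ B * |T| := by
    intro k k' hk T B hB
    have := (convex_Icc (-|T|) |T|).norm_image_sub_le_of_norm_hasDerivWithin_le
      (f := k) (f' := k') (C := B) (x := 0) (y := T) (fun σ _ => (hk σ).hasDerivWithinAt)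
      (fun σ hσ => hB σ (abs_le.2 hσ)) (Set.mem_Icc.2 ⟨by simp, abs_nonneg T⟩)
      (Set.mem_Icc.2 ⟨neg_abs_le T, le_abs_self T⟩)
    simpa using this
  have hC0 : 0 ≤ C := (abs_nonneg _).trans (hC 0)
  have s2 : ∀ T, |g₂ T - g₂ 0| ≤ C * |T| := fun T => mv g₂ g₃ h2 T C fun σ _ => hC σ
  have s1 : ∀ T, |g₁ T - g₁ 0 - T * g₂ 0| ≤ C * |T| ^ 2 := by
    intro T
    have := mv (fun σ => g₁ σ - σ * g₂ 0) (fun σ => g₂ σ - g₂ 0)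
      (fun σ => (h1 σ).sub (by simpa using (hasDerivAt_id σ).mul_const (g₂ 0))) T (C * |T|)
      fun σ hσ => (s2 σ).trans (by gcongr)
    rw [show g₁ T - g₁ 0 - T * g₂ 0 = g₁ T - T * g₂ 0 - (g₁ 0 - 0 * g₂ 0) by ring]
    exact this.trans_eq (by ring)
  have := mv (fun σ => g σ - σ * g₁ 0 - σ ^ 2 / 2 * g₂ 0) (fun σ => g₁ σ - g₁ 0 - σ * g₂ 0)
    (fun σ => ((h0 σ).sub (by simpa using (hasDerivAt_id σ).mul_const (g₁ 0))).sub (by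
      simpa using ((((hasDerivAt_id σ).pow 2).div_const 2).mul_const (g₂ 0)))) τ (C * |τ| ^ 2)
    fun σ hσ => (s1 σ).trans (by gcongr)
  rw [show g τ - g 0 - τ * g₁ 0 - τ ^ 2 / 2 * g₂ 0 =
    g τ - τ * g₁ 0 - τ ^ 2 / 2 * g₂ 0 - (g 0 - 0 * g₁ 0 - 0 ^ 2 / 2 * g₂ 0) by ring]
  exact this.trans_eq (by ring)

/-- Uses `e^u ≥ u²/2` with `u = y²/(2s)`. The weight `1 + y⁴` dominates every polynomial factor met
below, all of degree at most three. -/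
theorem one_add_pow_four_mul_exp_le {s : ℝ} (hs : 0 < s) (y : ℝ) :
    (1 + y ^ 4) * Real.exp (-y ^ 2 / (2 * s)) ≤ 1 + 8 * s ^ 2 := by
  have hu : 0 ≤ y ^ 2 / (2 * s) := by positivity
  have h1 := Real.quadratic_le_exp_of_nonneg hu
  have h2 : Real.exp (y ^ 2 / (2 * s)) * Real.exp (-y ^ 2 / (2 * s)) = 1 := by
    rw [← Real.exp_add, neg_div]; simp
  have h3 : y ^ 4 = 8 * s ^ 2 * ((y ^ 2 / (2 * s)) ^ 2 / 2) := by field_simp; ring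
  have h4 : y ^ 4 ≤ 8 * s ^ 2 * Real.exp (y ^ 2 / (2 * s)) := by
    rw [h3]; gcongr; linarith
  have h5 : Real.exp (-y ^ 2 / (2 * s)) ≤ 1 := by
    rw [neg_div]; exact Real.exp_le_one_iff.2 (by linarith)
  calc _ = Real.exp (-y ^ 2 / (2 * s)) + y ^ 4 * Real.exp (-y ^ 2 / (2 * s)) := by ring
    _ ≤ 1 + 8 * s ^ 2 * Real.exp (y ^ 2 / (2 * s)) * Real.exp (-y ^ 2 / (2 * s)) := by gcongr
    _ = _ := by rw [mul_assoc, h2, mul_one]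

/-- Along a line the derivatives are Hermite polynomials in `L = ⟨a, ·⟩ / s` times the kernel `k`:
`-L k`, `(L² - α) k` and `(3 α L - L³) k`, all bounded by Gaussian decay. -/
theorem exists_gaussKernel_taylor {s : ℝ} (hs : 0 < s) (a : Rn n) :
    ∃ (k₁ k₂ : Rn n → ℝ) (C : ℝ), Continuous k₁ ∧ Continuous k₂ ∧
      (∀ x, |k₁ x| ≤ C) ∧ (∀ x, |k₂ x| ≤ C) ∧ ∀ (x : Rn n) (τ : ℝ),
      |gaussKernel s (x + τ • a) - gaussKernel s x - τ * k₁ x - τ ^ 2 / 2 * k₂ x|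
        ≤ C * |τ| ^ 3 := by
  set c := ((2 * Real.pi * s) ^ ((n : ℝ) / 2))⁻¹
  have hc : 0 < c := by positivity
  set α := ‖a‖ ^ 2 / s
  have hα : 0 ≤ α := by positivity
  set L : Rn n → ℝ := fun x => inner ℝ a x / s
  set k : Rn n → ℝ := gaussKernel s
  have hkc : Continuous k := continuous_gaussKernel s
  have hLc : Continuous L := by fun_prop
  have hL : ∀ x τ, L (x + τ • a) = L x + τ * α := by
    intro x τ
    simp only [L, α]
    rw [inner_add_right, inner_smul_right, real_inner_self_eq_norm_sq]
    ring
  have hdL : ∀ x τ, HasDerivAt (fun τ : ℝ => L (x + τ • a)) α τ := by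
    intro x τ
    simp_rw [hL]
    simpa using ((hasDerivAt_id τ).mul_const α).const_add (L x)
  have hdk : ∀ x τ, HasDerivAt (fun τ : ℝ => k (x + τ • a))
      (-L (x + τ • a) * k (x + τ • a)) τ := by
    intro x τ
    have hk : ∀ σ : ℝ, k (x + σ • a) = k x * Real.exp (-(σ * L x + σ ^ 2 / 2 * α)) := by
      intro σ
      simp only [k, gaussKernel_eq, L, α]
      rw [mul_assoc _ (Real.exp _), ← Real.exp_add, norm_add_sq_real, inner_smul_right, norm_smul,
        mul_pow, Real.norm_eq_abs, sq_abs, real_inner_comm]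
      congr 2
      field_simp
      ring
    have h1 : HasDerivAt (fun σ : ℝ => -(σ * L x + σ ^ 2 / 2 * α)) (-(L x + τ * α)) τ := by
      have := (((hasDerivAt_id' τ).mul_const (L x)).fun_add
        ((((hasDerivAt_id' τ).fun_pow 2).div_const 2).mul_const α)).fun_neg
      simpa using this
    have := (h1.exp).const_mul (k x)
    simp_rw [hk]
    convert! this using 1
    rw [hL]
    ring
  set k₁ : Rn n → ℝ := fun x => -L x * k x
  set k₂ : Rn n → ℝ := fun x => (L x ^ 2 - α) * k x
  set k₃ : Rn n → ℝ := fun x => (3 * α * L x - L x ^ 3) * k x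
  have hd1 : ∀ x τ, HasDerivAt (fun τ : ℝ => k₁ (x + τ • a)) (k₂ (x + τ • a)) τ := by
    intro x τ
    convert! ((hdL x τ).fun_neg).mul (hdk x τ) using 1
    simp only [k₂]
    ring
  have hd2 : ∀ x τ, HasDerivAt (fun τ : ℝ => k₂ (x + τ • a)) (k₃ (x + τ • a)) τ := by
    intro x τ
    convert! (((hdL x τ).fun_pow 2).sub_const α).mul (hdk x τ) using 1
    simp only [k₃]
    push_cast
    ring
  set B := ‖a‖ / s
  have hB : 0 ≤ B := by positivity
  have hLB : ∀ x, |L x| ≤ B * ‖x‖ := by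
    intro x
    simp only [L, B]
    rw [abs_div, abs_of_pos hs, div_mul_eq_mul_div]
    gcongr
    exact abs_real_inner_le_norm a x
  have hkb : ∀ (x : Rn n) (D p : ℝ), 0 ≤ D → |p| ≤ D * (1 + ‖x‖ ^ 4) →
      |p * k x| ≤ D * (c * (1 + 8 * s ^ 2)) := by
    intro x D p hD hp
    have h1 := one_add_pow_four_mul_exp_le hs ‖x‖
    rw [abs_mul, abs_of_pos (gaussKernel_pos hs x)]
    have h2 : k x = c * Real.exp (-‖x‖ ^ 2 / (2 * s)) := by
      simp only [k, gaussKernel, c]; rw [div_eq_inv_mul]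
    calc |p| * gaussKernel s x ≤ D * (1 + ‖x‖ ^ 4) * (c * Real.exp (-‖x‖ ^ 2 / (2 * s))) := by
          rw [← h2]; gcongr; exact (gaussKernel_pos hs x).le
      _ = D * (c * ((1 + ‖x‖ ^ 4) * Real.exp (-‖x‖ ^ 2 / (2 * s)))) := by ring
      _ ≤ _ := by gcongr
  have hp1 : ∀ y : ℝ, 0 ≤ y → y ≤ 1 + y ^ 4 := fun y hy => by
    nlinarith [sq_nonneg (y - 1), sq_nonneg (y ^ 2 - 1), sq_nonneg y]
  have hp2 : ∀ y : ℝ, y ^ 2 ≤ 1 + y ^ 4 := fun y => by nlinarith [sq_nonneg (y ^ 2 - 1)]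
  have hp3 : ∀ y : ℝ, 0 ≤ y → y ^ 3 ≤ 1 + y ^ 4 := fun y hy => by
    nlinarith [sq_nonneg (y - 1), sq_nonneg (y ^ 2 - 1), sq_nonneg (y ^ 2 - y), sq_nonneg y]
  have hb1 : ∀ x, |k₁ x| ≤ B * (c * (1 + 8 * s ^ 2)) := fun x => by
    refine hkb x _ _ hB ?_
    rw [abs_neg]
    exact (hLB x).trans (by gcongr; exact hp1 _ (norm_nonneg x))
  have hL2 : ∀ x, |L x| ^ 2 ≤ B ^ 2 * (1 + ‖x‖ ^ 4) := fun x => by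
    calc |L x| ^ 2 ≤ (B * ‖x‖) ^ 2 := by gcongr; exact hLB x
      _ = B ^ 2 * ‖x‖ ^ 2 := by ring
      _ ≤ _ := by gcongr; exact hp2 _
  have hL3 : ∀ x, |L x| ^ 3 ≤ B ^ 3 * (1 + ‖x‖ ^ 4) := fun x => by
    calc |L x| ^ 3 ≤ (B * ‖x‖) ^ 3 := by gcongr; exact hLB x
      _ = B ^ 3 * ‖x‖ ^ 3 := by ring
      _ ≤ _ := by gcongr; exact hp3 _ (norm_nonneg x)
  have h14 : ∀ x : Rn n, 1 ≤ 1 + ‖x‖ ^ 4 := fun x => by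
    have : 0 ≤ ‖x‖ ^ 4 := by positivity
    linarith
  have hb2 : ∀ x, |k₂ x| ≤ (B ^ 2 + α) * (c * (1 + 8 * s ^ 2)) := fun x => by
    refine hkb x _ _ (by positivity) ?_
    calc |L x ^ 2 - α| ≤ |L x ^ 2| + |α| := abs_sub _ _
      _ ≤ B ^ 2 * (1 + ‖x‖ ^ 4) + α * (1 + ‖x‖ ^ 4) := by
        rw [abs_pow, abs_of_nonneg hα]
        exact add_le_add (hL2 x) (le_mul_of_one_le_right hα (h14 x))
      _ = _ := by ring
  have hb3 : ∀ x, |k₃ x| ≤ (3 * α * B + B ^ 3) * (c * (1 + 8 * s ^ 2)) := fun x => by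
    refine hkb x _ _ (by positivity) ?_
    calc |3 * α * L x - L x ^ 3| ≤ |3 * α * L x| + |L x ^ 3| := abs_sub _ _
      _ ≤ 3 * α * (B * (1 + ‖x‖ ^ 4)) + B ^ 3 * (1 + ‖x‖ ^ 4) := by
        rw [abs_pow, abs_mul, abs_of_nonneg (by positivity : 0 ≤ 3 * α)]
        refine add_le_add ?_ (hL3 x)
        gcongr
        exact (hLB x).trans (by gcongr; exact hp1 _ (norm_nonneg x))
      _ = _ := by ring
  set Q := c * (1 + 8 * s ^ 2)
  have hQ : 0 ≤ Q := by positivity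
  refine ⟨k₁, k₂, B * Q + (B ^ 2 + α) * Q + (3 * α * B + B ^ 3) * Q, by fun_prop, by fun_prop,
    fun x => (hb1 x).trans ?_, fun x => (hb2 x).trans ?_, fun x τ => ?_⟩
  · have : 0 ≤ (B ^ 2 + α) * Q + (3 * α * B + B ^ 3) * Q := by positivity
    linarith
  · have : 0 ≤ B * Q + (3 * α * B + B ^ 3) * Q := by positivity
    linarith
  · have h := abs_taylor_two_le (hdk x) (hd1 x) (hd2 x) (fun τ => hb3 (x + τ • a)) τ
    simp only [zero_smul, add_zero] at h
    refine h.trans ?_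
    gcongr
    have : 0 ≤ B * Q + (B ^ 2 + α) * Q := by positivity
    linarith

theorem avg_gaussVec_pos {s : ℝ} (hs : 0 < s) {f : Rn n → ℝ} (hf : Integrable f volume)
    (hf0 : ∀ x, 0 ≤ f x) (hne : ¬ f =ᵐ[volume] 0) (x : Rn n) : 0 < avg (gaussVec n s) f x := by
  rw [avg_gaussVec_eq hs, integral_pos_iff_support_of_nonneg
    (fun y => mul_nonneg (gaussKernel_pos hs _).le (hf0 y))
    (integrable_kernel_mul hf (continuous_gaussKernel s) (abs_gaussKernel_le hs) x)]
  have : (Function.support fun y => gaussKernel s (x - y) * f y) = Function.support f := by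
    ext y; simp [(gaussKernel_pos hs (x - y)).ne']
  rw [this, pos_iff_ne_zero]
  intro h0
  exact hne (measure_eq_zero_iff_ae_notMem.1 h0 |>.mono fun y hy => by simpa using hy)

/-- Bounded support serves the decay clause. Semiconvexity comes from the exact identity `k(x)² =
e^{‖a‖² τ² / s} k(x + τ a) k(x - τ a)` for the kernel, integrated by Cauchy–Schwarz. -/
theorem niceFun_avg_gaussVec {s : ℝ} (hs : 0 < s) {f : Rn n → ℝ} (hf : Integrable f volume)
    (hf0 : ∀ x, 0 ≤ f x) (hfe : ∀ x, f (-x) = f x) (hne : ¬ f =ᵐ[volume] 0) {ρ : ℝ}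
    (hρ : ∀ x, ρ < ‖x‖ → f x = 0) : NiceFun (avg (gaussVec n s) f) where
  cont := by
    simp_rw [funext (avg_gaussVec_eq hs f)]
    exact continuous_integral_kernel_mul hf (continuous_gaussKernel s) (abs_gaussKernel_le hs)
  pos := avg_gaussVec_pos hs hf hf0 hne
  even := avg_even (gaussVec_map_neg hs) hfe
  decay R hR := by
    set c := ((2 * Real.pi * s) ^ ((n : ℝ) / 2))⁻¹
    have hc : 0 < c := by positivity
    have hI : 0 ≤ ∫ y, f y := integral_nonneg hf0
    refine ⟨c * Real.exp (R ^ 2 * s / 2 + R * ρ) * ∫ y, f y, by positivity, fun x => ?_⟩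
    rw [avg_gaussVec_eq hs]
    have hb : ∀ y, gaussKernel s (x - y) * f y ≤
        c * Real.exp (R ^ 2 * s / 2 + R * ρ) * Real.exp (-(R * ‖x‖)) * f y := by
      intro y
      rcases lt_or_ge ρ ‖y‖ with hy | hy
      · simp [hρ y hy]
      · refine mul_le_mul_of_nonneg_right ?_ (hf0 y)
        rw [gaussKernel_eq, mul_assoc c, ← Real.exp_add]
        change c * _ ≤ _
        gcongr
        have h1 : ‖x‖ ≤ ‖x - y‖ + ρ := by
          have := norm_add_le (x - y) y
          rw [sub_add_cancel] at this
          linarith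
        -- Completing the square: the difference of the two sides is `(‖x - y‖ - R s)² / (2 s)`.
        have h2 : R * ‖x - y‖ - R ^ 2 * s / 2 ≤ 1 / (2 * s) * ‖x - y‖ ^ 2 := by
          have : 1 / (2 * s) * ‖x - y‖ ^ 2 - (R * ‖x - y‖ - R ^ 2 * s / 2) =
            (‖x - y‖ - R * s) ^ 2 / (2 * s) := by field_simp; ring
          have h3 : 0 ≤ (‖x - y‖ - R * s) ^ 2 / (2 * s) := by positivity
          linarith
        have h3 : R * ‖x‖ ≤ R * (‖x - y‖ + ρ) := by gcongr
        linarith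
    calc _ ≤ ∫ y, c * Real.exp (R ^ 2 * s / 2 + R * ρ) * Real.exp (-(R * ‖x‖)) * f y :=
          integral_mono (integrable_kernel_mul hf (continuous_gaussKernel s)
            (abs_gaussKernel_le hs) x) (hf.const_mul _) hb
      _ = _ := by rw [integral_const_mul]; ring
  taylor a := by
    obtain ⟨k₁, k₂, C, c1, c2, b1, b2, h⟩ := exists_gaussKernel_taylor hs a
    have i0 := integrable_kernel_mul hf (continuous_gaussKernel s) (abs_gaussKernel_le hs)
    have i1 := integrable_kernel_mul hf c1 b1
    have i2 := integrable_kernel_mul hf c2 b2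
    refine ⟨fun x => ∫ y, k₁ (x - y) * f y, fun x => ∫ y, k₂ (x - y) * f y, C * ∫ y, |f y|,
      continuous_integral_kernel_mul hf c1 b1, continuous_integral_kernel_mul hf c2 b2,
      abs_integral_kernel_mul_le hf b1, abs_integral_kernel_mul_le hf b2, fun x τ => ?_⟩
    rw [avg_gaussVec_eq hs, avg_gaussVec_eq hs, ← integral_const_mul, ← integral_const_mul,
      ← integral_sub_sub_sub (i0 _) (i0 _) ((i1 _).const_mul _) ((i2 _).const_mul _),
      mul_right_comm, ← integral_const_mul, ← Real.norm_eq_abs]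
    refine norm_integral_le_of_norm_le (hf.abs.const_mul _) (Eventually.of_forall fun y => ?_)
    have := h (x - y) τ
    rw [Real.norm_eq_abs, show gaussKernel s (x + τ • a - y) * f y - gaussKernel s (x - y) * f y -
        τ * (k₁ (x - y) * f y) - τ ^ 2 / 2 * (k₂ (x - y) * f y) =
        (gaussKernel s (x - y + τ • a) - gaussKernel s (x - y) - τ * k₁ (x - y) -
          τ ^ 2 / 2 * k₂ (x - y)) * f y by rw [add_sub_right_comm]; ring, abs_mul]
    gcongr
  semiconvex a := by
    refine ⟨‖a‖ ^ 2 / s, by positivity, fun x τ => ?_⟩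
    have i0 := integrable_kernel_mul hf (continuous_gaussKernel s) (abs_gaussKernel_le hs)
    have p0 : ∀ x y : Rn n, 0 ≤ gaussKernel s (x - y) * f y := fun x y =>
      mul_nonneg (gaussKernel_pos hs _).le (hf0 y)
    have pos := avg_gaussVec_pos hs hf hf0 hne
    simp_rw [avg_gaussVec_eq hs] at pos ⊢
    refine sq_integral_le_of_sq_le (i0 _) (i0 _) (i0 _) (p0 _) (p0 _) (p0 _) (Real.exp_pos _).le
      (pos _) (pos _) fun y => ?_
    have hk : gaussKernel s (x - y) ^ 2 = Real.exp (‖a‖ ^ 2 / s * τ ^ 2) *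
        (gaussKernel s (x + τ • a - y) * gaussKernel s (x - τ • a - y)) := by
      rw [add_sub_right_comm, sub_right_comm]
      simp only [gaussKernel_eq]
      set c := ((2 * Real.pi * s) ^ ((n : ℝ) / 2))⁻¹
      rw [mul_mul_mul_comm, mul_left_comm, ← Real.exp_add, ← Real.exp_add, mul_pow, ← sq,
        ← Real.exp_nat_mul, norm_add_sq_real (x - y) (τ • a), norm_sub_sq_real (x - y) (τ • a), norm_smul,
        mul_pow, Real.norm_eq_abs, sq_abs]
      congr 2
      push_cast
      field_simp
      ring
    refine le_of_eq ?_
    rw [mul_pow, hk]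
    ring

/-- Split the variance as `(s - ε k) + ε k`. The `ε k` average is nice and its polar is at least `f°
e^{-ε k ‖z‖² / 2}`; Fatou's lemma removes the weight as `ε k → 0`. -/
theorem lintegral_polarFun_le_avg_of_bounded_support {s : ℝ} (hs : 0 < s) {f : Rn n → ℝ}
    (hf : Integrable f volume) (hf0 : ∀ x, 0 ≤ f x) (hfe : ∀ x, f (-x) = f x)
    (hne : ¬ f =ᵐ[volume] 0) {ρ : ℝ} (hρ : ∀ x, ρ < ‖x‖ → f x = 0) :
    ∫⁻ z, polarFun f z ≤ ∫⁻ z, polarFun (avg (gaussVec n s) f) z := by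
  -- The shift by `2` keeps `ε k < s` also for `k = 0`.
  set ε : ℕ → ℝ := fun k => s / (k + 2)
  have hε0 : ∀ k, 0 < ε k := fun k => by positivity
  have hεs : ∀ k, ε k < s := fun k => by
    simp only [ε]
    rw [div_lt_iff₀ (by positivity)]
    nlinarith [hs, (Nat.cast_nonneg k : (0 : ℝ) ≤ k)]
  have hεt : Tendsto ε atTop (𝓝 0) :=
    tendsto_const_nhds.div_atTop
      (tendsto_atTop_add_const_right _ _ tendsto_natCast_atTop_atTop)
  have h1 : ∀ k, ∫⁻ z, polarFun f z * ENNReal.ofReal (Real.exp (-(ε k * ‖z‖ ^ 2 / 2)))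
      ≤ ∫⁻ z, polarFun (avg (gaussVec n s) f) z := by
    intro k
    have hn := niceFun_avg_gaussVec (hε0 k) hf hf0 hfe hne hρ
    have h2 := hn.lintegral_polarFun_le_avg_gaussVec (sub_pos.2 (hεs k))
    rw [avg_gaussVec_avg (sub_pos.2 (hεs k)) (hε0 k) hf, sub_add_cancel] at h2
    refine le_trans (lintegral_mono fun z => ?_) h2
    exact polarFun_mul_exp_le_avg hf0 (lintegral_exp_gaussVec (hε0 k) z).le
  have h2 : ∀ z, Tendsto (fun k => polarFun f z * ENNReal.ofReal (Real.exp (-(ε k * ‖z‖ ^ 2 / 2))))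
      atTop (𝓝 (polarFun f z)) := by
    intro z
    have h3 : Tendsto (fun k => ENNReal.ofReal (Real.exp (-(ε k * ‖z‖ ^ 2 / 2)))) atTop (𝓝 1) := by
      have h4 : Tendsto (fun e : ℝ => Real.exp (-(e * ‖z‖ ^ 2 / 2))) (𝓝 0)
        (𝓝 (Real.exp (-(0 * ‖z‖ ^ 2 / 2)))) := Continuous.tendsto (by fun_prop) 0
      simpa using ENNReal.tendsto_ofReal (h4.comp hεt)
    simpa using ENNReal.Tendsto.const_mul h3 (Or.inl one_ne_zero)
  calc ∫⁻ z, polarFun f z = ∫⁻ z, liminf (fun k => polarFun f z *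
        ENNReal.ofReal (Real.exp (-(ε k * ‖z‖ ^ 2 / 2)))) atTop :=
        lintegral_congr fun z => (h2 z).liminf_eq.symm
    _ ≤ liminf (fun k => ∫⁻ z, polarFun f z *
        ENNReal.ofReal (Real.exp (-(ε k * ‖z‖ ^ 2 / 2)))) atTop :=
        lintegral_liminf_le fun k => (measurable_polarFun f).mul (by fun_prop)
    _ ≤ liminf (fun _ : ℕ => ∫⁻ z, polarFun (avg (gaussVec n s) f) z) atTop :=
        liminf_le_liminf (Eventually.of_forall h1)
    _ = _ := liminf_const _

/-- For even functions, the integral of the polar function increases along the heat flow. -/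
theorem lintegral_polarFun_le_avg_gaussVec {s : ℝ} (hs : 0 < s) {f : Rn n → ℝ}
    (hf : Integrable f volume) (hf0 : ∀ x, 0 ≤ f x) (hfe : ∀ x, f (-x) = f x)
    (hne : ¬ f =ᵐ[volume] 0) :
    ∫⁻ z, polarFun f z ≤ ∫⁻ z, polarFun (avg (gaussVec n s) f) z := by
  set g : ℕ → Rn n → ℝ := fun k => (Metric.closedBall (0 : Rn n) k).indicator f
  have hg : ∀ k, Integrable (g k) volume := fun k => hf.indicator measurableSet_closedBall
  have hg0 : ∀ k x, 0 ≤ g k x := fun k x => Set.indicator_nonneg (fun y _ => hf0 y) x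
  have hgf : ∀ k x, g k x ≤ f x := fun k x => Set.indicator_le_self' (fun y _ => hf0 y) x
  have hge : ∀ k x, g k (-x) = g k x := by
    intro k x
    simp [g, Set.indicator, hfe]
  have hgρ : ∀ (k : ℕ) x, (k : ℝ) < ‖x‖ → g k x = 0 := by
    intro k x hx
    refine Set.indicator_of_notMem ?_ f
    simpa using hx
  have hgt : ∀ x, ∀ᶠ k in atTop, g k x = f x := by
    intro x
    obtain ⟨N, hN⟩ := exists_nat_ge ‖x‖
    filter_upwards [eventually_ge_atTop N] with k hk
    refine Set.indicator_of_mem ?_ f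
    have : (N : ℝ) ≤ k := by exact_mod_cast hk
    simpa using hN.trans this
  have hgmono : ∀ {k l : ℕ}, k ≤ l → ∀ x, g k x ≤ g l x := by
    intro k l hkl x
    refine Set.indicator_le_indicator_of_subset (Metric.closedBall_subset_closedBall ?_) hf0 x
    exact_mod_cast hkl
  -- Truncations increase with `k`, so the average of one nonzero truncation bounds all later
  -- averages below on the unit ball, as upper semicontinuity requires.
  obtain ⟨k₀, hk₀⟩ : ∃ k, ¬ g k =ᵐ[volume] 0 := by
    by_contra! h
    refine hne ?_
    filter_upwards [ae_all_iff.2 h] with x hx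
    obtain ⟨k, hk⟩ := (hgt x).exists
    rw [← hk, hx k]
  have hgne : ∀ k, k₀ ≤ k → ¬ g k =ᵐ[volume] 0 := by
    intro k hk h
    refine hk₀ ?_
    filter_upwards [h] with x hx
    refine le_antisymm ?_ (hg0 _ x)
    exact (hgmono hk x).trans hx.le
  refine le_of_forall_gt fun b hb => ?_
  have hn := niceFun_avg_gaussVec hs (hg k₀) (hg0 k₀) (hge k₀) hk₀ (hgρ k₀)
  obtain ⟨c, hc, hcF⟩ := hn.exists_le_ball 1
  have hev : ∀ᶠ k in atTop, ∫⁻ z, polarFun (avg (gaussVec n s) (g k)) z < b := by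
    refine eventually_lintegral_polarFun_lt (fun x => ?_) hc ?_ hb
    · refine tendsto_integral_of_dominated_convergence (fun w => f (x + w))
        (fun k => (integrable_translate_gaussVec hs (hg k) x).aestronglyMeasurable)
        (integrable_translate_gaussVec hs hf x)
        (fun k => Eventually.of_forall fun w => ?_) (Eventually.of_forall fun w => ?_)
      · rw [Real.norm_of_nonneg (hg0 _ _)]
        exact hgf _ _
      · exact tendsto_const_nhds.congr' ((hgt (x + w)).mono fun k hk => hk.symm)
    · filter_upwards [eventually_ge_atTop k₀] with k hk x hx
      exact (hcF x hx).trans (integral_mono (integrable_translate_gaussVec hs (hg k₀) x)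
        (integrable_translate_gaussVec hs (hg k) x) fun w => hgmono hk _)
  obtain ⟨k, hk, hkk⟩ := (hev.and (eventually_ge_atTop k₀)).exists
  calc ∫⁻ z, polarFun f z ≤ ∫⁻ z, polarFun (g k) z :=
        lintegral_mono fun z => polarFun_anti (hgf k) z
    _ ≤ ∫⁻ z, polarFun (avg (gaussVec n s) (g k)) z :=
        lintegral_polarFun_le_avg_of_bounded_support hs (hg k) (hg0 k) (hge k) (hgne k hkk) (hgρ k)
    _ < b := hk

end HeatMonotonicity

/-! ### The Fokker-Planck flow and the volume product -/

section VolumeProduct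

variable {n : ℕ}

open ProbabilityTheory

theorem one_sub_exp_pos {t : ℝ} (ht : 0 < t) : 0 < 1 - Real.exp (-2 * t) := by
  have : Real.exp (-2 * t) < 1 := Real.exp_lt_one_iff.2 (by linarith)
  linarith

theorem exp_sub_one_pos {t : ℝ} (ht : 0 < t) : 0 < Real.exp (2 * t) - 1 := by
  have : 1 < Real.exp (2 * t) := Real.one_lt_exp_iff.2 (by linarith)
  linarith

/-! ### The flow as a dilated Gaussian average; conservation of mass -/

theorem fokkerPlanckFlow_zero (f : Rn n → ℝ) : fokkerPlanckFlow 0 f = f := by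
  ext x; simp [fokkerPlanckFlow]

theorem fokkerPlanckFlow_of_pos {t : ℝ} (ht : 0 < t) (f : Rn n → ℝ) (x : Rn n) :
    fokkerPlanckFlow t f x =
      ∫ y, gaussKernel (1 - Real.exp (-2 * t)) (x - Real.exp (-t) • y) * f y := by
  rw [fokkerPlanckFlow, if_neg ht.ne']
  refine integral_congr_ae (Eventually.of_forall fun y => ?_)
  simp only [gaussKernel]
  rw [div_mul_eq_mul_div, mul_div_assoc]

/-- Write `x - e^{-t} y = e^{-t} (e^t x - y)`; the variance `1 - e^{-2t}` is multiplied by `e^{2t}`,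
and the normalisation accounts for `e^{tn}`. -/
theorem fokkerPlanckFlow_eq_avg {t : ℝ} (ht : 0 < t) (f : Rn n → ℝ) (x : Rn n) :
    fokkerPlanckFlow t f x = Real.exp t ^ n *
      avg (gaussVec n (Real.exp (2 * t) - 1)) f (Real.exp t • x) := by
  rw [fokkerPlanckFlow_of_pos ht, avg_gaussVec_eq (exp_sub_one_pos ht), ← integral_const_mul]
  refine integral_congr_ae (Eventually.of_forall fun y => ?_)
  simp only
  rw [← mul_assoc]
  congr 1
  have h1 := one_sub_exp_pos ht
  have hE : Real.exp (2 * t) - 1 = Real.exp t ^ 2 * (1 - Real.exp (-2 * t)) := by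
    rw [mul_sub, ← Real.exp_nat_mul, ← Real.exp_add]
    simp
  have hx : Real.exp t • x - y = Real.exp t • (x - Real.exp (-t) • y) := by
    rw [smul_sub, smul_smul, ← Real.exp_add]
    simp
  rw [hE, hx]
  set σ := 1 - Real.exp (-2 * t)
  set v := x - Real.exp (-t) • y
  set c := Real.exp t
  have hc : 0 < c := Real.exp_pos t
  simp only [gaussKernel]
  rw [norm_smul, Real.norm_of_nonneg hc.le, show 2 * Real.pi * (c ^ 2 * σ) =
    c ^ 2 * (2 * Real.pi * σ) by ring,
    Real.mul_rpow (x := c ^ 2) (y := 2 * Real.pi * σ) (by positivity) (by positivity)]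
  have h2 : (c ^ 2) ^ ((n : ℝ) / 2) = c ^ n := by
    rw [← Real.rpow_natCast, ← Real.rpow_mul hc.le, ← Real.rpow_natCast]
    congr 1
    push_cast
    ring
  rw [h2, ← mul_div_assoc, mul_div_mul_left _ _ (by positivity)]
  congr 2
  field_simp

theorem lintegral_comp_smul_pos (g : Rn n → ℝ≥0∞) {c : ℝ} (hc : 0 < c) :
    ∫⁻ x, g (c • x) = ENNReal.ofReal (c ^ n)⁻¹ * ∫⁻ x, g x := by
  have h := (Homeomorph.smulOfNeZero c hc.ne' (α := Rn n)).measurableEmbedding.lintegral_map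
    (μ := volume) g
  have hmap := Measure.map_addHaar_smul (volume : Measure (Rn n)) hc.ne'
  rw [finrank_euclideanSpace_fin, abs_of_pos (by positivity)] at hmap
  calc ∫⁻ x, g (c • x) = ∫⁻ x, g x ∂(Measure.map (c • ·) volume) := h.symm
    _ = _ := by rw [hmap, lintegral_smul_measure, smul_eq_mul]

/-- Substitute `y ↦ c y` in the infimum: polarity reverses dilations, so the mass-preserving
dilation of `h` yields one of `h°` that preserves its integral. -/
theorem polarFun_dilate {g h : Rn n → ℝ} {c : ℝ} (hc : 0 < c)
    (hgh : ∀ x, g x = c ^ n * h (c • x)) (z : Rn n) :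
    polarFun g z = ENNReal.ofReal (c ^ n)⁻¹ * polarFun h (c⁻¹ • z) := by
  have hcn : 0 < c ^ n := by positivity
  unfold polarFun
  rw [ENNReal.mul_iInf_of_ne (by simpa using hcn) ENNReal.ofReal_ne_top]
  refine (Homeomorph.smulOfNeZero c hc.ne' (α := Rn n)).toEquiv.iInf_congr fun y => ?_
  change _ * (ENNReal.ofReal (Real.exp (-inner ℝ (c⁻¹ • z) (c • y))) / ENNReal.ofReal (h (c • y))) = _
  rw [hgh, inner_smul_left, inner_smul_right, conj_trivial, inv_mul_cancel_left₀ hc.ne',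
    ENNReal.ofReal_mul hcn.le, ENNReal.ofReal_inv_of_pos hcn, ENNReal.div_eq_inv_mul,
    ENNReal.div_eq_inv_mul, ENNReal.mul_inv (Or.inl (by simpa using hcn))
    (Or.inl ENNReal.ofReal_ne_top), mul_assoc]

theorem lintegral_polarFun_fokkerPlanckFlow {t : ℝ} (ht : 0 < t) (f : Rn n → ℝ) :
    ∫⁻ z, polarFun (fokkerPlanckFlow t f) z =
      ∫⁻ z, polarFun (avg (gaussVec n (Real.exp (2 * t) - 1)) f) z := by
  have hc := Real.exp_pos t
  simp_rw [polarFun_dilate hc (fokkerPlanckFlow_eq_avg ht f)]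
  have hm := measurable_polarFun (avg (gaussVec n (Real.exp (2 * t) - 1)) f)
  rw [lintegral_const_mul _ (by fun_prop),
    lintegral_comp_smul_pos (fun z => polarFun (avg (gaussVec n (Real.exp (2 * t) - 1)) f) z)
    (inv_pos.2 hc), ← mul_assoc, ← ENNReal.ofReal_mul (by positivity), inv_pow, inv_inv,
    inv_mul_cancel₀ (by positivity), ENNReal.ofReal_one, one_mul]

/-- Tonelli and translation invariance in `x`. The coefficient `c` is `e^{-t}` for the flow and `1`
for plain averages. -/
theorem lintegral_lintegral_gaussKernel {s : ℝ} (hs : 0 < s) (c : ℝ) {g : Rn n → ℝ≥0∞}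
    (hg : AEMeasurable g volume) :
    ∫⁻ x, ∫⁻ y, ENNReal.ofReal (gaussKernel s (x - c • y)) * g y = ∫⁻ y, g y := by
  have hm := (continuous_gaussKernel (n := n) s).measurable
  rw [lintegral_lintegral_swap]
  · refine lintegral_congr fun y => ?_
    rw [lintegral_mul_const _ (by fun_prop),
      lintegral_sub_right_eq_self (fun x => ENNReal.ofReal (gaussKernel s x)),
      lintegral_gaussKernel hs, one_mul]
  · exact AEMeasurable.mul (by fun_prop) hg.comp_snd

theorem integrable_flowKernel_mul {k f : Rn n → ℝ} (hf : Integrable f volume) (hk : Continuous k)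
    {C : ℝ} (hC : ∀ x, |k x| ≤ C) (c : ℝ) (x : Rn n) :
    Integrable (fun y => k (x - c • y) * f y) volume :=
  hf.bdd_mul (by fun_prop) (Eventually.of_forall fun y => hC _)

theorem fokkerPlanckFlow_nonneg {t : ℝ} (ht : 0 < t) {f : Rn n → ℝ} (hf0 : ∀ x, 0 ≤ f x)
    (x : Rn n) : 0 ≤ fokkerPlanckFlow t f x := by
  rw [fokkerPlanckFlow_of_pos ht]
  exact integral_nonneg fun y => mul_nonneg (gaussKernel_pos (one_sub_exp_pos ht) _).le (hf0 y)

theorem lintegral_fokkerPlanckFlow {t : ℝ} (ht : 0 < t) {f : Rn n → ℝ}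
    (hf : Integrable f volume) (hf0 : ∀ x, 0 ≤ f x) :
    ∫⁻ x, ENNReal.ofReal (fokkerPlanckFlow t f x) = ∫⁻ x, ENNReal.ofReal (f x) := by
  have hs := one_sub_exp_pos ht
  rw [← lintegral_lintegral_gaussKernel hs (Real.exp (-t)) hf.aemeasurable.ennreal_ofReal]
  refine lintegral_congr fun x => ?_
  rw [fokkerPlanckFlow_of_pos ht, ofReal_integral_eq_lintegral_ofReal
    (integrable_flowKernel_mul hf (continuous_gaussKernel _) (abs_gaussKernel_le hs) _ x)
    (Eventually.of_forall fun y => mul_nonneg (gaussKernel_pos hs _).le (hf0 y))]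
  refine lintegral_congr fun y => ?_
  rw [ENNReal.ofReal_mul (gaussKernel_pos hs _).le]

theorem lintegral_polarFun_le_fokkerPlanckFlow {t : ℝ} (ht : 0 < t) {f : Rn n → ℝ}
    (hf : Integrable f volume) (hf0 : ∀ x, 0 ≤ f x) (hfe : ∀ x, f (-x) = f x)
    (hne : ¬ f =ᵐ[volume] 0) :
    ∫⁻ z, polarFun f z ≤ ∫⁻ z, polarFun (fokkerPlanckFlow t f) z := by
  rw [lintegral_polarFun_fokkerPlanckFlow ht]
  exact lintegral_polarFun_le_avg_gaussVec (exp_sub_one_pos ht) hf hf0 hfe hne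

theorem integrable_avg_gaussVec {s : ℝ} (hs : 0 < s) {f : Rn n → ℝ} (hf : Integrable f volume)
    (hf0 : ∀ x, 0 ≤ f x) : Integrable (avg (gaussVec n s) f) volume := by
  have hc : Continuous (avg (gaussVec n s) f) := by
    simp_rw [funext (avg_gaussVec_eq hs f)]
    exact continuous_integral_kernel_mul hf (continuous_gaussKernel s) (abs_gaussKernel_le hs)
  have h0 : ∀ x, 0 ≤ avg (gaussVec n s) f x := fun x => integral_nonneg fun w => hf0 _
  refine ⟨hc.aestronglyMeasurable, ?_⟩
  rw [hasFiniteIntegral_iff_ofReal (Eventually.of_forall h0)]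
  have h1 := lintegral_lintegral_gaussKernel hs 1 hf.aemeasurable.ennreal_ofReal
  have h2 : ∀ x, ENNReal.ofReal (avg (gaussVec n s) f x) =
      ∫⁻ y, ENNReal.ofReal (gaussKernel s (x - (1 : ℝ) • y)) * ENNReal.ofReal (f y) := by
    intro x
    rw [avg_gaussVec_eq hs, ofReal_integral_eq_lintegral_ofReal
      (integrable_kernel_mul hf (continuous_gaussKernel _) (abs_gaussKernel_le hs) x)
      (Eventually.of_forall fun y => mul_nonneg (gaussKernel_pos hs _).le (hf0 y))]
    refine lintegral_congr fun y => ?_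
    rw [ENNReal.ofReal_mul (gaussKernel_pos hs _).le, one_smul]
  simp_rw [h2, h1]
  exact hf.lintegral_lt_top

/-- For `t₁ > 0` both times are read as Gaussian averages of `f`, of variances `s₁ < s₂`; the first
is again even, integrable and positive, and the semigroup law produces the second from it. -/
theorem volumeProduct_fokkerPlanckFlow_mono {f : Rn n → ℝ} (hf : Integrable f volume)
    (hf0 : ∀ x, 0 ≤ f x) (hfe : ∀ x, f (-x) = f x) (hne : ¬ f =ᵐ[volume] 0) {t₁ t₂ : ℝ}
    (h0 : 0 ≤ t₁) (h12 : t₁ ≤ t₂) :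
    volumeProduct (fokkerPlanckFlow t₁ f) ≤ volumeProduct (fokkerPlanckFlow t₂ f) := by
  have hmass : ∀ {t : ℝ}, 0 ≤ t →
      ∫⁻ x, ENNReal.ofReal (fokkerPlanckFlow t f x) = ∫⁻ x, ENNReal.ofReal (f x) := by
    intro t ht
    rcases ht.eq_or_lt with rfl | ht
    · rw [fokkerPlanckFlow_zero]
    · exact lintegral_fokkerPlanckFlow ht hf hf0
  unfold volumeProduct
  rw [hmass h0, hmass (h0.trans h12)]
  refine mul_le_mul' le_rfl ?_
  rcases h12.eq_or_lt with rfl | h12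
  · exact le_rfl
  rcases h0.eq_or_lt with rfl | h0
  · rw [fokkerPlanckFlow_zero]
    exact lintegral_polarFun_le_fokkerPlanckFlow h12 hf hf0 hfe hne
  · have h2 := h0.trans h12
    rw [lintegral_polarFun_fokkerPlanckFlow h0, lintegral_polarFun_fokkerPlanckFlow h2]
    set s₁ := Real.exp (2 * t₁) - 1
    set s₂ := Real.exp (2 * t₂) - 1
    have hs₁ : 0 < s₁ := exp_sub_one_pos h0
    have hs : 0 < s₂ - s₁ := by
      simp only [s₁, s₂]
      have : Real.exp (2 * t₁) < Real.exp (2 * t₂) := Real.exp_lt_exp.2 (by linarith)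
      linarith
    have hpos := avg_gaussVec_pos hs₁ hf hf0 hne
    have hne1 : ¬ avg (gaussVec n s₁) f =ᵐ[volume] 0 := by
      intro h
      obtain ⟨x, hx⟩ := h.exists
      exact (hpos x).ne' hx
    have := lintegral_polarFun_le_avg_gaussVec hs (integrable_avg_gaussVec hs₁ hf hf0)
      (fun x => (hpos x).le) (avg_even (gaussVec_map_neg hs₁) hfe) hne1
    rwa [avg_gaussVec_avg hs hs₁ hf, sub_add_cancel] at this

theorem tendsto_fokkerPlanckFlow_atTop {f : Rn n → ℝ} (hf : Integrable f volume) (x : Rn n) :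
    Tendsto (fun t => fokkerPlanckFlow t f x) atTop (𝓝 (gaussKernel 1 x * ∫ y, f y)) := by
  have hκ := one_sub_exp_pos (t := 1) one_pos
  have he : ∀ t : ℝ, 1 ≤ t → 1 - Real.exp (-2 * 1) ≤ 1 - Real.exp (-2 * t) := fun t ht => by
    have : Real.exp (-2 * t) ≤ Real.exp (-2 * 1) := Real.exp_le_exp.2 (by linarith)
    linarith
  have h1 : Tendsto (fun t => ∫ y, gaussKernel (1 - Real.exp (-2 * t)) (x - Real.exp (-t) • y) * f y)
      atTop (𝓝 (∫ y, gaussKernel 1 x * f y)) := by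
    refine tendsto_integral_filter_of_dominated_convergence
      (fun y => ((2 * Real.pi * (1 - Real.exp (-2 * 1))) ^ ((n : ℝ) / 2))⁻¹ * |f y|) ?_ ?_
      (hf.abs.const_mul _) ?_
    · filter_upwards [eventually_ge_atTop 1] with t ht
      exact (integrable_flowKernel_mul hf (continuous_gaussKernel _)
        (abs_gaussKernel_le (hκ.trans_le (he t ht))) _ x).aestronglyMeasurable
    · filter_upwards [eventually_ge_atTop 1] with t ht
      refine Eventually.of_forall fun y => ?_
      rw [Real.norm_eq_abs, abs_mul]
      gcongr
      refine (abs_gaussKernel_le (hκ.trans_le (he t ht)) _).trans ?_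
      have hle := he t ht
      generalize 1 - Real.exp (-2 * t) = σ at hle
      generalize 1 - Real.exp (-2 * 1) = κ at hle hκ
      gcongr
    · refine Eventually.of_forall fun y => Tendsto.mul_const _ ?_
      have e1 : Tendsto (fun t : ℝ => Real.exp (-t)) atTop (𝓝 0) := Real.tendsto_exp_neg_atTop_nhds_zero
      have e2 : Tendsto (fun t : ℝ => 1 - Real.exp (-2 * t)) atTop (𝓝 1) := by
        have : Tendsto (fun t : ℝ => 1 - Real.exp (-t) ^ 2) atTop (𝓝 (1 - 0 ^ 2)) :=
          tendsto_const_nhds.sub (e1.pow 2)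
        simp only [ne_eq, OfNat.ofNat_ne_zero, not_false_eq_true, zero_pow, sub_zero] at this
        refine this.congr fun t => ?_
        rw [← Real.exp_nat_mul]
        congr 2
        push_cast
        ring
      have e3 : Tendsto (fun t : ℝ => x - Real.exp (-t) • y) atTop (𝓝 (x - (0 : ℝ) • y)) :=
        tendsto_const_nhds.sub (e1.smul_const y)
      rw [zero_smul, sub_zero] at e3
      unfold gaussKernel
      refine Tendsto.div ?_ ((e2.const_mul _).rpow_const (Or.inl (by positivity)))
        (by positivity)
      exact (Real.continuous_exp.tendsto _).comp
        (((e3.norm.pow 2).neg).div (e2.const_mul 2) (by norm_num))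
  rw [integral_const_mul] at h1
  refine h1.congr' ?_
  filter_upwards [eventually_gt_atTop 0] with t ht
  rw [fokkerPlanckFlow_of_pos ht]

/-- The uniform lower bound needed for upper semicontinuity as `t → ∞`. The kernel is replaced by
its worst case: distance at most `1 + ‖y‖`, the smallest variance `κ` in the exponent and the
largest, `1`, in the normalisation. -/
theorem exists_le_fokkerPlanckFlow {f : Rn n → ℝ} (hf : Integrable f volume)
    (hf0 : ∀ x, 0 ≤ f x) (hne : ¬ f =ᵐ[volume] 0) :
    ∃ c : ℝ, 0 < c ∧ ∀ t : ℝ, 1 ≤ t → ∀ x, ‖x‖ ≤ 1 → c ≤ fokkerPlanckFlow t f x := by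
  have hκ := one_sub_exp_pos (t := 1) one_pos
  set κ := 1 - Real.exp (-2 * 1)
  set k : Rn n → ℝ := fun y =>
    Real.exp (-(1 + ‖y‖) ^ 2 / (2 * κ)) / (2 * Real.pi) ^ ((n : ℝ) / 2)
  have hk0 : ∀ y, 0 < k y := fun y => by positivity
  have hkc : Continuous k := Continuous.div_const (by fun_prop) _
  have hkb : ∀ y, |k y| ≤ ((2 * Real.pi) ^ ((n : ℝ) / 2))⁻¹ := fun y => by
    rw [abs_of_pos (hk0 y)]
    simp only [k]
    rw [div_eq_mul_inv]
    refine mul_le_of_le_one_left (by positivity) (Real.exp_le_one_iff.2 ?_)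
    rw [neg_div]
    have : 0 ≤ (1 + ‖y‖) ^ 2 / (2 * κ) := by positivity
    linarith
  have hki : Integrable (fun y => k y * f y) volume :=
    hf.bdd_mul hkc.aestronglyMeasurable (Eventually.of_forall hkb)
  refine ⟨∫ y, k y * f y, ?_, fun t ht x hx => ?_⟩
  · rw [integral_pos_iff_support_of_nonneg (fun y => mul_nonneg (hk0 y).le (hf0 y)) hki]
    have : (Function.support fun y => k y * f y) = Function.support f := by
      ext y; simp [(hk0 y).ne']
    rw [this, pos_iff_ne_zero]
    intro h0
    exact hne (measure_eq_zero_iff_ae_notMem.1 h0 |>.mono fun y hy => by simpa using hy)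
  · have ht0 : 0 < t := by linarith
    have hσ := one_sub_exp_pos ht0
    rw [fokkerPlanckFlow_of_pos ht0]
    refine integral_mono hki (integrable_flowKernel_mul hf (continuous_gaussKernel _)
      (abs_gaussKernel_le hσ) _ x) fun y => mul_le_mul_of_nonneg_right ?_ (hf0 y)
    have hσκ : κ ≤ 1 - Real.exp (-2 * t) := by
      have : Real.exp (-2 * t) ≤ Real.exp (-2 * 1) := Real.exp_le_exp.2 (by linarith)
      simp only [κ]
      linarith
    have hσ1 : 1 - Real.exp (-2 * t) ≤ 1 := by linarith [Real.exp_pos (-2 * t)]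
    have hnorm : ‖x - Real.exp (-t) • y‖ ≤ 1 + ‖y‖ := by
      have h1 : Real.exp (-t) ≤ 1 := Real.exp_le_one_iff.2 (by linarith)
      refine (norm_sub_le _ _).trans (add_le_add hx ?_)
      rw [norm_smul, Real.norm_of_nonneg (Real.exp_pos _).le]
      exact mul_le_of_le_one_left (norm_nonneg _) h1
    simp only [k, gaussKernel, neg_div]
    generalize 1 - Real.exp (-2 * t) = σ at hσκ hσ1 hσ
    have h2 : 2 * Real.pi * σ ≤ 2 * Real.pi := mul_le_of_le_one_right (by positivity) hσ1
    refine div_le_div₀ (Real.exp_pos _).le ?_ (by positivity)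
      (Real.rpow_le_rpow (by positivity) h2 (by positivity))
    gcongr

/-- Testing the infimum at `y = z` gives a multiple of the Gaussian itself; this upper bound
suffices. -/
theorem lintegral_polarFun_gaussKernel_mul_le {m : ℝ} (hm : 0 < m) :
    ∫⁻ z : Rn n, polarFun (fun x => gaussKernel 1 x * m) z
      ≤ ENNReal.ofReal ((2 * Real.pi) ^ n / m) := by
  set c := (2 * Real.pi) ^ ((n : ℝ) / 2)
  have hc : 0 < c := by positivity
  have h1 : ∀ z : Rn n, polarFun (fun x => gaussKernel 1 x * m) z ≤
      ENNReal.ofReal (c * c / m) * ENNReal.ofReal (gaussKernel 1 z) := by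
    intro z
    refine (iInf_le _ z).trans (le_of_eq ?_)
    rw [← ENNReal.ofReal_mul (by positivity),
      ← ENNReal.ofReal_div_of_pos (mul_pos (gaussKernel_pos one_pos z) hm)]
    congr 1
    simp only [gaussKernel, mul_one]
    rw [real_inner_self_eq_norm_sq]
    have h2 : Real.exp (-‖z‖ ^ 2) = Real.exp (-‖z‖ ^ 2 / 2) * Real.exp (-‖z‖ ^ 2 / 2) := by
      rw [← Real.exp_add]; congr 1; ring
    rw [h2]
    change _ / (_ / c * m) = c * c / m * (_ / c)
    field_simp
  refine (lintegral_mono h1).trans (le_of_eq ?_)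
  have hmeas := (continuous_gaussKernel (n := n) 1).measurable
  rw [lintegral_const_mul _ (by fun_prop), lintegral_gaussKernel one_pos, mul_one]
  congr 2
  rw [← Real.rpow_add (by positivity), add_halves, Real.rpow_natCast]

/-- Any `b` above the Gaussian bound also exceeds `∫ (f_t)°` for some large `t`, hence `∫ f°` by
monotonicity. -/
theorem volumeProduct_le {f : Rn n → ℝ} (hf : Integrable f volume)
    (hf0 : ∀ x, 0 ≤ f x) (hfe : ∀ x, f (-x) = f x) (hne : ¬ f =ᵐ[volume] 0) :
    volumeProduct f ≤ ENNReal.ofReal ((2 * Real.pi) ^ n) := by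
  set m := ∫ y, f y
  have hm : 0 < m := by
    refine lt_of_le_of_ne (integral_nonneg hf0) fun h => hne ?_
    exact (integral_eq_zero_iff_of_nonneg hf0 hf).1 h.symm
  obtain ⟨c, hc, hcf⟩ := exists_le_fokkerPlanckFlow hf hf0 hne
  have hle : ∫⁻ z, polarFun f z ≤ ENNReal.ofReal ((2 * Real.pi) ^ n / m) := by
    refine le_of_forall_gt fun b hb => ?_
    have hev := eventually_lintegral_polarFun_lt (tendsto_fokkerPlanckFlow_atTop hf) hc
      ((eventually_ge_atTop 1).mono fun t ht x hx => hcf t ht x hx)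
      ((lintegral_polarFun_gaussKernel_mul_le hm).trans_lt hb)
    obtain ⟨t, ht, ht1⟩ := (hev.and (eventually_ge_atTop 1)).exists
    exact (lintegral_polarFun_le_fokkerPlanckFlow (by linarith) hf hf0 hfe hne).trans_lt ht
  unfold volumeProduct
  rw [← ofReal_integral_eq_lintegral_ofReal hf (Eventually.of_forall hf0)]
  calc _ ≤ ENNReal.ofReal m * ENNReal.ofReal ((2 * Real.pi) ^ n / m) := by gcongr
    _ = _ := by
      rw [← ENNReal.ofReal_mul hm.le]
      congr 1
      field_simp

end VolumeProduct

/-! ### Spatial regularity of the Fokker-Planck flow -/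

section SpatialRegularity

variable {n : ℕ}

open ProbabilityTheory

/-! ### Differentiation of integrals against a bounded kernel -/

section Convolution

variable {E : Type*} [NormedAddCommGroup E] [NormedSpace ℝ E]

theorem integrable_smul_flowKernel {k : Rn n → E} {f : Rn n → ℝ} (hf : Integrable f volume)
    (hk : Continuous k) {C : ℝ} (hC : ∀ v, ‖k v‖ ≤ C) (c : ℝ) (x : Rn n) :
    Integrable (fun y => f y • k (x - c • y)) volume := by
  have hm : AEStronglyMeasurable (fun y => k (x - c • y)) volume := by fun_prop
  refine (hf.norm.mul_const C).mono' (hf.aestronglyMeasurable.smul hm)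
    (Eventually.of_forall fun y => ?_)
  rw [norm_smul]
  exact mul_le_mul_of_nonneg_left (hC _) (norm_nonneg _)

theorem continuous_integral_smul_flowKernel {k : Rn n → E} {f : Rn n → ℝ}
    (hf : Integrable f volume) (hk : Continuous k) {C : ℝ} (hC : ∀ v, ‖k v‖ ≤ C) (c : ℝ) :
    Continuous fun x => ∫ y, f y • k (x - c • y) := by
  refine continuous_of_dominated (bound := fun y => ‖f y‖ * C)
    (fun x => (integrable_smul_flowKernel hf hk hC c x).aestronglyMeasurable)
    (fun x => Eventually.of_forall fun y => ?_) (hf.norm.mul_const C)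
    (Eventually.of_forall fun y => by fun_prop)
  rw [norm_smul]
  exact mul_le_mul_of_nonneg_left (hC _) (norm_nonneg _)

/-- Vector-valued, so that it applies both to the Gaussian kernel and to its gradient. -/
theorem hasFDerivAt_integral_smul_flowKernel {k : Rn n → E} {k' : Rn n → Rn n →L[ℝ] E}
    {f : Rn n → ℝ} (hf : Integrable f volume) (hk : ∀ v, HasFDerivAt k (k' v) v)
    (hk' : Continuous k') {C C' : ℝ} (hC : ∀ v, ‖k v‖ ≤ C) (hC' : ∀ v, ‖k' v‖ ≤ C') (c : ℝ)
    (x : Rn n) :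
    HasFDerivAt (fun x => ∫ y, f y • k (x - c • y)) (∫ y, f y • k' (x - c • y)) x := by
  have hkc : Continuous k := continuous_iff_continuousAt.2 fun v => (hk v).continuousAt
  refine hasFDerivAt_integral_of_dominated_of_fderiv_le (s := Set.univ)
    (F' := fun x y => f y • k' (x - c • y)) (bound := fun y => ‖f y‖ * C') univ_mem
    (Eventually.of_forall fun x => (integrable_smul_flowKernel hf hkc hC c x).aestronglyMeasurable)
    (integrable_smul_flowKernel hf hkc hC c x)
    (integrable_smul_flowKernel hf hk' hC' c x).aestronglyMeasurable
    (Eventually.of_forall fun y x _ => ?_) (hf.norm.mul_const C')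
    (Eventually.of_forall fun y x _ => ?_)
  · rw [norm_smul]
    exact mul_le_mul_of_nonneg_left (hC' _) (norm_nonneg _)
  · have := (hk (x - c • y)).comp x ((hasFDerivAt_id x).sub_const (c • y))
    exact (this.const_smul (f y))

theorem norm_smul_add_smulRight_le {V : Type*} [NormedAddCommGroup V] [NormedSpace ℝ V]
    (a : ℝ) (B : V →L[ℝ] E) (φ : V →L[ℝ] ℝ) (w : E) :
    ‖a • B + φ.smulRight w‖ ≤ |a| * ‖B‖ + ‖φ‖ * ‖w‖ := by
  refine (norm_add_le _ _).trans (add_le_add (norm_smul a B).le ?_)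
  exact (ContinuousLinearMap.norm_smulRight_apply φ w).le

theorem continuous_smul_add_smulRight {V : Type*} [NormedAddCommGroup V] [NormedSpace ℝ V]
    {a : V → ℝ} (ha : Continuous a) (B : V →L[ℝ] E) {φ : V → V →L[ℝ] ℝ} (hφ : Continuous φ) :
    Continuous fun v => a v • B + (φ v).smulRight (B v) := by
  refine (ha.smul continuous_const).add ?_
  exact (ContinuousLinearMap.smulRightL ℝ V E).continuous₂.comp (hφ.prodMk B.continuous)

end Convolution

/-! ### Gradient and Hessian of the Gaussian kernel -/

/-- The real inner product as a continuous bilinear map. -/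
noncomputable def innerCLM (n : ℕ) : Rn n →L[ℝ] Rn n →L[ℝ] ℝ := innerSL ℝ

theorem norm_innerCLM_apply (v : Rn n) : ‖innerCLM n v‖ = ‖v‖ := innerSL_apply_norm ℝ v

/-- The gradient of the Gaussian kernel, as a linear form. -/
noncomputable def gaussKernelFDeriv (s : ℝ) (v : Rn n) : Rn n →L[ℝ] ℝ :=
  (-(1 / s) * gaussKernel s v) • innerCLM n v

/-- The Hessian of the Gaussian kernel. -/
noncomputable def gaussKernelHessian (s : ℝ) (v : Rn n) : Rn n →L[ℝ] Rn n →L[ℝ] ℝ :=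
  (-(1 / s) * gaussKernel s v) • innerCLM n +
    ((-(1 / s)) • gaussKernelFDeriv s v).smulRight (innerCLM n v)

theorem hasFDerivAt_gaussKernel {s : ℝ} (v : Rn n) :
    HasFDerivAt (gaussKernel s) (gaussKernelFDeriv s v) v := by
  have h1 : HasFDerivAt (fun v : Rn n => ‖v‖ ^ 2) (2 • innerSL ℝ v) v :=
    (hasStrictFDerivAt_norm_sq v).hasFDerivAt
  have h2 := ((h1.const_mul (-(1 / (2 * s)))).exp).const_mul
    (((2 * Real.pi * s) ^ ((n : ℝ) / 2))⁻¹)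
  have h3 : (gaussKernel s : Rn n → ℝ) = fun v => ((2 * Real.pi * s) ^ ((n : ℝ) / 2))⁻¹ *
      Real.exp (-(1 / (2 * s)) * ‖v‖ ^ 2) := funext (gaussKernel_eq s)
  rw [h3]
  refine h2.congr_fderiv ?_
  ext w
  simp only [gaussKernelFDeriv, gaussKernel_eq]
  change _ * (_ * (_ * (2 • inner ℝ v w))) = _ * inner ℝ v w
  rw [two_nsmul]
  ring

theorem hasFDerivAt_gaussKernelFDeriv {s : ℝ} (v : Rn n) :
    HasFDerivAt (gaussKernelFDeriv s) (gaussKernelHessian s v) v :=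
  ((hasFDerivAt_gaussKernel v).const_mul (-(1 / s))).smul (innerCLM n).hasFDerivAt

theorem continuous_gaussKernelFDeriv (s : ℝ) :
    Continuous (gaussKernelFDeriv s : Rn n → Rn n →L[ℝ] ℝ) :=
  continuous_iff_continuousAt.2 fun v => (hasFDerivAt_gaussKernelFDeriv v).continuousAt

theorem continuous_gaussKernelHessian (s : ℝ) :
    Continuous (gaussKernelHessian s : Rn n → Rn n →L[ℝ] Rn n →L[ℝ] ℝ) := by
  exact continuous_smul_add_smulRight (continuous_const.mul (continuous_gaussKernel s))
    (innerCLM n) ((continuous_gaussKernelFDeriv s).const_smul (-(1 / s)))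

theorem gaussKernel_mul_one_add_pow_le {s : ℝ} (hs : 0 < s) (v : Rn n) :
    gaussKernel s v * (1 + ‖v‖ ^ 4) ≤
      (1 + 8 * s ^ 2) * ((2 * Real.pi * s) ^ ((n : ℝ) / 2))⁻¹ := by
  have h := one_add_pow_four_mul_exp_le hs ‖v‖
  rw [gaussKernel, div_eq_mul_inv, mul_right_comm]
  rw [mul_comm] at h
  gcongr

theorem norm_gaussKernelFDeriv_le {s : ℝ} (hs : 0 < s) (v : Rn n) :
    ‖gaussKernelFDeriv s v‖ ≤
      1 / s * ((1 + 8 * s ^ 2) * ((2 * Real.pi * s) ^ ((n : ℝ) / 2))⁻¹) := by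
  have h := gaussKernel_mul_one_add_pow_le hs v
  have hp := gaussKernel_pos hs v
  rw [gaussKernelFDeriv, norm_smul, norm_innerCLM_apply, norm_mul, norm_neg,
    Real.norm_of_nonneg (by positivity), Real.norm_of_nonneg hp.le, mul_assoc]
  refine mul_le_mul_of_nonneg_left (le_trans ?_ h) (by positivity)
  refine mul_le_mul_of_nonneg_left ?_ hp.le
  nlinarith [sq_nonneg (‖v‖ - 1), sq_nonneg (‖v‖ ^ 2 - 1), norm_nonneg v]

theorem norm_gaussKernelHessian_le {s : ℝ} (hs : 0 < s) (v : Rn n) :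
    ‖gaussKernelHessian s v‖ ≤ (1 / s * ‖innerCLM n‖ + 1 / s * (1 / s)) *
      ((1 + 8 * s ^ 2) * ((2 * Real.pi * s) ^ ((n : ℝ) / 2))⁻¹) := by
  have h := gaussKernel_mul_one_add_pow_le hs v
  have hp := gaussKernel_pos hs v
  have h1 : 1 ≤ 1 + ‖v‖ ^ 4 := by nlinarith [sq_nonneg (‖v‖ ^ 2)]
  have h2 : ‖v‖ * ‖v‖ ≤ 1 + ‖v‖ ^ 4 := by nlinarith [sq_nonneg (‖v‖ ^ 2 - 1)]
  have hs' : 0 ≤ 1 / s := by positivity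
  refine (norm_smul_add_smulRight_le _ _ _ _).trans ?_
  rw [norm_innerCLM_apply, norm_smul, gaussKernelFDeriv, norm_smul, norm_innerCLM_apply,
    ← Real.norm_eq_abs, norm_mul, norm_neg, Real.norm_of_nonneg hs', Real.norm_of_nonneg hp.le]
  calc _ = 1 / s * ‖innerCLM n‖ * (gaussKernel s v * 1) +
        1 / s * (1 / s) * (gaussKernel s v * (‖v‖ * ‖v‖)) := by ring
    _ ≤ 1 / s * ‖innerCLM n‖ * (gaussKernel s v * (1 + ‖v‖ ^ 4)) +
        1 / s * (1 / s) * (gaussKernel s v * (1 + ‖v‖ ^ 4)) := by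
      gcongr
    _ ≤ _ := by
      rw [← add_mul]
      exact mul_le_mul_of_nonneg_left h (by positivity)

/-! ### Spatial derivatives of the flow -/

section Flow

variable {t : ℝ} {f : Rn n → ℝ}

theorem hasFDerivAt_fokkerPlanckFlow (ht : 0 < t) (hf : Integrable f volume) (x : Rn n) :
    HasFDerivAt (fokkerPlanckFlow t f)
      (∫ y, f y • gaussKernelFDeriv (1 - Real.exp (-2 * t)) (x - Real.exp (-t) • y)) x := by
  have hs := one_sub_exp_pos ht
  have h : fokkerPlanckFlow t f = fun x =>
      ∫ y, f y • gaussKernel (1 - Real.exp (-2 * t)) (x - Real.exp (-t) • y) := by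
    ext x
    simp_rw [fokkerPlanckFlow_of_pos ht, smul_eq_mul, mul_comm]
  rw [h]
  exact hasFDerivAt_integral_smul_flowKernel hf hasFDerivAt_gaussKernel
    (continuous_gaussKernelFDeriv _) (abs_gaussKernel_le hs) (norm_gaussKernelFDeriv_le hs) _ x

theorem fderiv_fokkerPlanckFlow (ht : 0 < t) (hf : Integrable f volume) :
    fderiv ℝ (fokkerPlanckFlow t f) = fun x =>
      ∫ y, f y • gaussKernelFDeriv (1 - Real.exp (-2 * t)) (x - Real.exp (-t) • y) :=
  funext fun x => (hasFDerivAt_fokkerPlanckFlow ht hf x).fderiv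

theorem hasFDerivAt_fderiv_fokkerPlanckFlow (ht : 0 < t) (hf : Integrable f volume) (x : Rn n) :
    HasFDerivAt (fderiv ℝ (fokkerPlanckFlow t f))
      (∫ y, f y • gaussKernelHessian (1 - Real.exp (-2 * t)) (x - Real.exp (-t) • y)) x := by
  have hs := one_sub_exp_pos ht
  rw [fderiv_fokkerPlanckFlow ht hf]
  exact hasFDerivAt_integral_smul_flowKernel hf hasFDerivAt_gaussKernelFDeriv
    (continuous_gaussKernelHessian _) (norm_gaussKernelFDeriv_le hs)
    (norm_gaussKernelHessian_le hs) _ x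

theorem contDiff_fokkerPlanckFlow (ht : 0 < t) (hf : Integrable f volume) :
    ContDiff ℝ 2 (fokkerPlanckFlow t f) := by
  have hs := one_sub_exp_pos ht
  rw [show (2 : WithTop ℕ∞) = 1 + 1 by norm_num, contDiff_succ_iff_fderiv, contDiff_one_iff_fderiv]
  refine ⟨fun x => (hasFDerivAt_fokkerPlanckFlow ht hf x).differentiableAt, by simp,
    fun x => (hasFDerivAt_fderiv_fokkerPlanckFlow ht hf x).differentiableAt, ?_⟩
  rw [funext fun x => (hasFDerivAt_fderiv_fokkerPlanckFlow ht hf x).fderiv]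
  exact continuous_integral_smul_flowKernel hf (continuous_gaussKernelHessian _)
    (norm_gaussKernelHessian_le hs) _

theorem sum_inner_single_sq (v : Rn n) :
    ∑ i, inner ℝ v (EuclideanSpace.single i (1 : ℝ)) * inner ℝ v (EuclideanSpace.single i 1) =
      ‖v‖ ^ 2 := by
  rw [EuclideanSpace.norm_sq_eq]
  refine Finset.sum_congr rfl fun i _ => ?_
  simp [EuclideanSpace.inner_single_right, sq]

theorem sum_gaussKernelHessian {s : ℝ} (hs : s ≠ 0) (v : Rn n) :
    ∑ i, gaussKernelHessian s v (EuclideanSpace.single i 1) (EuclideanSpace.single i 1) =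
      gaussKernel s v * (‖v‖ ^ 2 / s ^ 2 - n / s) := by
  have h : ∀ i : Fin n,
      gaussKernelHessian s v (EuclideanSpace.single i 1) (EuclideanSpace.single i 1) =
      -(1 / s) * gaussKernel s v + (1 / s) ^ 2 * gaussKernel s v *
        (inner ℝ v (EuclideanSpace.single i (1 : ℝ)) * inner ℝ v (EuclideanSpace.single i 1)) := by
    intro i
    change (-(1 / s) * gaussKernel s v) *
      inner ℝ (EuclideanSpace.single i (1 : ℝ)) (EuclideanSpace.single i (1 : ℝ)) +
      (-(1 / s) * ((-(1 / s) * gaussKernel s v) * inner ℝ v (EuclideanSpace.single i 1))) *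
      inner ℝ v (EuclideanSpace.single i 1) = _
    rw [real_inner_self_eq_norm_sq, PiLp.norm_single, norm_one]
    ring
  simp_rw [h]
  rw [Finset.sum_add_distrib, ← Finset.mul_sum Finset.univ (fun i => inner ℝ v
    (EuclideanSpace.single i (1 : ℝ)) * inner ℝ v (EuclideanSpace.single i (1 : ℝ))),
    sum_inner_single_sq]
  simp only [Finset.sum_const, Finset.card_univ, Fintype.card_fin, nsmul_eq_mul]
  field_simp
  ring

theorem laplacian_fokkerPlanckFlow (ht : 0 < t) (hf : Integrable f volume) (x : Rn n) :
    Laplacian.laplacian (fokkerPlanckFlow t f) x =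
      ∫ y, f y * (gaussKernel (1 - Real.exp (-2 * t)) (x - Real.exp (-t) • y) *
        (‖x - Real.exp (-t) • y‖ ^ 2 / (1 - Real.exp (-2 * t)) ^ 2 -
          n / (1 - Real.exp (-2 * t)))) := by
  have hs := one_sub_exp_pos ht
  rw [InnerProductSpace.laplacian_eq_iteratedFDeriv_orthonormalBasis _
    (EuclideanSpace.basisFun (Fin n) ℝ)]
  simp only [iteratedFDeriv_two_apply, EuclideanSpace.basisFun_apply, Matrix.cons_val_zero,
    Matrix.cons_val_one]
  rw [(hasFDerivAt_fderiv_fokkerPlanckFlow ht hf x).fderiv]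
  have hi := integrable_smul_flowKernel (E := Rn n →L[ℝ] Rn n →L[ℝ] ℝ) hf
    (continuous_gaussKernelHessian _)
    (norm_gaussKernelHessian_le hs) (Real.exp (-t)) x
  have hi1 : ∀ w : Rn n, Integrable (fun y => (f y • gaussKernelHessian (1 - Real.exp (-2 * t))
      (x - Real.exp (-t) • y)) w) volume := fun w => hi.apply_continuousLinearMap w
  simp_rw [ContinuousLinearMap.integral_apply hi]
  simp_rw [ContinuousLinearMap.integral_apply (hi1 _)]
  rw [← integral_finsetSum _ fun i _ => (hi1 _).apply_continuousLinearMap _]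
  refine integral_congr_ae (Eventually.of_forall fun y => ?_)
  simp only
  rw [← sum_gaussKernelHessian hs.ne', Finset.mul_sum]
  rfl

theorem divergence_smul_id {u : Rn n → ℝ} {u' : Rn n →L[ℝ] ℝ} {x : Rn n}
    (hu : HasFDerivAt u u' x) : divergence (fun y => u y • y) x = n * u x + u' x := by
  have h : HasFDerivAt (fun y => u y • y) _ x := hu.smul (hasFDerivAt_id x)
  rw [divergence, h.fderiv]
  have hx : x = ∑ i, x i • EuclideanSpace.single i (1 : ℝ) := by
    conv_lhs => rw [← (EuclideanSpace.basisFun (Fin n) ℝ).sum_repr x]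
    simp
  have hux : u' x = ∑ i, x i * u' (EuclideanSpace.single i 1) := by
    conv_lhs => rw [hx]
    simp
  rw [hux]
  simp [Finset.sum_add_distrib, mul_comm]

/-- Laplacian and divergence are gathered under one integral, whose integrand is shown below to be
the time derivative of the kernel. -/
theorem fokkerPlanckOp_fokkerPlanckFlow (ht : 0 < t) (hf : Integrable f volume) (x : Rn n) :
    fokkerPlanckOp (fokkerPlanckFlow t f) x =
      ∫ y, f y * (gaussKernel (1 - Real.exp (-2 * t)) (x - Real.exp (-t) • y) *
        (‖x - Real.exp (-t) • y‖ ^ 2 / (1 - Real.exp (-2 * t)) ^ 2 -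
          n / (1 - Real.exp (-2 * t)) + n -
          inner ℝ (x - Real.exp (-t) • y) x / (1 - Real.exp (-2 * t)))) := by
  have hs := one_sub_exp_pos ht
  have hi := integrable_smul_flowKernel hf (continuous_gaussKernelFDeriv _)
    (norm_gaussKernelFDeriv_le hs) (Real.exp (-t)) x
  have hi1 := hi.apply_continuousLinearMap x
  have hi0 := integrable_smul_flowKernel hf (continuous_gaussKernel _)
    (abs_gaussKernel_le hs) (Real.exp (-t)) x
  have hi2 : Integrable (fun y => f y * (gaussKernel (1 - Real.exp (-2 * t)) (x - Real.exp (-t) • y) *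
        (‖x - Real.exp (-t) • y‖ ^ 2 / (1 - Real.exp (-2 * t)) ^ 2 -
          n / (1 - Real.exp (-2 * t))))) volume := by
    have hi := integrable_smul_flowKernel (E := Rn n →L[ℝ] Rn n →L[ℝ] ℝ) hf
      (continuous_gaussKernelHessian _)
      (norm_gaussKernelHessian_le hs) (Real.exp (-t)) x
    refine (integrable_finsetSum Finset.univ fun i _ => (hi.apply_continuousLinearMap
      (EuclideanSpace.single i 1)).apply_continuousLinearMap (EuclideanSpace.single i 1)).congr
      (Eventually.of_forall fun y => ?_)
    simp only
    rw [← sum_gaussKernelHessian hs.ne', Finset.mul_sum]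
    rfl
  rw [fokkerPlanckOp, divergence_smul_id (hasFDerivAt_fokkerPlanckFlow ht hf x),
    laplacian_fokkerPlanckFlow ht hf, ContinuousLinearMap.integral_apply hi,
    fokkerPlanckFlow_of_pos ht]
  have hflow : (∫ y, gaussKernel (1 - Real.exp (-2 * t)) (x - Real.exp (-t) • y) * f y) =
    ∫ y, f y • gaussKernel (1 - Real.exp (-2 * t)) (x - Real.exp (-t) • y) := by
    simp_rw [smul_eq_mul, mul_comm]
  rw [hflow, ← integral_const_mul, ← integral_add (hi0.const_mul _) hi1,
    ← integral_add hi2 (show Integrable (fun _ => _ + _) volume from (hi0.const_mul _).add hi1)]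
  refine integral_congr_ae (Eventually.of_forall fun y => ?_)
  change _ + ((n : ℝ) * (f y * _) + f y * ((-(1 / _) * _) * inner ℝ _ x)) = _
  ring

end Flow

end SpatialRegularity

/-! ### The Fokker-Planck equation and the initial condition -/

section FokkerPlanckEquation

variable {n : ℕ}

open ProbabilityTheory

/-! ### The time derivative of the flow -/

section Equation

variable {t : ℝ} {f : Rn n → ℝ}

/-- The transition kernel itself solves the equation: `σ = 1 - e^{-2t}` satisfies `σ' = 2 (1 - σ)`
and `v = x - e^{-t} y` satisfies `v' = x - v`. -/
theorem hasDerivAt_gaussKernel_flow (ht : 0 < t) (x y : Rn n) :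
    HasDerivAt (fun t => gaussKernel (1 - Real.exp (-2 * t)) (x - Real.exp (-t) • y))
      (gaussKernel (1 - Real.exp (-2 * t)) (x - Real.exp (-t) • y) *
        (‖x - Real.exp (-t) • y‖ ^ 2 / (1 - Real.exp (-2 * t)) ^ 2 -
          n / (1 - Real.exp (-2 * t)) + n -
          inner ℝ (x - Real.exp (-t) • y) x / (1 - Real.exp (-2 * t)))) t := by
  have hs := one_sub_exp_pos ht
  have hv : HasDerivAt (fun t => x - Real.exp (-t) • y) (Real.exp (-t) • y) t := by
    have h := ((hasDerivAt_id t).neg.exp.smul_const y).const_sub x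
    refine h.congr_deriv ?_
    simp
  have hσ : HasDerivAt (fun t => 1 - Real.exp (-2 * t)) (2 * Real.exp (-2 * t)) t := by
    have h := (((hasDerivAt_id t).const_mul (-2)).exp).const_sub 1
    refine h.congr_deriv ?_
    simp only [id]
    ring
  have hinner : inner ℝ (x - Real.exp (-t) • y) (Real.exp (-t) • y) =
      inner ℝ (x - Real.exp (-t) • y) x - ‖x - Real.exp (-t) • y‖ ^ 2 := by
    rw [← real_inner_self_eq_norm_sq, ← inner_sub_right]
    congr 1
    abel
  have hA := (hv.norm_sq.neg.div (hσ.const_mul 2) (by positivity)).exp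
  have hZ := (hσ.const_mul (2 * Real.pi)).rpow_const (p := (n : ℝ) / 2)
    (Or.inl (by positivity))
  have hZ0 : (2 * Real.pi * (1 - Real.exp (-2 * t))) ^ ((n : ℝ) / 2) ≠ 0 := by positivity
  have h := hA.div hZ hZ0
  refine h.congr_deriv ?_
  rw [Real.rpow_sub_one (by positivity), hinner]
  have he : Real.exp (-2 * t) = 1 - (1 - Real.exp (-2 * t)) := by ring
  simp only [gaussKernel, Pi.div_apply, Pi.neg_apply]
  rw [show 2 * Real.exp (-2 * t) = 2 * (1 - (1 - Real.exp (-2 * t))) by ring]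
  generalize inner ℝ (x - Real.exp (-t) • y) x = i
  generalize ‖x - Real.exp (-t) • y‖ = r
  generalize 1 - Real.exp (-2 * t) = σ at hs hZ0
  generalize (2 * Real.pi * σ) ^ ((n : ℝ) / 2) = Z at hZ0
  have hpi := Real.pi_pos.ne'
  field_simp
  ring

/-- A bound independent of `σ` and `v`: every term of the polynomial factor is at most a constant
times `1 + ‖v‖⁴`, and `9` bounds `1 + 8 σ²` for `σ ≤ 1`. -/
theorem abs_deriv_gaussKernel_flow_le {σ₀ σ : ℝ} (h0 : 0 < σ₀) (h1 : σ₀ ≤ σ) (h2 : σ ≤ 1)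
    (v x : Rn n) :
    |gaussKernel σ v * (‖v‖ ^ 2 / σ ^ 2 - n / σ + n - inner ℝ v x / σ)| ≤
      9 * ((2 * Real.pi * σ₀) ^ ((n : ℝ) / 2))⁻¹ *
        (1 / σ₀ ^ 2 + n / σ₀ + n + ‖x‖ / σ₀) := by
  have hσ : 0 < σ := h0.trans_le h1
  have hp := gaussKernel_pos hσ v
  have hr := norm_nonneg v
  have e1 : ‖v‖ ^ 2 ≤ 1 + ‖v‖ ^ 4 := by nlinarith [sq_nonneg (‖v‖ ^ 2 - 1)]
  have e2 : ‖v‖ ≤ 1 + ‖v‖ ^ 4 := by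
    nlinarith [sq_nonneg (‖v‖ - 1), sq_nonneg (‖v‖ ^ 2 - 1)]
  have e3 : 1 ≤ 1 + ‖v‖ ^ 4 := by nlinarith [sq_nonneg (‖v‖ ^ 2)]
  have hi : |inner ℝ v x / σ| ≤ (1 + ‖v‖ ^ 4) * (‖x‖ / σ₀) := by
    rw [abs_div, abs_of_pos hσ, ← mul_div_assoc]
    have := abs_real_inner_le_norm v x
    gcongr
    exact this.trans (by gcongr)
  have ha : |‖v‖ ^ 2 / σ ^ 2| ≤ (1 + ‖v‖ ^ 4) * (1 / σ₀ ^ 2) := by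
    rw [abs_of_nonneg (by positivity), mul_one_div]
    gcongr
  have hb : |(n : ℝ) / σ| ≤ (1 + ‖v‖ ^ 4) * (n / σ₀) := by
    rw [abs_of_nonneg (by positivity)]
    exact (div_le_div_of_nonneg_left (by positivity) h0 h1).trans
      (le_mul_of_one_le_left (by positivity) e3)
  have hc : |(n : ℝ)| ≤ (1 + ‖v‖ ^ 4) * n := by
    rw [abs_of_nonneg (by positivity)]
    exact le_mul_of_one_le_left (by positivity) e3
  have hsum : |‖v‖ ^ 2 / σ ^ 2 - n / σ + n - inner ℝ v x / σ| ≤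
      (1 + ‖v‖ ^ 4) * (1 / σ₀ ^ 2 + n / σ₀ + n + ‖x‖ / σ₀) := by
    rw [mul_add, mul_add, mul_add]
    rw [abs_le] at *
    constructor <;> linarith [ha.1, ha.2, hb.1, hb.2, hc.1, hc.2, hi.1, hi.2]
  have hk : gaussKernel σ v * (1 + ‖v‖ ^ 4) ≤
      9 * ((2 * Real.pi * σ₀) ^ ((n : ℝ) / 2))⁻¹ := by
    refine (gaussKernel_mul_one_add_pow_le hσ v).trans ?_
    have : 1 + 8 * σ ^ 2 ≤ 9 := by nlinarith
    gcongr
  rw [abs_mul, abs_of_pos hp]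
  calc _ ≤ gaussKernel σ v * ((1 + ‖v‖ ^ 4) * (1 / σ₀ ^ 2 + n / σ₀ + n + ‖x‖ / σ₀)) := by gcongr
    _ ≤ _ := by
      rw [← mul_assoc]
      exact mul_le_mul_of_nonneg_right hk (by positivity)

theorem hasDerivAt_fokkerPlanckFlow (ht : 0 < t) (hf : Integrable f volume) (x : Rn n) :
    HasDerivAt (fun s => fokkerPlanckFlow s f x) (fokkerPlanckOp (fokkerPlanckFlow t f) x) t := by
  have hs := one_sub_exp_pos ht
  have h0 : 0 < 1 - Real.exp (-t) := by
    have : Real.exp (-t) < 1 := Real.exp_lt_one_iff.2 (by linarith)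
    linarith
  have hmeas : ∀ τ : ℝ, AEStronglyMeasurable (fun y =>
      f y * gaussKernel (1 - Real.exp (-2 * τ)) (x - Real.exp (-τ) • y)) volume := fun τ => by
    have := continuous_gaussKernel (n := n) (1 - Real.exp (-2 * τ))
    exact hf.aestronglyMeasurable.mul (by fun_prop)
  have hmeas' : AEStronglyMeasurable (fun y =>
      f y * (gaussKernel (1 - Real.exp (-2 * t)) (x - Real.exp (-t) • y) *
        (‖x - Real.exp (-t) • y‖ ^ 2 / (1 - Real.exp (-2 * t)) ^ 2 -
          n / (1 - Real.exp (-2 * t)) + n -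
          inner ℝ (x - Real.exp (-t) • y) x / (1 - Real.exp (-2 * t))))) volume := by
    have := continuous_gaussKernel (n := n) (1 - Real.exp (-2 * t))
    refine hf.aestronglyMeasurable.mul (Continuous.aestronglyMeasurable ?_)
    fun_prop
  -- Times are restricted to `τ > t/2`, where the variance `1 - e^{-2τ}` is at least `1 - e^{-t}`;
  -- this is the `σ₀` of the dominating function.
  have key := (hasDerivAt_integral_of_dominated_loc_of_deriv_le (μ := (volume : Measure (Rn n)))
    (F := fun τ y => f y * gaussKernel (1 - Real.exp (-2 * τ)) (x - Real.exp (-τ) • y))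
    (F' := fun τ y => f y * (gaussKernel (1 - Real.exp (-2 * τ)) (x - Real.exp (-τ) • y) *
        (‖x - Real.exp (-τ) • y‖ ^ 2 / (1 - Real.exp (-2 * τ)) ^ 2 -
          n / (1 - Real.exp (-2 * τ)) + n -
          inner ℝ (x - Real.exp (-τ) • y) x / (1 - Real.exp (-2 * τ)))))
    (bound := fun y => |f y| * (9 * ((2 * Real.pi * (1 - Real.exp (-t))) ^ ((n : ℝ) / 2))⁻¹ *
        (1 / (1 - Real.exp (-t)) ^ 2 + n / (1 - Real.exp (-t)) + n +
          ‖x‖ / (1 - Real.exp (-t)))))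
    (Ioi_mem_nhds (half_lt_self ht)) (Eventually.of_forall hmeas)
    (integrable_smul_flowKernel hf (continuous_gaussKernel _) (abs_gaussKernel_le hs) _ x)
    hmeas' (Eventually.of_forall fun y τ hτ => ?_) (hf.abs.mul_const _)
    (Eventually.of_forall fun y τ hτ =>
      (hasDerivAt_gaussKernel_flow ((half_pos ht).trans hτ) x y).const_mul (f y))).2
  · rw [fokkerPlanckOp_fokkerPlanckFlow ht hf]
    refine key.congr_of_eventuallyEq ?_
    filter_upwards [lt_mem_nhds ht] with τ hτ
    simp_rw [fokkerPlanckFlow_of_pos hτ, mul_comm]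
  · rw [Real.norm_eq_abs, abs_mul]
    refine mul_le_mul_of_nonneg_left (abs_deriv_gaussKernel_flow_le h0 ?_ ?_ _ _) (abs_nonneg _)
    · have : Real.exp (-2 * τ) ≤ Real.exp (-t) :=
        Real.exp_le_exp.2 (by linarith [Set.mem_Ioi.1 hτ])
      linarith
    · linarith [Real.exp_pos (-2 * τ)]

end Equation

/-! ### Convergence to the initial datum in `L¹` -/

section InitialCondition

/-- Transfers all variances to one fixed measure, so that the limit `s → 0` becomes dominated
convergence. -/
theorem gaussVec_eq_map_smul {s : ℝ} (hs : 0 < s) :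
    gaussVec n s = (gaussVec n 1).map (fun w => √s • w) := by
  have := isProbabilityMeasure_gaussVec (n := n) hs
  have := isProbabilityMeasure_gaussVec (n := n) one_pos
  have : IsProbabilityMeasure ((gaussVec n 1).map (fun w => √s • w)) :=
    Measure.isProbabilityMeasure_map (by fun_prop)
  refine Measure.ext_of_charFun ?_
  ext t
  rw [charFun_map_smul, charFun_gaussVec hs, charFun_gaussVec one_pos, norm_smul, mul_pow,
    Real.norm_of_nonneg (Real.sqrt_nonneg s), Real.sq_sqrt hs.le, one_mul]

theorem tendsto_fokkerPlanckFlow_zero {h : Rn n → ℝ} (hc : Continuous h) {C : ℝ}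
    (hC : ∀ x, ‖h x‖ ≤ C) (x : Rn n) :
    Tendsto (fun t => fokkerPlanckFlow t h x) (𝓝[>] 0) (𝓝 (h x)) := by
  have := isProbabilityMeasure_gaussVec (n := n) one_pos
  have hlim : Tendsto (fun t : ℝ => Real.exp t ^ n *
      ∫ w, h (Real.exp t • x + √(Real.exp (2 * t) - 1) • w) ∂(gaussVec n 1)) (𝓝 0) (𝓝 (h x)) := by
    have h1 : Continuous fun t : ℝ =>
        ∫ w, h (Real.exp t • x + √(Real.exp (2 * t) - 1) • w) ∂(gaussVec n 1) :=
      continuous_of_dominated (bound := fun _ => C)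
        (fun t => Continuous.aestronglyMeasurable (by fun_prop))
        (fun t => Eventually.of_forall fun w => hC _) (integrable_const C)
        (Eventually.of_forall fun w => by fun_prop)
    have h2 : Continuous fun t : ℝ => Real.exp t ^ n *
        ∫ w, h (Real.exp t • x + √(Real.exp (2 * t) - 1) • w) ∂(gaussVec n 1) := by fun_prop
    simpa using h2.tendsto 0
  refine (hlim.mono_left nhdsWithin_le_nhds).congr' ?_
  filter_upwards [self_mem_nhdsWithin] with t ht
  rw [fokkerPlanckFlow_eq_avg ht, avg, gaussVec_eq_map_smul (exp_sub_one_pos ht),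
    integral_map (by fun_prop) (by fun_prop)]

theorem lintegral_enorm_fokkerPlanckFlow_le {t : ℝ} (ht : 0 < t) {f : Rn n → ℝ}
    (hf : Integrable f volume) : ∫⁻ x, ‖fokkerPlanckFlow t f x‖ₑ ≤ ∫⁻ x, ‖f x‖ₑ := by
  have hs := one_sub_exp_pos ht
  rw [← lintegral_lintegral_gaussKernel hs (Real.exp (-t)) hf.aestronglyMeasurable.enorm]
  refine lintegral_mono fun x => ?_
  rw [fokkerPlanckFlow_of_pos ht]
  refine (enorm_integral_le_lintegral_enorm _).trans (le_of_eq (lintegral_congr fun y => ?_))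
  rw [enorm_mul, Real.enorm_of_nonneg (gaussKernel_pos hs _).le]

theorem fokkerPlanckFlow_sub {t : ℝ} (ht : 0 < t) {f g : Rn n → ℝ} (hf : Integrable f volume)
    (hg : Integrable g volume) (x : Rn n) :
    fokkerPlanckFlow t (fun y => f y - g y) x =
      fokkerPlanckFlow t f x - fokkerPlanckFlow t g x := by
  have hs := one_sub_exp_pos ht
  simp_rw [fokkerPlanckFlow_of_pos ht, mul_sub]
  exact integral_sub
    (integrable_flowKernel_mul hf (continuous_gaussKernel _) (abs_gaussKernel_le hs) _ x)
    (integrable_flowKernel_mul hg (continuous_gaussKernel _) (abs_gaussKernel_le hs) _ x)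

/-- This is `|p - h| = (p - h) + 2 (h - p)⁺`, written additively to avoid subtraction in `ℝ≥0∞`. -/
theorem enorm_sub_add_ofReal {p h : ℝ} (hp : 0 ≤ p) (hh : 0 ≤ h) :
    ‖p - h‖ₑ + ENNReal.ofReal h = ENNReal.ofReal p + 2 * ENNReal.ofReal (h - p) := by
  rw [Real.enorm_eq_ofReal_abs, ← ENNReal.ofReal_add (abs_nonneg _) hh]
  rcases le_total p h with hle | hle
  · rw [abs_of_nonpos (by linarith), show (2 : ℝ≥0∞) = ENNReal.ofReal 2 by simp,
      ← ENNReal.ofReal_mul (by norm_num), ← ENNReal.ofReal_add hp (by linarith)]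
    congr 1
    ring
  · rw [abs_of_nonneg (by linarith), ENNReal.ofReal_of_nonpos (by linarith : h - p ≤ 0)]
    simp

/-- Scheffé's argument: as masses agree, the `L¹` distance is twice the integral of the positive
part of `h - f_t`, which tends to `0` pointwise and is dominated by `h`. -/
theorem tendsto_lintegral_fokkerPlanckFlow_sub_of_continuous {h : Rn n → ℝ}
    (hi : Integrable h volume) (h0 : ∀ x, 0 ≤ h x) (hc : Continuous h) {C : ℝ}
    (hC : ∀ x, ‖h x‖ ≤ C) :
    Tendsto (fun t => ∫⁻ x, ‖fokkerPlanckFlow t h x - h x‖ₑ) (𝓝[>] 0) (𝓝 0) := by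
  have hcont : ∀ {t : ℝ}, 0 < t → Continuous (fokkerPlanckFlow t h) := fun ht =>
    (contDiff_fokkerPlanckFlow ht hi).continuous
  have h1 : Tendsto (fun t => ∫⁻ x, ENNReal.ofReal (h x - fokkerPlanckFlow t h x))
      (𝓝[>] 0) (𝓝 (∫⁻ _ : Rn n, 0)) := by
    refine tendsto_lintegral_filter_of_dominated_convergence (fun x => ENNReal.ofReal (h x))
      ?_ ?_ hi.lintegral_lt_top.ne ?_
    · filter_upwards [self_mem_nhdsWithin] with t ht
      exact (hc.sub (hcont ht)).measurable.ennreal_ofReal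
    · filter_upwards [self_mem_nhdsWithin] with t ht
      refine Eventually.of_forall fun x => ENNReal.ofReal_le_ofReal ?_
      linarith [fokkerPlanckFlow_nonneg ht h0 x]
    · refine Eventually.of_forall fun x => ?_
      have := ENNReal.tendsto_ofReal (tendsto_const_nhds (x := h x) |>.sub
        (tendsto_fokkerPlanckFlow_zero hc hC x))
      simpa using this
  have h2 := ENNReal.Tendsto.const_mul (a := 2) h1 (Or.inr (by simp))
  rw [lintegral_zero, mul_zero] at h2
  refine h2.congr' ?_
  filter_upwards [self_mem_nhdsWithin] with t ht
  have hm : Measurable fun x => ENNReal.ofReal (h x - fokkerPlanckFlow t h x) :=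
    (hc.sub (hcont ht)).measurable.ennreal_ofReal
  have h3 : (∫⁻ x, ‖fokkerPlanckFlow t h x - h x‖ₑ) + ∫⁻ x, ENNReal.ofReal (h x) =
      2 * (∫⁻ x, ENNReal.ofReal (h x - fokkerPlanckFlow t h x)) + ∫⁻ x, ENNReal.ofReal (h x) := by
    rw [← lintegral_add_right _ hc.measurable.ennreal_ofReal]
    simp_rw [fun x => enorm_sub_add_ofReal (fokkerPlanckFlow_nonneg ht h0 x) (h0 x)]
    rw [lintegral_add_left (hcont ht).measurable.ennreal_ofReal, lintegral_const_mul _ hm,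
      lintegral_fokkerPlanckFlow ht hi h0, add_comm]
  exact ((ENNReal.add_left_inj hi.lintegral_lt_top.ne).1 h3).symm

theorem tendsto_lintegral_fokkerPlanckFlow_sub {f : Rn n → ℝ} (hf : Integrable f volume)
    (hf0 : ∀ x, 0 ≤ f x) :
    Tendsto (fun t => ∫⁻ x, ‖fokkerPlanckFlow t f x - f x‖ₑ) (𝓝[>] 0) (𝓝 0) := by
  rw [ENNReal.tendsto_nhds_zero]
  intro ε hε
  have hε3 : ε / 3 ≠ 0 := by simpa using hε.ne'
  obtain ⟨g, hgs, hfg, hgc, hgi⟩ := hf.exists_hasCompactSupport_lintegral_sub_le hε3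
  obtain ⟨C, hC⟩ := hgc.bounded_above_of_compact_support hgs
  -- The positive part of the approximant is no farther from the nonnegative `f`, and the Scheffé
  -- argument requires nonnegative data.
  set h : Rn n → ℝ := fun x => max (g x) 0
  have hhc : Continuous h := hgc.max continuous_const
  have hhi : Integrable h volume := hgi.pos_part
  have hhC : ∀ x, ‖h x‖ ≤ C := fun x => by
    refine le_trans ?_ (hC x)
    rw [Real.norm_of_nonneg (le_max_right _ _)]
    exact max_le (le_abs_self _) (abs_nonneg _)
  have hfh : ∫⁻ x, ‖f x - h x‖ₑ ≤ ε / 3 := by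
    refine (lintegral_mono fun x => ?_).trans hfg
    rw [enorm_le_iff_norm_le]
    have := abs_max_sub_max_le_abs (f x) (g x) 0
    rwa [max_eq_left (hf0 x)] at this
  have hev := ENNReal.tendsto_nhds_zero.1 (tendsto_lintegral_fokkerPlanckFlow_sub_of_continuous
    hhi (fun x => le_max_right _ _) hhc hhC) (ε / 3) (pos_iff_ne_zero.2 hε3)
  filter_upwards [hev, self_mem_nhdsWithin] with t hte ht
  have hd : Integrable (fun x => f x - h x) volume := hf.sub hhi
  have hm1 : Measurable (fokkerPlanckFlow t fun x => f x - h x) :=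
    (contDiff_fokkerPlanckFlow ht hd).continuous.measurable
  have hm2 : Measurable (fokkerPlanckFlow t h) :=
    (contDiff_fokkerPlanckFlow ht hhi).continuous.measurable
  have hm3 := hhc.measurable
  calc ∫⁻ x, ‖fokkerPlanckFlow t f x - f x‖ₑ
      ≤ ∫⁻ x, (‖fokkerPlanckFlow t (fun x => f x - h x) x‖ₑ +
          (‖fokkerPlanckFlow t h x - h x‖ₑ + ‖f x - h x‖ₑ)) := by
        refine lintegral_mono fun x => ?_
        have : fokkerPlanckFlow t f x - f x = fokkerPlanckFlow t (fun x => f x - h x) x +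
            ((fokkerPlanckFlow t h x - h x) - (f x - h x)) := by
          rw [fokkerPlanckFlow_sub ht hf hhi]
          ring
        rw [this]
        exact (enorm_add_le _ _).trans (by gcongr; exact enorm_sub_le)
    _ = (∫⁻ x, ‖fokkerPlanckFlow t (fun x => f x - h x) x‖ₑ) +
          ((∫⁻ x, ‖fokkerPlanckFlow t h x - h x‖ₑ) + ∫⁻ x, ‖f x - h x‖ₑ) := by
        rw [lintegral_add_left (by fun_prop), lintegral_add_left (by fun_prop)]
    _ ≤ ε / 3 + (ε / 3 + ε / 3) := by
        gcongr
        exact (lintegral_enorm_fokkerPlanckFlow_le ht hd).trans hfh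
    _ = ε := by rw [← add_assoc, ENNReal.add_thirds]

end InitialCondition

theorem isFokkerPlanckSolution_fokkerPlanckFlow {f : Rn n → ℝ} (hf : Integrable f volume)
    (hf0 : ∀ x, 0 ≤ f x) : IsFokkerPlanckSolution f (fun t => fokkerPlanckFlow t f) where
  initial := fokkerPlanckFlow_zero f
  contDiff _ ht := contDiff_fokkerPlanckFlow ht hf
  equation _ ht x := hasDerivAt_fokkerPlanckFlow ht hf x
  tendsto_initial := tendsto_lintegral_fokkerPlanckFlow_sub hf hf0

end FokkerPlanckEquation

theorem theorem1p2 (n : ℕ) (f₀ : Rn n → ℝ) (hf₀_int : Integrable f₀ volume)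
    (hf₀_nonneg : ∀ x, 0 ≤ f₀ x) (hf₀_even : ∀ x, f₀ (-x) = f₀ x)
    (hf₀_ne : ¬ f₀ =ᵐ[volume] 0) :
    IsFokkerPlanckSolution f₀ (fun t => fokkerPlanckFlow t f₀) ∧
    (∀ t₁ t₂ : ℝ, 0 ≤ t₁ → t₁ ≤ t₂ →
      volumeProduct (fokkerPlanckFlow t₁ f₀) ≤ volumeProduct (fokkerPlanckFlow t₂ f₀)) ∧
    volumeProduct f₀ ≤ ENNReal.ofReal ((2 * Real.pi) ^ n) :=
  ⟨isFokkerPlanckSolution_fokkerPlanckFlow hf₀_int hf₀_nonneg,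
    fun _ _ h0 h12 =>
      volumeProduct_fokkerPlanckFlow_mono hf₀_int hf₀_nonneg hf₀_even hf₀_ne h0 h12,
    volumeProduct_le hf₀_int hf₀_nonneg hf₀_even hf₀_ne⟩
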